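/- Let $n\ge 2$ and $\mu>0$. On the Poincaré ball $\mathbb B^n=\{x\in\mathbb R^n:|x|<1\}$ put $dV_{\mathbb H}=\left(\frac{2}{1-|x|^2}\right)^n dx$, $\Delta_{\mathbb H}=\frac{1-|x|^2}{4}\left((1-|x|^2)\Delta_{\mathbb R^n}+2(n-2)\sum_i x_i\partial_{x_i}\right)$, $\rho(x)=\log\frac{1+|x|}{1-|x|}$, and $\rho(x,y)=\rho(T_x(y))$, where $T_a(x)=\frac{|x-a|^2a-(1-|a|^2)(x-a)}{1-2x\cdot a+|x|^2|a|^2}$ is the Möbius translation. For $z\in\mathbb C$ with $\Re z\ge 0$ and $\rho>0$ let $$G_z(\rho)=A_{n,z}\,\frac{(\cosh\rho)^{\frac{n-3}{2}-z}}{(\sinh\rho)^{n-2}}\int_0^\pi\left(1+\frac{\cos t}{\cosh\rho}\right)^{\frac{n-3}{2}-z}(\sin t)^{2z}\,dt,\qquad A_{n,z}=(2\pi)^{-\frac n2}\frac{\Gamma(\frac{n-1}{2}+z)}{2^{z+\frac12}\,\Gamma(z+\frac12)} .$$ The equations below are understood in the sense of distributions on $\mathbb B^n$ (tested against $\varphi\in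 C_c^\infty(\mathbb B^n)$ with respect to $dV_{\mathbb H}$). Let $w$ be either of the two numbers $-\mu\mathrm i$, $\mu\mathrm i$. Then the following hold. 1. (Limiting absorption.) For every $\varepsilon>0$, $G_{\varepsilon+w}(\rho(x,y))$ is the kernel of the $L^2$ resolvent $\left(-\Delta_{\mathbb H}-\frac{(n-1)^2}{4}+(\varepsilon+w)^2\right)^{-1}$: for every $f\in C_c^\infty(\mathbb B^n)$ the integral $u_\varepsilon(x)=\int_{\mathbb B^n}G_{\varepsilon+w}(\rho(x,y))f(y)\,dV_{\mathbb H}(y)$ converges absolutely for every $x\in\mathbb B^n$, and $u_\varepsilon$ is the unique $u\in L^2(\mathbb B^n,dV_{\mathbb H})$ with $-\Delta_{\mathbb H}u-\frac{(n-1)^2}{4}u+(\varepsilon+w)^2u=f$. As $\varepsilon\to0^+$, $G_{\varepsilon+w}(\rho)\to G_w(\rho)$ for every $\rho>0$, and $u_\varepsilon(x)\to\int_{\mathbb B^n}G_w(\rho(x,y))f(y)\,dV_{\mathbb H}(y)$ for every $x\in\mathbb B^n$ and every $f\in C_c^\infty(\mathbb B^n)$. 2. (Singularity at the origin.) $G_w(\rho(\cdot))$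 is locally integrable on $\mathbb B^n$, and $$-\Delta_{\mathbb H}G_w(\rho(y))-\tfrac{(n-1)^2}{4}G_w(\rho(y))-\mu^2G_w(\rho(y))=\delta_0(y),\qquad G_w(\rho(y))=O\!\left(\sinh^{-\frac{n-1}{2}}\rho(y)\right)\ \text{as }\rho(y)\to+\infty .$$ 3. (Singularity at any point.) For every $x\in\mathbb B^n$, $G_w(\rho(x,\cdot))$ is locally integrable on $\mathbb B^n$, and $$(-\Delta_{\mathbb H})_yG_w(\rho(x,y))-\tfrac{(n-1)^2}{4}G_w(\rho(x,y))-\mu^2G_w(\rho(x,y))=\delta_x(y),\qquad G_w(\rho(x,y))=O\!\left(\sinh^{-\frac{n-1}{2}}\rho(y)\right)\ \text{as }\rho(y)\to+\infty .$$ 4. (Outgoing and ingoing.) Let $\partial_\rho$ be the derivative in $y$ along $\rho=\rho(y)$ in geodesic polar coordinates at the origin. For every $x\in\mathbb B^n$ the functions $y\mapsto G_{\mp\mu\mathrm i}(\rho(x,y))$ are differentiable for all $y$ with $\rho(y)$ large, $u=G_{-\mu\mathrm i}(\rho(x,\cdot))$ satisfies the outgoing radiation condition $$\partial_\rho u-\left(\mu\mathrm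 i-\tfrac{n-1}{2}\right)\tanh\!\left(\tfrac{\rho}{2}\right)u=O\!\left(\sinh^{-\frac{n+1}{2}}\rho\right)\quad\text{as }\rho=\rho(y)\to+\infty,$$ and $u=G_{\mu\mathrm i}(\rho(x,\cdot))$ satisfies the ingoing radiation condition $$\partial_\rho u+\left(\mu\mathrm i+\tfrac{n-1}{2}\right)\tanh\!\left(\tfrac{\rho}{2}\right)u=O\!\left(\sinh^{-\frac{n+1}{2}}\rho\right)\quad\text{as }\rho=\rho(y)\to+\infty .$$ -/

import Mathlib

open MeasureTheory Filter Topology Asymptotics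
open scoped ContDiff

noncomputable section

namespace HypScattering

/-- The Euclidean space in which the ball model lives. -/
abbrev E (n : ℕ) : Type := EuclideanSpace ℝ (Fin n)

/-- The underlying set of the Poincaré ball: the open Euclidean unit ball. -/
def pBall (n : ℕ) : Set (E n) := Metric.ball 0 1

/-- The hyperbolic volume `dV = (2 / (1 - |x|²))ⁿ dx` on the unit ball
(no mass outside the ball). -/
def hypVolume (n : ℕ) : Measure (E n) :=
  (volume.restrict (pBall n)).withDensity
    (fun x => ENNReal.ofReal ((2 / (1 - ‖x‖ ^ 2)) ^ n))

/-- The geodesic distance `ρ(x) = log ((1 + |x|) / (1 - |x|))` from the origin. -/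
def rho {n : ℕ} (x : E n) : ℝ := Real.log ((1 + ‖x‖) / (1 - ‖x‖))

/-- The Möbius transformation
`T_a(x) = (|x - a|² a - (1 - |a|²)(x - a)) / (1 - 2 x·a + |x|²|a|²)`. -/
def mobius {n : ℕ} (a x : E n) : E n :=
  (1 - 2 * inner ℝ x a + ‖x‖ ^ 2 * ‖a‖ ^ 2)⁻¹ •
    (‖x - a‖ ^ 2 • a - (1 - ‖a‖ ^ 2) • (x - a))

/-- The geodesic distance `ρ(x, y) = ρ(T_x(y))` of the Poincaré ball. -/
def hypDist {n : ℕ} (x y : E n) : ℝ := rho (mobius x y)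

/-- The Laplace–Beltrami operator of the Poincaré ball,
`Δ_ℍ = (1 - |x|²)/4 · ((1 - |x|²) Δ + 2 (n - 2) x·∇)`. -/
def hypLaplacian {n : ℕ} (u : E n → ℂ) (x : E n) : ℂ :=
  ((1 - ‖x‖ ^ 2) / 4 : ℝ) •
    ((1 - ‖x‖ ^ 2) • Laplacian.laplacian u x + (2 * ((n : ℝ) - 2)) • fderiv ℝ u x x)

/-- The operator `-Δ_ℍ - (n - 1)²/4 + κ`. The Helmholtz operator of wavenumber `μ` is the case
`κ = -μ²`. -/
def shiftedOp {n : ℕ} (κ : ℂ) (u : E n → ℂ) (x : E n) : ℂ :=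
  -hypLaplacian u x - ((n : ℂ) - 1) ^ 2 / 4 * u x + κ * u x

/-- Test functions on the Poincaré ball: smooth complex functions whose support is a compact
subset of the open ball. -/
structure IsTest {n : ℕ} (φ : E n → ℂ) : Prop where
  smooth : ContDiff ℝ ∞ φ
  compact : HasCompactSupport φ
  support_subset : tsupport φ ⊆ pBall n

/-- The constant `A_{n,z} = (2π)^{-n/2} Γ((n-1)/2 + z) / (2^{z+1/2} Γ(z + 1/2))`. -/
def greenConst (n : ℕ) (z : ℂ) : ℂ :=
  ((2 * Real.pi : ℝ) : ℂ) ^ (-(n : ℂ) / 2) * Complex.Gamma (((n : ℂ) - 1) / 2 + z) /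
    ((2 : ℂ) ^ (z + 1 / 2) * Complex.Gamma (z + 1 / 2))

/-- The function
`G_z(ρ) = A_{n,z} (cosh ρ)^{(n-3)/2 - z} / (sinh ρ)^{n-2}
  · ∫_0^π (1 + cos t / cosh ρ)^{(n-3)/2 - z} (sin t)^{2z} dt`. -/
def green (n : ℕ) (z : ℂ) (ρ : ℝ) : ℂ :=
  greenConst n z *
    (((Real.cosh ρ : ℝ) : ℂ) ^ (((n : ℂ) - 3) / 2 - z) /
      ((Real.sinh ρ : ℝ) : ℂ) ^ ((n : ℤ) - 2)) *
    ∫ t in (0 : ℝ)..Real.pi,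
      ((1 + Real.cos t / Real.cosh ρ : ℝ) : ℂ) ^ (((n : ℂ) - 3) / 2 - z) *
        ((Real.sin t : ℝ) : ℂ) ^ (2 * z)

/-- `(-Δ_ℍ - (n - 1)²/4 + κ) g = δ_x` on the Poincaré ball in the sense of distributions. -/
def IsFundamentalSolution {n : ℕ} (κ : ℂ) (x : E n) (g : E n → ℂ) : Prop :=
  LocallyIntegrableOn g (pBall n) (hypVolume n) ∧
    ∀ φ : E n → ℂ, IsTest φ → ∫ y, g y * shiftedOp κ φ y ∂(hypVolume n) = φ x

/-- The regime `ρ(y) → +∞` for points `y` of the Poincaré ball. -/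
def atInfinity (n : ℕ) : Filter (E n) := comap rho atTop ⊓ 𝓟 (pBall n)

/-- The derivative `∂u/∂ρ` in geodesic polar coordinates at the origin; as `|y| = tanh (ρ/2)`, it
is `(1 - |y|²)/2` times the Euclidean derivative in the direction `y / |y|`. -/
def radialDeriv {n : ℕ} (u : E n → ℂ) (y : E n) : ℂ :=
  ((1 - ‖y‖ ^ 2) / 2 : ℝ) • fderiv ℝ u y (‖y‖⁻¹ • y)

/-- The outgoing radiation condition
`∂u/∂ρ - (μ i - (n-1)/2) tanh(ρ/2) u = O(sinh^{-(n+1)/2} ρ)`, with `u` differentiable near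
infinity. -/
def IsOutgoing {n : ℕ} (μ : ℝ) (u : E n → ℂ) : Prop :=
  (∀ᶠ y in atInfinity n, DifferentiableAt ℝ u y) ∧
    (fun y => radialDeriv u y -
        ((μ : ℂ) * Complex.I - ((n : ℂ) - 1) / 2) * ((Real.tanh (rho y / 2) : ℝ) : ℂ) * u y)
      =O[atInfinity n] (fun y => Real.sinh (rho y) ^ (-((n : ℝ) + 1) / 2))

/-- The ingoing radiation condition
`∂u/∂ρ + (μ i + (n-1)/2) tanh(ρ/2) u = O(sinh^{-(n+1)/2} ρ)`, with `u` differentiable near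
infinity. -/
def IsIngoing {n : ℕ} (μ : ℝ) (u : E n → ℂ) : Prop :=
  (∀ᶠ y in atInfinity n, DifferentiableAt ℝ u y) ∧
    (fun y => radialDeriv u y +
        ((μ : ℂ) * Complex.I + ((n : ℂ) - 1) / 2) * ((Real.tanh (rho y / 2) : ℝ) : ℂ) * u y)
      =O[atInfinity n] (fun y => Real.sinh (rho y) ^ (-((n : ℝ) + 1) / 2))

/-- `u ∈ L²(dV)` solves `(-Δ_ℍ - (n - 1)²/4 + κ) u = f` in the sense of distributions. -/
def IsL2Solution {n : ℕ} (κ : ℂ) (f u : E n → ℂ) : Prop :=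
  MemLp u 2 (hypVolume n) ∧
    ∀ φ : E n → ℂ, IsTest φ →
      ∫ y, u y * shiftedOp κ φ y ∂(hypVolume n) = ∫ y, f y * φ y ∂(hypVolume n)

/-- `K` is the integral kernel of the `L²` resolvent `(-Δ_ℍ - (n - 1)²/4 + κ)⁻¹`: for each test
function `f`, the integral `∫ K(x, y) f(y) dV(y)` converges absolutely for every `x` in the ball,
and as a function of `x` it is the one and only `L²` solution of
`(-Δ_ℍ - (n - 1)²/4 + κ) u = f`. -/
def IsResolventKernel {n : ℕ} (κ : ℂ) (K : E n → E n → ℂ) : Prop :=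
  ∀ f : E n → ℂ, IsTest f →
    (∀ x ∈ pBall n, Integrable (fun y => K x y * f y) (hypVolume n)) ∧
    IsL2Solution κ f (fun x => ∫ y, K x y * f y ∂(hypVolume n)) ∧
    ∀ v : E n → ℂ, IsL2Solution κ f v →
      v =ᵐ[hypVolume n] fun x => ∫ y, K x y * f y ∂(hypVolume n)

/-- Limiting absorption along `z_ε = ε + w`, `ε → 0⁺`: for `ε > 0` the kernel of the resolvent
`(-Δ_ℍ - (n - 1)²/4 + (ε + w)²)⁻¹` is `G_{ε+w}(ρ(x, y))`; as `ε → 0⁺` these kernels converge to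
`G_w(ρ(x, y))` off the diagonal, and the resolvents applied to a test function converge pointwise
to the integral operator with kernel `G_w(ρ(x, y))`. -/
def IsLimitingAbsorption (n : ℕ) (w : ℂ) : Prop :=
  (∀ ε : ℝ, 0 < ε →
    IsResolventKernel (n := n) (((ε : ℂ) + w) ^ 2) (fun x y => green n ((ε : ℂ) + w) (hypDist x y))) ∧
  (∀ ρ : ℝ, 0 < ρ →
    Tendsto (fun ε : ℝ => green n ((ε : ℂ) + w) ρ) (𝓝[>] 0) (𝓝 (green n w ρ))) ∧
  (∀ f : E n → ℂ, IsTest f → ∀ x ∈ pBall n,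
    Tendsto (fun ε : ℝ => ∫ y, green n ((ε : ℂ) + w) (hypDist x y) * f y ∂(hypVolume n))
      (𝓝[>] 0) (𝓝 (∫ y, green n w (hypDist x y) * f y ∂(hypVolume n))))

end HypScattering

end

/-!
Everything is done in the variable `C = cosh ρ(x, y)`, which is a rational function of the points
`x` and `y` of the ball (`coshDist`, `cosh_hypDist`). In this variable the Green function of
dimension `n` is a constant times `(C² - 1)^{-(n-2)/2}` times the Legendre-type integral
`∫_0^π (C + cos t)^{(n-3)/2 - z} (sin t)^{2z} dt`, and an integration by parts in `t` gives the
three-term recurrence `legInt_recurrence`. With the normalisation `A_{n,z}` the recurrence says that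
differentiation in `C` moves up by two dimensions, `g_n' = -2π g_{n+2}` (`hasDerivAt_greenC`), and
that `g_n` solves the radial equation `(C² - 1) g'' + n C g' + ((n-1)²/4 - z²) g = 0` (`greenC_ode`).
Since `Δ_ℍ (q ∘ C) = (C² - 1) q'' + n C q'` (`hypLaplacian_comp_coshDist`), the Green function solves
the homogeneous equation off the diagonal. All derivatives of `g_n` are Green functions of higher
dimension, so one family of size bounds (`norm_greenC_le`, `norm_greenC_le_crude`) serves throughout.

*The point mass.* The regularised function `g(C + δ)` is smooth across the diagonal, and by the
radial equation the operator maps it to a combination `regErr` of `g_{n+2}(C + δ)` and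
`g_{n+4}(C + δ)` with coefficients of order `δ`. For `δ = s²`, in the variable `ζ = (y - x)/s` and
times `sⁿ`, this converges to a multiple of the profile `(2|ζ|² + 1)^{-(n/2+1)}`, up to a dilation
that depends on `x`; so it is an approximate identity. Its mass is one because the
integral at `C = 1` is an Euler Beta integral (`legInt_one`), whose Gamma factors cancel those
of `A_{n,z}` (`greenConst_mul_legInt_one`, `profile_mass_normalised`). Green's identity for the
regularised function and the limit `s → 0` give `isFundamentalSolution_green`. The logarithmic
singularity of dimension two need only be integrable, since the leading coefficients that enter the
limit are those of `g_{n+2}` and `g_{n+4}`.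

*Behaviour at infinity.* For fixed `x` the function `C` is comparable to `cosh ρ(y)`, which turns
the bounds in `C` into bounds in `sinh ρ(y)`. For the radiation conditions, the leading terms of
`C g'` and `-((n-1)/2 + z) g` cancel (`norm_radiation_greenC_le`), and `∂C/∂ρ - C` is bounded
(`radial_coshDist`).

*Limiting absorption.* For `Re z > 0` the Green potential of a test function is
`O((cosh ρ)^{-(n-1)/2 - Re z})`, which is square integrable (`memLp_decay`), and Fubini makes it a
weak solution (`isL2Solution_greenC`). Uniqueness in `L²` needs no spectral theory: the regularised
Green function with pole `y`, cut off where `C` exceeds `1/s`, is a test function. Testing a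
homogeneous solution `u` against it, integrating in `y` against a test function `f`, and letting
`s → 0` gives `∫ u f dV = 0` (`integral_mul_eq_zero_of_homogeneous`); the truncation costs only terms
dominated by the same square integrable function. The limits `ε → 0⁺` are dominated convergence.
-/

namespace HypScattering

/-! ### The Legendre-type integral -/

/-- The integrand `(C + cos t)^a (sin t)^{2z}` of the Green function, with `C` standing for
`cosh ρ`. The power of `cosh ρ` in front of the integral is absorbed: with it the factor
`1 + cos t / cosh ρ` becomes `C + cos t`. -/
noncomputable def legKer (a z : ℂ) (C t : ℝ) : ℂ :=
  ((C + Real.cos t : ℝ) : ℂ) ^ a * ((Real.sin t : ℝ) : ℂ) ^ (2 * z)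

/-- The Legendre-type integral `∫_0^π (C + cos t)^a (sin t)^{2z} dt`. The open interval keeps the
bases of both powers positive, also at `C = 1`. -/
noncomputable def legInt (a z : ℂ) (C : ℝ) : ℂ :=
  ∫ t in Set.Ioo 0 Real.pi, legKer a z C t

/-- The chain rule for a complex power of a positive real function; for the base `cos`, `sin` and
`C + cos` this avoids the branch cut. -/
theorem hasDerivAt_ofReal_cpow {f : ℝ → ℝ} {f' x : ℝ} (a : ℂ) (hf : HasDerivAt f f' x)
    (hx : 0 < f x) :
    HasDerivAt (fun t => (f t : ℂ) ^ a) (a * (f x : ℂ) ^ (a - 1) * (f' : ℂ)) x := by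
  have h1 : HasDerivAt (fun y : ℂ => y ^ a) (a * (f x : ℂ) ^ (a - 1)) (f x : ℂ) := by
    have := (hasDerivAt_id (f x : ℂ)).cpow_const (c := a) (Complex.ofReal_mem_slitPlane.2 hx)
    simpa using this
  exact h1.comp x hf.ofReal_comp

theorem neg_one_lt_cos {t : ℝ} (ht : t ∈ Set.Ioo 0 Real.pi) : -1 < Real.cos t := by
  have := Real.strictAntiOn_cos ⟨ht.1.le, ht.2.le⟩ ⟨Real.pi_pos.le, le_refl _⟩ ht.2
  simpa using this

theorem add_cos_pos {C t : ℝ} (hC : 1 ≤ C) (ht : t ∈ Set.Ioo 0 Real.pi) : 0 < C + Real.cos t := by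
  linarith [neg_one_lt_cos ht]

theorem sin_pos_of_mem {t : ℝ} (ht : t ∈ Set.Ioo 0 Real.pi) : 0 < Real.sin t :=
  Real.sin_pos_of_mem_Ioo ht

theorem norm_legKer (a z : ℂ) {C t : ℝ} (hC : 1 ≤ C) (ht : t ∈ Set.Ioo 0 Real.pi) :
    ‖legKer a z C t‖ = (C + Real.cos t) ^ a.re * Real.sin t ^ (2 * z.re) := by
  rw [legKer, norm_mul, Complex.norm_cpow_eq_rpow_re_of_pos (add_cos_pos hC ht),
    Complex.norm_cpow_eq_rpow_re_of_pos (sin_pos_of_mem ht)]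
  simp

theorem continuousOn_legKer (a z : ℂ) {C : ℝ} (hC : 1 ≤ C) :
    ContinuousOn (legKer a z C) (Set.Ioo 0 Real.pi) := by
  intro t ht
  have h1 := hasDerivAt_ofReal_cpow a ((Real.hasDerivAt_cos t).const_add C) (add_cos_pos hC ht)
  have h2 := hasDerivAt_ofReal_cpow (2 * z) (Real.hasDerivAt_sin t) (sin_pos_of_mem ht)
  exact (h1.continuousAt.mul h2.continuousAt).continuousWithinAt

theorem aestronglyMeasurable_legKer (a z : ℂ) {C : ℝ} (hC : 1 ≤ C) :
    AEStronglyMeasurable (legKer a z C) (volume.restrict (Set.Ioo 0 Real.pi)) :=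
  (continuousOn_legKer a z hC).aestronglyMeasurable measurableSet_Ioo

theorem rpow_le_add_of_mem_Icc {m P M : ℝ} (r : ℝ) (hm : 0 < m) (h1 : m ≤ P) (h2 : P ≤ M) :
    P ^ r ≤ m ^ r + M ^ r := by
  have hM : 0 < M := by linarith
  rcases le_total 0 r with h | h
  · have := Real.rpow_le_rpow (hm.le.trans h1) h2 h
    have := Real.rpow_nonneg hm.le r
    linarith
  · have := Real.rpow_le_rpow_of_nonpos hm h1 h
    have := Real.rpow_nonneg hM.le r
    linarith

theorem sin_rpow_le_one {t r : ℝ} (ht : t ∈ Set.Ioo 0 Real.pi) (hr : 0 ≤ r) :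
    Real.sin t ^ r ≤ 1 :=
  Real.rpow_le_one (sin_pos_of_mem ht).le (Real.sin_le_one t) hr

theorem norm_legKer_le (a : ℂ) {z : ℂ} (hz : 0 ≤ z.re) {m M C t : ℝ} (hm : 1 < m) (h1 : m ≤ C)
    (h2 : C ≤ M) (ht : t ∈ Set.Ioo 0 Real.pi) :
    ‖legKer a z C t‖ ≤ (m - 1) ^ a.re + (M + 1) ^ a.re := by
  rw [norm_legKer a z (by linarith) ht]
  have h3 := rpow_le_add_of_mem_Icc (P := C + Real.cos t) (M := M + 1) a.re (sub_pos.2 hm)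
    (by linarith [Real.neg_one_le_cos t]) (by linarith [Real.cos_le_one t])
  have h4 := sin_rpow_le_one ht (r := 2 * z.re) (by linarith)
  have h5 := Real.rpow_nonneg (add_cos_pos (hm.le.trans h1) ht).le a.re
  have h6 := Real.rpow_nonneg (sin_pos_of_mem ht).le (2 * z.re)
  nlinarith

theorem integrableOn_Ioo_of_bound {f : ℝ → ℂ} {B : ℝ}
    (hf : AEStronglyMeasurable f (volume.restrict (Set.Ioo 0 Real.pi)))
    (h : ∀ t ∈ Set.Ioo 0 Real.pi, ‖f t‖ ≤ B) : IntegrableOn f (Set.Ioo 0 Real.pi) := by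
  refine Integrable.mono' (g := fun _ => B) (by simp) hf ?_
  exact (ae_restrict_iff' measurableSet_Ioo).2 (Eventually.of_forall h)

theorem integrableOn_legKer (a : ℂ) {z : ℂ} (hz : 0 ≤ z.re) {C : ℝ} (hC : 1 < C) :
    IntegrableOn (legKer a z C) (Set.Ioo 0 Real.pi) :=
  integrableOn_Ioo_of_bound (aestronglyMeasurable_legKer a z hC.le)
    fun _ ht => norm_legKer_le a hz hC le_rfl le_rfl ht

theorem norm_setIntegral_Ioo_le {f : ℝ → ℂ} {B : ℝ}
    (h : ∀ t ∈ Set.Ioo 0 Real.pi, ‖f t‖ ≤ B) : ‖∫ t in Set.Ioo 0 Real.pi, f t‖ ≤ B * Real.pi := by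
  have := norm_setIntegral_le_of_norm_le_const (μ := volume) (s := Set.Ioo 0 Real.pi) (by simp) h
  simpa [Real.pi_pos.le] using this

theorem hasDerivAt_legInt (a : ℂ) {z : ℂ} (hz : 0 ≤ z.re) {C₀ : ℝ} (hC : 1 < C₀) :
    HasDerivAt (legInt a z) (a * legInt (a - 1) z C₀) C₀ := by
  have hm : 1 < (1 + C₀) / 2 := by linarith
  have key := hasDerivAt_integral_of_dominated_loc_of_deriv_le
    (μ := volume.restrict (Set.Ioo 0 Real.pi)) (F := fun C t => legKer a z C t)
    (F' := fun C t => a * legKer (a - 1) z C t) (x₀ := C₀)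
    (bound := fun _ => ‖a‖ * (((1 + C₀) / 2 - 1) ^ (a - 1).re + (C₀ + 1 + 1) ^ (a - 1).re))
    (s := Set.Ioo ((1 + C₀) / 2) (C₀ + 1))
    (Ioo_mem_nhds (by linarith) (by linarith))
    (by
      filter_upwards [lt_mem_nhds hC] with C h
      exact aestronglyMeasurable_legKer a z h.le)
    (integrableOn_legKer a hz hC)
    ((aestronglyMeasurable_legKer (a - 1) z hC.le).const_mul a)
    (by
      refine (ae_restrict_iff' measurableSet_Ioo).2 (Eventually.of_forall fun t ht C hCs => ?_)
      rw [norm_mul]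
      gcongr
      exact norm_legKer_le (a - 1) hz hm hCs.1.le hCs.2.le ht)
    (integrableOn_const (by simp))
    (by
      refine (ae_restrict_iff' measurableSet_Ioo).2 (Eventually.of_forall fun t ht C hCs => ?_)
      have hC1 : 1 ≤ C := by linarith [hCs.1]
      have h1 := hasDerivAt_ofReal_cpow (f := fun C => C + Real.cos t) a
        ((hasDerivAt_id' C).add_const (Real.cos t)) (add_cos_pos hC1 ht)
      have h2 := h1.mul_const (((Real.sin t : ℝ) : ℂ) ^ (2 * z))
      refine h2.congr_deriv ?_
      simp [legKer]; ring)
  have h := key.2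
  rw [integral_const_mul] at h
  exact h

/-- The boundary terms vanish in `∫_0^π d/dt[(C + cos t)^a (sin t)^{2z+1}] dt = 0`. -/
theorem legInt_by_parts (a : ℂ) {z : ℂ} (hz : 0 ≤ z.re) {C : ℝ} (hC : 1 < C) :
    ∫ t in Set.Ioo 0 Real.pi, (-(a * (Real.sin t : ℂ) ^ 2 * legKer (a - 1) z C t) +
      (2 * z + 1) * Real.cos t * legKer a z C t) = 0 := by
  rw [← integral_Ioc_eq_integral_Ioo, ← intervalIntegral.integral_of_le Real.pi_pos.le]
  have hpos : ∀ t, 0 < C + Real.cos t := fun t => by linarith [Real.neg_one_le_cos t]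
  have hz1 : 0 < (2 * z + 1).re := by simp; linarith
  have hzne : (2 * z + 1) ≠ 0 := fun h => by rw [h] at hz1; simp at hz1
  have hcont : Continuous fun t : ℝ => ((C + Real.cos t : ℝ) : ℂ) ^ a *
      ((Real.sin t : ℝ) : ℂ) ^ (2 * z + 1) := by
    refine Continuous.mul ?_ ((Complex.continuous_ofReal_cpow_const hz1).comp Real.continuous_sin)
    exact continuous_iff_continuousAt.2 fun t =>
      (hasDerivAt_ofReal_cpow a ((Real.hasDerivAt_cos t).const_add C) (hpos t)).continuousAt
  rw [intervalIntegral.integral_eq_sub_of_hasDerivAt_of_le Real.pi_pos.le hcont.continuousOn]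
  · simp [Complex.zero_cpow hzne]
  · intro t ht
    have h1 := hasDerivAt_ofReal_cpow a ((Real.hasDerivAt_cos t).const_add C) (hpos t)
    have h2 := hasDerivAt_ofReal_cpow (2 * z + 1) (Real.hasDerivAt_sin t) (sin_pos_of_mem ht)
    refine (h1.mul h2).congr_deriv ?_
    have hs : ((Real.sin t : ℝ) : ℂ) ≠ 0 := by exact_mod_cast (sin_pos_of_mem ht).ne'
    rw [Complex.cpow_add _ _ hs]
    simp only [legKer, Complex.cpow_one, add_sub_cancel_right, Complex.ofReal_neg]
    ring
  · rw [intervalIntegrable_iff_integrableOn_Ioo_of_le Real.pi_pos.le]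
    refine Integrable.add (Integrable.neg ?_) ?_
    · refine (integrableOn_legKer (a - 1) hz hC).bdd_mul (c := ‖a‖) ?_ ?_
      · fun_prop
      · refine Eventually.of_forall fun t => ?_
        rw [norm_mul, norm_pow, Complex.norm_real, Real.norm_eq_abs, sq_abs]
        exact mul_le_of_le_one_right (norm_nonneg _) (Real.sin_sq_le_one t)
    · refine (integrableOn_legKer a hz hC).bdd_mul (c := ‖2 * z + 1‖) ?_ ?_
      · fun_prop
      · refine Eventually.of_forall fun t => ?_
        rw [norm_mul, Complex.norm_real, Real.norm_eq_abs]
        exact mul_le_of_le_one_right (norm_nonneg _) (Real.abs_cos_le_one t)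

theorem legKer_add_one (a z : ℂ) {C t : ℝ} (hC : 1 < C) :
    legKer (a + 1) z C t = (C + Real.cos t) * legKer a z C t := by
  have h : ((C + Real.cos t : ℝ) : ℂ) ≠ 0 := by
    exact_mod_cast (by linarith [Real.neg_one_le_cos t] : 0 < C + Real.cos t).ne'
  rw [legKer, Complex.cpow_add _ _ h, legKer, Complex.cpow_one]
  push_cast; ring

/-- The three-term recurrence of the Legendre-type integrals: `legInt_by_parts` rewritten with
`sin² t = 1 - cos² t` and `cos t = (C + cos t) - C`. -/
theorem legInt_recurrence (a : ℂ) {z : ℂ} (hz : 0 ≤ z.re) {C : ℝ} (hC : 1 < C) :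
    ((C : ℂ) ^ 2 - 1) * (a * legInt (a - 1) z C) =
      (2 * a + 1 + 2 * z) * C * legInt a z C - (a + 2 * z + 1) * legInt (a + 1) z C := by
  have i0 := integrableOn_legKer (a - 1) hz hC
  have i1 := integrableOn_legKer a hz hC
  have i2 := integrableOn_legKer (a + 1) hz hC
  have h := legInt_by_parts a hz hC
  have hk : ∀ t, -(a * (Real.sin t : ℂ) ^ 2 * legKer (a - 1) z C t) +
      (2 * z + 1) * Real.cos t * legKer a z C t =
      ((C : ℂ) ^ 2 - 1) * a * legKer (a - 1) z C t
        + (a + 2 * z + 1) * legKer (a + 1) z C t - (2 * a + 1 + 2 * z) * C * legKer a z C t := by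
    intro t
    have e1 : legKer a z C t = (C + Real.cos t) * legKer (a - 1) z C t := by
      have := legKer_add_one (a - 1) z (t := t) hC
      rwa [sub_add_cancel] at this
    have e2 : ((Real.sin t : ℝ) : ℂ) ^ 2 = 1 - ((Real.cos t : ℝ) : ℂ) ^ 2 := by
      exact_mod_cast Real.sin_sq t
    rw [legKer_add_one a z hC, e1, e2]
    ring
  simp_rw [hk] at h
  have i02 : IntegrableOn (fun t => ((C : ℂ) ^ 2 - 1) * a * legKer (a - 1) z C t
      + (a + 2 * z + 1) * legKer (a + 1) z C t) (Set.Ioo 0 Real.pi) :=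
    (i0.const_mul _).add (i2.const_mul _)
  rw [integral_sub i02 (i1.const_mul _),
    integral_add (i0.const_mul _) (i2.const_mul _), integral_const_mul, integral_const_mul,
    integral_const_mul] at h
  simp only [legInt]
  linear_combination h

/-! ### The Green function in the variable `C = cosh ρ` -/

/-- The Green function `G_z` as a function of `C = cosh ρ`. -/
noncomputable def greenC (n : ℕ) (z : ℂ) (C : ℝ) : ℂ :=
  greenConst n z * (((C ^ 2 - 1) ^ (-((n : ℝ) - 2) / 2) : ℝ) : ℂ) *
    legInt (((n : ℂ) - 3) / 2 - z) z C

theorem cosh_cpow_mul_integrand (a z : ℂ) {ρ : ℝ} (t : ℝ) :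
    ((Real.cosh ρ : ℝ) : ℂ) ^ a * (((1 + Real.cos t / Real.cosh ρ : ℝ) : ℂ) ^ a *
        ((Real.sin t : ℝ) : ℂ) ^ (2 * z)) = legKer a z (Real.cosh ρ) t := by
  have hc := Real.cosh_pos ρ
  have h1 : 0 ≤ 1 + Real.cos t / Real.cosh ρ := by
    have : -1 ≤ Real.cos t / Real.cosh ρ := by
      rw [le_div_iff₀ hc]; linarith [Real.neg_one_le_cos t, Real.one_le_cosh ρ]
    linarith
  rw [legKer, ← mul_assoc, ← Complex.mul_cpow_ofReal_nonneg hc.le h1]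
  congr 3
  rw [← Complex.ofReal_mul]
  congr 1
  field_simp

theorem green_eq_greenC (n : ℕ) (z : ℂ) {ρ : ℝ} (hρ : 0 < ρ) :
    green n z ρ = greenC n z (Real.cosh ρ) := by
  have hs : 0 < Real.sinh ρ := Real.sinh_pos_iff.2 hρ
  have h1 : (((Real.cosh ρ ^ 2 - 1) ^ (-((n : ℝ) - 2) / 2) : ℝ) : ℂ) =
      (((Real.sinh ρ : ℝ) : ℂ) ^ ((n : ℤ) - 2))⁻¹ := by
    have : Real.cosh ρ ^ 2 - 1 = Real.sinh ρ ^ (2 : ℝ) := by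
      rw [Real.rpow_two, Real.cosh_sq]; ring
    rw [this, ← Real.rpow_mul hs.le]
    have e : (2 : ℝ) * (-((n : ℝ) - 2) / 2) = ((-((n : ℤ) - 2) : ℤ) : ℝ) := by push_cast; ring
    rw [e, Real.rpow_intCast, zpow_neg]
    push_cast; rfl
  rw [green, greenC, legInt, h1, intervalIntegral.integral_of_le Real.pi_pos.le,
    integral_Ioc_eq_integral_Ioo]
  simp_rw [← cosh_cpow_mul_integrand, integral_const_mul]
  rw [div_eq_mul_inv]
  ring

/-- The functional equation of `Γ`, applied to the normalising constants. -/
theorem greenConst_add_two {n : ℕ} (hn : 2 ≤ n) {z : ℂ} (hz : 0 ≤ z.re) :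
    2 * Real.pi * greenConst (n + 2) z = (((n : ℂ) - 1) / 2 + z) * greenConst n z := by
  have hn' : (2 : ℝ) ≤ n := by exact_mod_cast hn
  have hb : ((n : ℂ) - 1) / 2 + z ≠ 0 := by
    intro h
    have := congrArg Complex.re h
    simp at this
    linarith
  have hpi : ((2 * Real.pi : ℝ) : ℂ) ≠ 0 := by exact_mod_cast (by positivity)
  have e1 : (((n + 2 : ℕ) : ℂ) - 1) / 2 + z = (((n : ℂ) - 1) / 2 + z) + 1 := by push_cast; ring
  have e2 : -((n + 2 : ℕ) : ℂ) / 2 = -(n : ℂ) / 2 - 1 := by push_cast; ring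
  rw [greenConst, greenConst, e1, e2, Complex.Gamma_add_one _ hb, Complex.cpow_sub _ _ hpi,
    Complex.cpow_one]
  have hpi' : (Real.pi : ℂ) ≠ 0 := by exact_mod_cast Real.pi_ne_zero
  push_cast
  field_simp

theorem one_lt_sq_sub {C : ℝ} (hC : 1 < C) : 0 < C ^ 2 - 1 := by nlinarith

theorem rpow_shift {C : ℝ} (hC : 1 < C) (n : ℕ) :
    (C ^ 2 - 1) ^ (-(((n + 2 : ℕ) : ℝ) - 2) / 2) =
      (C ^ 2 - 1) ^ (-((n : ℝ) - 2) / 2) / (C ^ 2 - 1) := by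
  have e : -(((n + 2 : ℕ) : ℝ) - 2) / 2 = -((n : ℝ) - 2) / 2 - 1 := by push_cast; ring
  rw [e, Real.rpow_sub_one (one_lt_sq_sub hC).ne']

/-- Differentiation in `C = cosh ρ` raises the dimension by two. -/
theorem hasDerivAt_greenC {n : ℕ} (hn : 2 ≤ n) {z : ℂ} (hz : 0 ≤ z.re) {C : ℝ} (hC : 1 < C) :
    HasDerivAt (greenC n z) (-(2 * Real.pi) * greenC (n + 2) z C) C := by
  have hp := one_lt_sq_sub hC
  have h1 : HasDerivAt (fun C : ℝ => (C ^ 2 - 1) ^ (-((n : ℝ) - 2) / 2))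
      (2 * C * (-((n : ℝ) - 2) / 2) * (C ^ 2 - 1) ^ (-((n : ℝ) - 2) / 2 - 1)) C := by
    have := ((hasDerivAt_pow 2 C).sub_const 1).rpow_const (p := -((n : ℝ) - 2) / 2)
      (Or.inl hp.ne')
    simpa using this
  have h2 := hasDerivAt_legInt (((n : ℂ) - 3) / 2 - z) hz hC
  have h3 := (h1.ofReal_comp.const_mul (greenConst n z)).mul h2
  refine h3.congr_deriv ?_
  have hpc : (C : ℂ) ^ 2 - 1 ≠ 0 := by exact_mod_cast hp.ne'
  have hr := legInt_recurrence (((n : ℂ) - 3) / 2 - z) hz hC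
  have hA := greenConst_add_two hn hz
  have e : ((n + 2 : ℕ) : ℂ) = n + 2 := by push_cast; ring
  have e' : ((n : ℂ) + 2 - 3) / 2 - z = ((n : ℂ) - 3) / 2 - z + 1 := by ring
  rw [Real.rpow_sub_one hp.ne', greenC, rpow_shift hC, e, e']
  generalize legInt (((n : ℂ) - 3) / 2 - z) z C = I0 at *
  generalize legInt (((n : ℂ) - 3) / 2 - z - 1) z C = Im at *
  generalize legInt (((n : ℂ) - 3) / 2 - z + 1) z C = Ip at *
  generalize (C ^ 2 - 1) ^ (-((n : ℝ) - 2) / 2) = p at *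
  push_cast
  field_simp
  linear_combination (2 * greenConst n z * p) * hr + 2 * p * Ip * hA

/-- The radial equation `(C² - 1) g'' + n C g' + ((n-1)²/4 - z²) g = 0`, with the derivatives
expressed through the Green functions in dimensions `n + 2` and `n + 4`. -/
theorem greenC_ode {n : ℕ} (hn : 2 ≤ n) {z : ℂ} (hz : 0 ≤ z.re) {C : ℝ} (hC : 1 < C) :
    ((C : ℂ) ^ 2 - 1) * ((2 * Real.pi) ^ 2 * greenC (n + 4) z C) -
      n * C * (2 * Real.pi * greenC (n + 2) z C) +
      (((n : ℂ) - 1) ^ 2 / 4 - z ^ 2) * greenC n z C = 0 := by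
  have hp := one_lt_sq_sub hC
  have hpc : (C : ℂ) ^ 2 - 1 ≠ 0 := by exact_mod_cast hp.ne'
  have hr := legInt_recurrence (((n : ℂ) - 3) / 2 - z + 1) hz hC
  have hA := greenConst_add_two hn hz
  have hA' := greenConst_add_two (n := n + 2) (by omega) hz
  have e4 : ((n + 2 + 2 : ℕ) : ℂ) = n + 4 := by push_cast; ring
  have e : ((n + 2 : ℕ) : ℂ) = n + 2 := by push_cast; ring
  have e' : ((n : ℂ) + 2 - 3) / 2 - z = ((n : ℂ) - 3) / 2 - z + 1 := by ring
  have e4' : ((n : ℂ) + 4 - 3) / 2 - z = ((n : ℂ) - 3) / 2 - z + 1 + 1 := by ring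
  have em : ((n : ℂ) - 3) / 2 - z + 1 - 1 = ((n : ℂ) - 3) / 2 - z := by ring
  rw [show n + 4 = n + 2 + 2 from rfl, greenC, greenC, greenC, rpow_shift hC, rpow_shift hC, e4, e,
    e', e4']
  rw [em] at hr
  rw [e] at hA'
  generalize legInt (((n : ℂ) - 3) / 2 - z) z C = I0 at *
  generalize legInt (((n : ℂ) - 3) / 2 - z + 1 + 1) z C = Ipp at *
  generalize legInt (((n : ℂ) - 3) / 2 - z + 1) z C = Ip at *
  generalize (C ^ 2 - 1) ^ (-((n : ℝ) - 2) / 2) = p at *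
  have hA2 : (2 * Real.pi : ℂ) ^ 2 * greenConst (n + 2 + 2) z =
      (((n : ℂ) + 1) / 2 + z) * ((((n : ℂ) - 1) / 2 + z) * greenConst n z) := by
    rw [← hA]; linear_combination (2 * Real.pi : ℂ) * hA'
  have hA1 : (2 * Real.pi : ℂ) * greenConst (n + 2) z =
    (((n : ℂ) - 1) / 2 + z) * greenConst n z := hA
  push_cast
  have r1 : ((C : ℂ) ^ 2 - 1) * ((2 * Real.pi) ^ 2 * (greenConst (n + 2 + 2) z *
      (p / (C ^ 2 - 1) / (C ^ 2 - 1)) * Ipp)) =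
      ((2 * Real.pi : ℂ) ^ 2 * greenConst (n + 2 + 2) z) * p * Ipp / (C ^ 2 - 1) := by
    field_simp
  have r2 : n * C * (2 * Real.pi * (greenConst (n + 2) z * (p / (C ^ 2 - 1)) * Ip)) =
      (2 * Real.pi : ℂ) * greenConst (n + 2) z * (n * C * p * Ip / (C ^ 2 - 1)) := by
    field_simp
  rw [r1, r2, hA2, hA1]
  field_simp
  linear_combination (8 * greenConst n z * p * ((n : ℂ) - 1 + 2 * z)) * hr

/-! ### Pointwise bounds -/

/-- The bound behind the decay: `sin² t / (C + cos t) ≤ 2 / C`, uniformly in `t`. -/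
theorem sin_sq_mul_le {C t : ℝ} (hC : 1 ≤ C) : Real.sin t ^ 2 * C ≤ 2 * (C + Real.cos t) := by
  have h := Real.sin_sq_add_cos_sq t
  have h1 := Real.neg_one_le_cos t
  have h2 := Real.cos_le_one t
  set c := Real.cos t
  have : Real.sin t ^ 2 = (1 - c) * (1 + c) := by linarith
  rw [this]
  rcases le_total 0 c with h0 | h0
  · nlinarith [mul_nonneg (sq_nonneg c) (by linarith : 0 ≤ C)]
  · nlinarith [mul_nonneg (by linarith : 0 ≤ 1 - c) (mul_nonneg (by linarith : 0 ≤ -c)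
      (by linarith : 0 ≤ C - 1)), mul_nonneg (by linarith : 0 ≤ 1 + c) (by linarith : 0 ≤ C + c)]

/-- The exponent `-z` of `C + cos t` is paired with the exponent `2z` of `sin t`; their product is
at most `(2 / C)^{Re z}`. This is uniform down to `C = 1`, where `C + cos t` degenerates. -/
theorem norm_legKer_le_decay (b : ℝ) {z : ℂ} (hz : 0 ≤ z.re) {C t : ℝ} (hC : 1 ≤ C)
    (ht : t ∈ Set.Ioo 0 Real.pi) :
    ‖legKer (b - z) z C t‖ ≤ (C + Real.cos t) ^ b * (2 / C) ^ z.re := by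
  have hP := add_cos_pos hC ht
  have hs := sin_pos_of_mem ht
  rw [norm_legKer _ _ hC ht, Real.rpow_mul hs.le, Real.rpow_two]
  simp only [Complex.sub_re, Complex.ofReal_re]
  rw [Real.rpow_sub hP, div_mul_eq_mul_div, mul_div_assoc, ← Real.div_rpow (by positivity) hP.le]
  refine mul_le_mul_of_nonneg_left (Real.rpow_le_rpow (by positivity) ?_ hz) (by positivity)
  rw [div_le_div_iff₀ hP (by linarith)]
  exact sin_sq_mul_le hC

theorem half_cast (n : ℕ) : (((n : ℂ) - 3) / 2) = (((((n : ℝ) - 3) / 2 : ℝ)) : ℂ) := by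
  push_cast; ring

/-- The constant in the pointwise bounds of the Green function; it is continuous in `z`, which makes
the bounds uniform as the absorption tends to zero. -/
noncomputable def greenBd (n : ℕ) (z : ℂ) : ℝ :=
  ‖greenConst n z‖ * (Real.pi * 2 ^ n * 2 ^ z.re)

theorem greenBd_nonneg (n : ℕ) (z : ℂ) : 0 ≤ greenBd n z := by
  unfold greenBd; positivity

theorem norm_legInt_le {n : ℕ} (hn : 3 ≤ n) {z : ℂ} (hz : 0 ≤ z.re) {C : ℝ} (hC : 1 ≤ C) :
    ‖legInt (((n : ℂ) - 3) / 2 - z) z C‖ ≤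
      (2 ^ n * C ^ (((n : ℝ) - 3) / 2)) * (2 / C) ^ z.re * Real.pi := by
  have hn' : (3 : ℝ) ≤ n := by exact_mod_cast hn
  refine norm_setIntegral_Ioo_le fun t ht => ?_
  rw [half_cast]
  refine (norm_legKer_le_decay _ hz hC ht).trans ?_
  gcongr
  calc (C + Real.cos t) ^ (((n : ℝ) - 3) / 2) ≤ (2 * C) ^ (((n : ℝ) - 3) / 2) :=
        Real.rpow_le_rpow (add_cos_pos hC ht).le (by linarith [Real.cos_le_one t]) (by linarith)
    _ = 2 ^ (((n : ℝ) - 3) / 2) * C ^ (((n : ℝ) - 3) / 2) :=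
        Real.mul_rpow (by norm_num) (by linarith)
    _ ≤ _ := by
        gcongr
        rw [← Real.rpow_natCast]
        exact Real.rpow_le_rpow_of_exponent_le (by norm_num) (by linarith)

/-- The bound with the sharp orders at `C = 1` and at infinity, in dimension at least three. -/
theorem norm_greenC_le {n : ℕ} (hn : 3 ≤ n) {z : ℂ} (hz : 0 ≤ z.re) {C : ℝ} (hC : 1 < C) :
    ‖greenC n z C‖ ≤ greenBd n z * (C / (C - 1)) ^ (((n : ℝ) - 2) / 2) *
      C ^ (-((n : ℝ) - 1) / 2 - z.re) := by
  have hn' : (3 : ℝ) ≤ n := by exact_mod_cast hn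
  have hC0 : 0 < C := by linarith
  have hC1 : 0 < C - 1 := by linarith
  have hp := one_lt_sq_sub hC
  have h1 : (C ^ 2 - 1) ^ (-((n : ℝ) - 2) / 2) ≤ (C * (C - 1)) ^ (-((n : ℝ) - 2) / 2) :=
    Real.rpow_le_rpow_of_nonpos (by positivity) (by nlinarith) (by linarith)
  have h2 := norm_legInt_le hn hz hC.le
  rw [greenC, norm_mul, norm_mul, Complex.norm_real, Real.norm_eq_abs,
    abs_of_nonneg (Real.rpow_nonneg hp.le _), greenBd]
  calc _ ≤ ‖greenConst n z‖ * (C * (C - 1)) ^ (-((n : ℝ) - 2) / 2) *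
      ((2 ^ n * C ^ (((n : ℝ) - 3) / 2)) * (2 / C) ^ z.re * Real.pi) := by gcongr
    _ = _ := by
      rw [Real.mul_rpow hC0.le hC1.le, Real.div_rpow hC0.le hC1.le,
        Real.div_rpow (by norm_num) hC0.le]
      have e1 : (C - 1) ^ (-((n : ℝ) - 2) / 2) = ((C - 1) ^ (((n : ℝ) - 2) / 2))⁻¹ := by
        rw [← Real.rpow_neg hC1.le]; ring_nf
      have e2 : C ^ (-((n : ℝ) - 2) / 2) * C ^ (((n : ℝ) - 3) / 2) * (C ^ z.re)⁻¹ =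
          C ^ (((n : ℝ) - 2) / 2) * C ^ (-((n : ℝ) - 1) / 2 - z.re) := by
        rw [← Real.rpow_neg hC0.le, ← Real.rpow_add hC0, ← Real.rpow_add hC0, ← Real.rpow_add hC0]
        ring_nf
      rw [e1]
      linear_combination (‖greenConst n z‖ * ((C - 1) ^ (((n : ℝ) - 2) / 2))⁻¹ * 2 ^ n * 2 ^ z.re *
        Real.pi) * e2

/-- A cruder bound that includes dimension two, where the singularity at `ρ = 0` is
logarithmic. -/
theorem norm_greenC_le_crude {n : ℕ} (hn : 2 ≤ n) {z : ℂ} (hz : 0 ≤ z.re) {C : ℝ} (hC : 1 < C) :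
    ‖greenC n z C‖ ≤ greenBd n z * (C / (C - 1)) ^ (((n : ℝ) - 1) / 2) *
      C ^ (-((n : ℝ) - 1) / 2 - z.re) := by
  have hC0 : 0 < C := by linarith
  have hC1 : 0 < C - 1 := by linarith
  rcases Nat.lt_or_ge n 3 with h | h
  · obtain rfl : n = 2 := by omega
    -- In dimension two the exponent of `C + cos t` is negative, and `C + cos t ≥ C - 1` is used.
    have h2 : ‖legInt ((((2 : ℕ) : ℂ) - 3) / 2 - z) z C‖ ≤
        (C - 1) ^ (-(1 / 2) : ℝ) * (2 / C) ^ z.re * Real.pi := by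
      refine norm_setIntegral_Ioo_le fun t ht => ?_
      rw [half_cast]
      refine (norm_legKer_le_decay _ hz hC.le ht).trans ?_
      gcongr
      rw [show (((2 : ℕ) : ℝ) - 3) / 2 = -(1 / 2) by norm_num]
      exact Real.rpow_le_rpow_of_nonpos hC1 (by linarith [Real.neg_one_le_cos t]) (by norm_num)
    rw [greenC, norm_mul, norm_mul, Complex.norm_real, greenBd]
    have e0 : -(((2 : ℕ) : ℝ) - 2) / 2 = 0 := by norm_num
    rw [e0, Real.rpow_zero, norm_one, mul_one]
    calc _ ≤ ‖greenConst 2 z‖ * ((C - 1) ^ (-(1 / 2) : ℝ) * (2 / C) ^ z.re * Real.pi) := by gcongr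
      _ ≤ 2 ^ 2 * (‖greenConst 2 z‖ * ((C - 1) ^ (-(1 / 2) : ℝ) * (2 / C) ^ z.re * Real.pi)) := by
        refine le_mul_of_one_le_left (by positivity) (by norm_num)
      _ = _ := by
        rw [Real.div_rpow hC0.le hC1.le, Real.div_rpow (by norm_num) hC0.le]
        have e1 : (C - 1) ^ (-(1 / 2) : ℝ) = ((C - 1) ^ ((((2 : ℕ) : ℝ) - 1) / 2))⁻¹ := by
          rw [← Real.rpow_neg hC1.le]; norm_num
        have e2 : (C ^ z.re)⁻¹ = C ^ ((((2 : ℕ) : ℝ) - 1) / 2) *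
            C ^ (-(((2 : ℕ) : ℝ) - 1) / 2 - z.re) := by
          rw [← Real.rpow_neg hC0.le, ← Real.rpow_add hC0]
          ring_nf
        rw [e1]
        linear_combination (‖greenConst 2 z‖ * ((C - 1) ^ ((((2 : ℕ) : ℝ) - 1) / 2))⁻¹ * 2 ^ 2 *
          2 ^ z.re * Real.pi) * e2
  · refine (norm_greenC_le h hz hC).trans ?_
    have := greenBd_nonneg n z
    gcongr ?_ * ?_ * ?_
    refine Real.rpow_le_rpow_of_exponent_le ?_ (by linarith)
    rw [le_div_iff₀ hC1]; linarith

/-! ### The singularity at `C = 1` -/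

theorem ofReal_rpow_cpow {x : ℝ} (hx : 0 < x) (r : ℝ) : ((x ^ r : ℝ) : ℂ) = (x : ℂ) ^ (r : ℂ) :=
  Complex.ofReal_cpow hx.le r

/-- The substitution `x = (1 + cos t)/2` turns the integral at `C = 1` into an Euler Beta
integral. -/
theorem legKer_one_eq (a z : ℂ) {t : ℝ} (ht : t ∈ Set.Ioo 0 Real.pi) :
    legKer a z 1 t = 2 ^ (a + 2 * z) * (|-Real.sin t / 2| •
      (((((1 + Real.cos t) / 2 : ℝ) : ℂ)) ^ (a + z + 1 / 2 - 1) *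
        (1 - (((1 + Real.cos t) / 2 : ℝ) : ℂ)) ^ (z + 1 / 2 - 1))) := by
  have hs := sin_pos_of_mem ht
  have hp : 0 < (1 + Real.cos t) / 2 := by linarith [neg_one_lt_cos ht]
  have hsq : Real.sin t ^ 2 = 4 * (((1 + Real.cos t) / 2) * (1 - (1 + Real.cos t) / 2)) := by
    have := Real.sin_sq_add_cos_sq t
    linarith
  have hq : 0 < 1 - (1 + Real.cos t) / 2 := by
    by_contra h
    push Not at h
    nlinarith [pow_pos hs 2]
  rw [show |-Real.sin t / 2| = Real.sin t / 2 by
    rw [abs_div, abs_neg, abs_of_pos hs]; norm_num]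
  obtain ⟨p, hpdef⟩ : ∃ p, p = (1 + Real.cos t) / 2 := ⟨_, rfl⟩
  rw [← hpdef] at hp hsq hq ⊢
  rw [legKer, show 1 + Real.cos t = 2 * p by rw [hpdef]; ring]
  set q := 1 - p with hqdef
  have hpc : (p : ℂ) ≠ 0 := by exact_mod_cast hp.ne'
  have hqc : (q : ℂ) ≠ 0 := by exact_mod_cast hq.ne'
  have e1 : (1 : ℂ) - (p : ℂ) = (q : ℂ) := by rw [hqdef]; push_cast; ring
  have e2 : ((Real.sin t : ℝ) : ℂ) ^ (2 * z) = 2 ^ (2 * z) * ((p : ℂ) ^ z * (q : ℂ) ^ z) := by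
    have h2 : (2 : ℂ) ^ (2 * z) = ((2 : ℝ) : ℂ) ^ z * ((2 : ℝ) : ℂ) ^ z := by
      rw [two_mul, Complex.cpow_add _ _ (by norm_num)]; norm_num
    rw [h2, two_mul, Complex.cpow_add _ _ (by exact_mod_cast hs.ne'),
      ← Complex.mul_cpow_ofReal_nonneg hs.le hs.le,
      ← Complex.mul_cpow_ofReal_nonneg (by norm_num) (by norm_num),
      ← Complex.mul_cpow_ofReal_nonneg hp.le hq.le, ← Complex.ofReal_mul, ← Complex.ofReal_mul,
      ← Complex.ofReal_mul, ← Complex.mul_cpow_ofReal_nonneg (by norm_num) (by positivity),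
      ← Complex.ofReal_mul]
    congr 2
    nlinarith
  have e3 : (p : ℂ) ^ (-(1 / 2) : ℂ) * (q : ℂ) ^ (-(1 / 2) : ℂ) * ((Real.sin t / 2 : ℝ) : ℂ) = 1 := by
    have h1 : Real.sin t / 2 = (p * q) ^ (1 / 2 : ℝ) := by
      rw [← Real.sqrt_eq_rpow, eq_comm, Real.sqrt_eq_iff_mul_self_eq (by positivity) (by positivity)]
      nlinarith
    rw [h1, ← Complex.mul_cpow_ofReal_nonneg hp.le hq.le, ← Complex.ofReal_mul,
      ofReal_rpow_cpow (by positivity), ← Complex.cpow_add]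
    · norm_num
    · exact_mod_cast (mul_pos hp hq).ne'
  have e4 : (p : ℂ) ^ (a + z + 1 / 2 - 1) = (p : ℂ) ^ a * (p : ℂ) ^ z * (p : ℂ) ^ (-(1 / 2) : ℂ) := by
    rw [← Complex.cpow_add _ _ hpc, ← Complex.cpow_add _ _ hpc]; congr 1; ring
  have e5 : (q : ℂ) ^ (z + 1 / 2 - 1) = (q : ℂ) ^ z * (q : ℂ) ^ (-(1 / 2) : ℂ) := by
    rw [← Complex.cpow_add _ _ hqc]; congr 1; ring
  rw [e1, e2, e4, e5, Complex.ofReal_mul, Complex.mul_cpow_ofReal_nonneg (by norm_num) hp.le,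
    Complex.cpow_add _ _ (by norm_num), Complex.real_smul, Complex.ofReal_ofNat]
  linear_combination (-(2 : ℂ) ^ a * 2 ^ (2 * z) * (p : ℂ) ^ a * (p : ℂ) ^ z * (q : ℂ) ^ z) * e3

/-- At `C = 1` the integral is an Euler Beta integral. -/
theorem legInt_one (a z : ℂ) :
    legInt a z 1 = 2 ^ (a + 2 * z) * Complex.betaIntegral (a + z + 1 / 2) (z + 1 / 2) := by
  have hd : ∀ t ∈ Set.Ioo 0 Real.pi,
      HasDerivWithinAt (fun t => (1 + Real.cos t) / 2) (-Real.sin t / 2) (Set.Ioo 0 Real.pi) t :=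
    fun t _ => (((Real.hasDerivAt_cos t).const_add 1).div_const 2).hasDerivWithinAt
  have hinj : Set.InjOn (fun t => (1 + Real.cos t) / 2) (Set.Ioo 0 Real.pi) := by
    intro s hs t ht h
    have : Real.cos s = Real.cos t := by simp only at h; linarith
    exact Real.injOn_cos ⟨hs.1.le, hs.2.le⟩ ⟨ht.1.le, ht.2.le⟩ this
  have himg : (fun t => (1 + Real.cos t) / 2) '' Set.Ioo 0 Real.pi = Set.Ioo 0 1 := by
    ext x
    constructor
    · rintro ⟨t, ht, rfl⟩
      have h1 := neg_one_lt_cos ht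
      have h2 : Real.cos t < 1 := by
        have := Real.strictAntiOn_cos ⟨le_refl _, Real.pi_pos.le⟩ ⟨ht.1.le, ht.2.le⟩ ht.1
        simpa using this
      constructor <;> simp only <;> linarith
    · intro hx
      refine ⟨Real.arccos (2 * x - 1), ⟨?_, ?_⟩, ?_⟩
      · rw [Real.arccos_pos]; linarith [hx.2]
      · rw [lt_iff_le_and_ne]
        refine ⟨Real.arccos_le_pi _, ?_⟩
        rw [Ne, Real.arccos_eq_pi]; linarith [hx.1]
      · simp only
        rw [Real.cos_arccos (by linarith [hx.1]) (by linarith [hx.2])]; ring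
  have h := integral_image_eq_integral_abs_deriv_smul measurableSet_Ioo hd hinj
    (fun x : ℝ => (x : ℂ) ^ (a + z + 1 / 2 - 1) * (1 - (x : ℂ)) ^ (z + 1 / 2 - 1))
  rw [himg, ← integral_Ioc_eq_integral_Ioo, ← intervalIntegral.integral_of_le zero_le_one] at h
  rw [Complex.betaIntegral, h, legInt, ← integral_const_mul]
  exact setIntegral_congr_fun measurableSet_Ioo fun t ht => legKer_one_eq a z ht

/-- The coefficient of the leading singularity `(C² - 1)^{-(n-2)/2}` of the Green function as
`C → 1⁺`. It does not depend on the spectral parameter. -/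
noncomputable def singConst (n : ℕ) : ℝ :=
  Real.pi ^ (-(n : ℝ) / 2) * Real.Gamma ((n : ℝ) / 2 - 1) / 4

/-- The Gamma factors of the normalising constant cancel those of the Beta integral. -/
theorem greenConst_mul_legInt_one {n : ℕ} (hn : 3 ≤ n) {z : ℂ} (hz : 0 ≤ z.re) :
    greenConst n z * legInt (((n : ℂ) - 3) / 2 - z) z 1 = singConst n := by
  have hn' : (3 : ℝ) ≤ n := by exact_mod_cast hn
  have e1 : ((n : ℂ) - 3) / 2 - z + z + 1 / 2 = (n : ℂ) / 2 - 1 := by ring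
  have hB := Complex.Gamma_mul_Gamma_eq_betaIntegral (s := (n : ℂ) / 2 - 1) (t := z + 1 / 2)
    (by simp; linarith) (by simp; linarith)
  have e2 : (n : ℂ) / 2 - 1 + (z + 1 / 2) = ((n : ℂ) - 1) / 2 + z := by ring
  have hG1 : Complex.Gamma (z + 1 / 2) ≠ 0 := Complex.Gamma_ne_zero_of_re_pos (by simp; linarith)
  have hG2 : Complex.Gamma (((n : ℂ) - 1) / 2 + z) ≠ 0 :=
    Complex.Gamma_ne_zero_of_re_pos (by simp; linarith)
  have h2 : (2 : ℂ) ≠ 0 := by norm_num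
  have hp2 : (2 : ℂ) ^ (z + 1 / 2) ≠ 0 := by simp [Complex.cpow_eq_zero_iff]
  rw [e2] at hB
  have hG3 : ((Real.Gamma ((n : ℝ) / 2 - 1) : ℝ) : ℂ) = Complex.Gamma ((n : ℂ) / 2 - 1) := by
    rw [← Complex.Gamma_ofReal]; push_cast; rfl
  have e3 : ((2 * Real.pi : ℝ) : ℂ) ^ (-(n : ℂ) / 2) =
      2 ^ (-(n : ℂ) / 2) * (Real.pi : ℂ) ^ (-(n : ℂ) / 2) := by
    rw [Complex.ofReal_mul, Complex.mul_cpow_ofReal_nonneg (by norm_num) Real.pi_pos.le,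
      Complex.ofReal_ofNat]
  have e4 : ((n : ℂ) - 3) / 2 - z + 2 * z = (z + 1 / 2) + (n : ℂ) / 2 + (-2 : ℂ) := by ring
  have e5 : (2 : ℂ) ^ (-2 : ℂ) = 1 / 4 := by
    rw [Complex.cpow_neg, show (2 : ℂ) ^ (2 : ℂ) = 2 ^ 2 by norm_cast]; norm_num
  have e6 : (2 : ℂ) ^ (-(n : ℂ) / 2) * 2 ^ ((n : ℂ) / 2) = 1 := by
    rw [← Complex.cpow_add _ _ h2, neg_div, neg_add_cancel, Complex.cpow_zero]
  have e7 : (2 : ℂ) ^ (((n : ℂ) - 3) / 2 - z + 2 * z) =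
      2 ^ (z + 1 / 2) * 2 ^ ((n : ℂ) / 2) * (1 / 4) := by
    rw [e4, Complex.cpow_add _ _ h2, Complex.cpow_add (z + 1 / 2) _ h2, e5]
  rw [legInt_one, e1, greenConst, e3, e7, singConst]
  push_cast
  rw [hG3, Complex.ofReal_cpow Real.pi_pos.le]
  push_cast
  have hB' : Complex.betaIntegral ((n : ℂ) / 2 - 1) (z + 1 / 2) = Complex.Gamma ((n : ℂ) / 2 - 1) *
      Complex.Gamma (z + 1 / 2) / Complex.Gamma (((n : ℂ) - 1) / 2 + z) := by
    rw [hB, mul_div_cancel_left₀ _ hG2]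
  rw [hB']
  generalize Complex.Gamma (z + 1 / 2) = G1 at *
  generalize Complex.Gamma (((n : ℂ) - 1) / 2 + z) = G2 at *
  generalize Complex.Gamma ((n : ℂ) / 2 - 1) = G3 at *
  generalize (2 : ℂ) ^ (z + 1 / 2) = T at *
  generalize (2 : ℂ) ^ (-(n : ℂ) / 2) = T1 at *
  generalize (2 : ℂ) ^ ((n : ℂ) / 2) = T2 at *
  generalize (Real.pi : ℂ) ^ (-(n : ℂ) / 2) = T3 at *
  field_simp
  linear_combination (T3 * G3) * e6

theorem tendsto_legInt_one {n : ℕ} (hn : 3 ≤ n) {z : ℂ} (hz : 0 ≤ z.re) :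
    Tendsto (legInt (((n : ℂ) - 3) / 2 - z) z) (𝓝[>] 1)
      (𝓝 (legInt (((n : ℂ) - 3) / 2 - z) z 1)) := by
  have hn' : (3 : ℝ) ≤ n := by exact_mod_cast hn
  have hnear : ∀ᶠ C : ℝ in 𝓝[>] 1, 1 < C ∧ C < 2 := Ioo_mem_nhdsGT (by norm_num)
  refine tendsto_integral_filter_of_dominated_convergence
    (fun _ => (3 : ℝ) ^ (((n : ℝ) - 3) / 2) * 2 ^ z.re) ?_ ?_ (integrableOn_const (by simp)) ?_
  · filter_upwards [hnear] with C hC using aestronglyMeasurable_legKer _ _ hC.1.le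
  · filter_upwards [hnear] with C hC
    refine (ae_restrict_iff' measurableSet_Ioo).2 (Eventually.of_forall fun t ht => ?_)
    rw [half_cast]
    refine (norm_legKer_le_decay _ hz hC.1.le ht).trans ?_
    have := add_cos_pos hC.1.le ht
    refine mul_le_mul (Real.rpow_le_rpow this.le ?_ (by linarith))
      (Real.rpow_le_rpow (div_nonneg zero_le_two (by linarith)) ?_ hz) ?_ ?_
    · linarith [Real.cos_le_one t]
    · exact div_le_self (by norm_num) hC.1.le
    · exact Real.rpow_nonneg (div_nonneg zero_le_two (by linarith)) _
    · positivity
  · refine (ae_restrict_iff' measurableSet_Ioo).2 (Eventually.of_forall fun t ht => ?_)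
    have h1 := hasDerivAt_ofReal_cpow (f := fun C => C + Real.cos t) (((n : ℂ) - 3) / 2 - z)
      ((hasDerivAt_id' (1 : ℝ)).add_const (Real.cos t)) (add_cos_pos le_rfl ht)
    exact ((h1.continuousAt.mul_const _).tendsto).mono_left nhdsWithin_le_nhds

/-- The leading singularity of the Green function in dimension at least three. -/
theorem tendsto_greenC_one {n : ℕ} (hn : 3 ≤ n) {z : ℂ} (hz : 0 ≤ z.re) :
    Tendsto (fun C : ℝ => (((C - 1) ^ (((n : ℝ) - 2) / 2) : ℝ) : ℂ) * greenC n z C) (𝓝[>] 1)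
      (𝓝 ((2 ^ (-((n : ℝ) - 2) / 2) * singConst n : ℝ) : ℂ)) := by
  have h1 : Tendsto (fun C : ℝ => (((C + 1) ^ (-((n : ℝ) - 2) / 2) : ℝ) : ℂ)) (𝓝[>] 1)
      (𝓝 ((2 ^ (-((n : ℝ) - 2) / 2) : ℝ) : ℂ)) := by
    have : ContinuousAt (fun C : ℝ => (C + 1) ^ (-((n : ℝ) - 2) / 2)) 1 :=
      (continuousAt_id.add continuousAt_const).rpow_const (Or.inl (by norm_num))
    have h := (Complex.continuous_ofReal.continuousAt.comp this).tendsto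
    norm_num [Function.comp_def] at h
    refine (Tendsto.mono_left ?_ nhdsWithin_le_nhds)
    norm_num
    exact h
  have h2 := (h1.mul ((tendsto_legInt_one hn hz).const_mul (greenConst n z)))
  rw [greenConst_mul_legInt_one hn hz, ← Complex.ofReal_mul] at h2
  refine h2.congr' ?_
  filter_upwards [self_mem_nhdsWithin] with C hC
  have hC : 1 < C := hC
  have e : (C - 1) ^ (((n : ℝ) - 2) / 2) * (C ^ 2 - 1) ^ (-((n : ℝ) - 2) / 2) =
      (C + 1) ^ (-((n : ℝ) - 2) / 2) := by
    rw [show C ^ 2 - 1 = (C - 1) * (C + 1) by ring, Real.mul_rpow (by linarith) (by linarith),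
      ← mul_assoc, ← Real.rpow_add (by linarith)]
    rw [show ((n : ℝ) - 2) / 2 + -((n : ℝ) - 2) / 2 = 0 by ring, Real.rpow_zero, one_mul]
  rw [← e, greenC]
  push_cast
  ring

/-! ### The radiation asymptotics -/

/-- `C g'` equals `-((n-1)/2 + z) g` up to an error one power of `C` below the general decay
`C^{-(n-1)/2}`. Here `g' = -2π g_{n+2}`, and the cancellation is the factor
`(C² - 1) - C (C + cos t) = -1 - C cos t`, of order `C` rather than `C²`, under the integral. -/
theorem norm_radiation_greenC_le {n : ℕ} (hn : 2 ≤ n) {z : ℂ} (hz : 0 ≤ z.re) :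
    ∃ K : ℝ, ∀ C : ℝ, 2 ≤ C →
      ‖C * (-(2 * Real.pi) * greenC (n + 2) z C) + (((n : ℂ) - 1) / 2 + z) * greenC n z C‖ ≤
        K * C ^ (-((n : ℝ) + 1) / 2) := by
  have hn' : (2 : ℝ) ≤ n := by exact_mod_cast hn
  refine ⟨‖((n : ℂ) - 1) / 2 + z‖ * ‖greenConst n z‖ *
    ((2 : ℝ) ^ (n : ℝ) * ((2 ^ (n : ℝ) * 2) * Real.pi)), fun C hC => ?_⟩
  have hC1 : 1 < C := by linarith
  have hC0 : 0 < C := by linarith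
  have hp := one_lt_sq_sub hC1
  have hpc : (C : ℂ) ^ 2 - 1 ≠ 0 := by exact_mod_cast hp.ne'
  have e : ((n + 2 : ℕ) : ℂ) = n + 2 := by push_cast; ring
  have e' : ((n : ℂ) + 2 - 3) / 2 - z = ((n : ℂ) - 3) / 2 - z + 1 := by ring
  have hA := greenConst_add_two hn hz
  have key : C * (-(2 * Real.pi) * greenC (n + 2) z C) + (((n : ℂ) - 1) / 2 + z) * greenC n z C =
      (((n : ℂ) - 1) / 2 + z) * greenConst n z *
        ((((C ^ 2 - 1) ^ (-((n : ℝ) - 2) / 2) / (C ^ 2 - 1) : ℝ) : ℂ) *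
        ∫ t in Set.Ioo 0 Real.pi, (-1 - C * Real.cos t : ℝ) *
          legKer (((n : ℂ) - 3) / 2 - z) z C t) := by
    have i1 := integrableOn_legKer (((n : ℂ) - 3) / 2 - z) hz hC1
    have i2 := integrableOn_legKer (((n : ℂ) - 3) / 2 - z + 1) hz hC1
    have hI : ∫ t in Set.Ioo 0 Real.pi, (-1 - C * Real.cos t : ℝ) *
          legKer (((n : ℂ) - 3) / 2 - z) z C t =
        (C ^ 2 - 1) * legInt (((n : ℂ) - 3) / 2 - z) z C -
          C * legInt (((n : ℂ) - 3) / 2 - z + 1) z C := by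
      rw [legInt, legInt, ← integral_const_mul, ← integral_const_mul,
        ← integral_sub (i1.const_mul _) (i2.const_mul _)]
      refine integral_congr_ae (Eventually.of_forall fun t => ?_)
      simp only
      rw [legKer_add_one _ _ hC1]
      push_cast; ring
    rw [hI, greenC, greenC, rpow_shift hC1, e, e']
    generalize legInt (((n : ℂ) - 3) / 2 - z + 1) z C = Ip at *
    generalize legInt (((n : ℂ) - 3) / 2 - z) z C = I0 at *
    generalize (C ^ 2 - 1) ^ (-((n : ℝ) - 2) / 2) = p at *
    push_cast
    field_simp
    linear_combination (-(C : ℂ) * p * 2 * Ip) * hA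
  rw [key, norm_mul, norm_mul, norm_mul, Complex.norm_real, Real.norm_eq_abs,
    abs_of_nonneg (div_nonneg (Real.rpow_nonneg hp.le _) hp.le), mul_assoc]
  have hI : ‖∫ t in Set.Ioo 0 Real.pi, (-1 - C * Real.cos t : ℝ) *
      legKer (((n : ℂ) - 3) / 2 - z) z C t‖ ≤
      (2 * C) * (2 ^ (n : ℝ) * C ^ (((n : ℝ) - 3) / 2)) * Real.pi := by
    refine norm_setIntegral_Ioo_le fun t ht => ?_
    rw [norm_mul, Complex.norm_real, Real.norm_eq_abs, half_cast]
    have h1 : |-1 - C * Real.cos t| ≤ 2 * C := by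
      have ha := Real.neg_one_le_cos t
      have hb := Real.cos_le_one t
      rw [abs_le]; constructor <;> nlinarith
    have h2 := norm_legKer_le_decay (((n : ℝ) - 3) / 2) hz hC1.le ht
    have h3 : (2 / C) ^ z.re ≤ 1 :=
      Real.rpow_le_one (by positivity) (by rw [div_le_one hC0]; exact hC) hz
    have h4 : (C + Real.cos t) ^ (((n : ℝ) - 3) / 2) ≤ 2 ^ (n : ℝ) * C ^ (((n : ℝ) - 3) / 2) := by
      rcases le_total 0 (((n : ℝ) - 3) / 2) with h | h
      · calc (C + Real.cos t) ^ (((n : ℝ) - 3) / 2) ≤ (2 * C) ^ (((n : ℝ) - 3) / 2) :=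
            Real.rpow_le_rpow (add_cos_pos hC1.le ht).le (by linarith [Real.cos_le_one t]) h
          _ = 2 ^ (((n : ℝ) - 3) / 2) * C ^ (((n : ℝ) - 3) / 2) :=
            Real.mul_rpow (by norm_num) hC0.le
          _ ≤ _ := by
            gcongr
            · norm_num
            · linarith
      · calc (C + Real.cos t) ^ (((n : ℝ) - 3) / 2) ≤ (2⁻¹ * C) ^ (((n : ℝ) - 3) / 2) :=
            Real.rpow_le_rpow_of_nonpos (by positivity) (by linarith [Real.neg_one_le_cos t]) h
          _ = 2 ^ (-(((n : ℝ) - 3) / 2)) * C ^ (((n : ℝ) - 3) / 2) := by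
            rw [Real.mul_rpow (by norm_num) hC0.le, Real.inv_rpow (by norm_num),
              Real.rpow_neg (by norm_num)]
          _ ≤ _ := by
            gcongr
            · norm_num
            · linarith
    have h5 : 0 ≤ (C + Real.cos t) ^ (((n : ℝ) - 3) / 2) :=
      Real.rpow_nonneg (add_cos_pos hC1.le ht).le _
    have h6 := h2.trans (mul_le_of_le_one_right h5 h3)
    gcongr
    exact h6.trans h4
  have hP : (C ^ 2 - 1) ^ (-((n : ℝ) - 2) / 2) / (C ^ 2 - 1) ≤
      2 ^ (n : ℝ) * C ^ (-(n : ℝ)) := by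
    rw [← Real.rpow_sub_one hp.ne']
    have h1 : (C ^ 2 - 1) ^ (-((n : ℝ) - 2) / 2 - 1) ≤ (2⁻¹ * C ^ 2) ^ (-((n : ℝ) - 2) / 2 - 1) :=
      Real.rpow_le_rpow_of_nonpos (by positivity) (by nlinarith) (by linarith)
    refine h1.trans ?_
    rw [Real.mul_rpow (by norm_num) (by positivity), Real.inv_rpow (by norm_num),
      ← Real.rpow_neg (by norm_num), ← Real.rpow_natCast C 2, ← Real.rpow_mul hC0.le]
    have : ((2 : ℕ) : ℝ) * (-((n : ℝ) - 2) / 2 - 1) = -(n : ℝ) := by push_cast; ring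
    rw [this]
    gcongr
    · norm_num
    · linarith
  calc _ ≤ ‖((n : ℂ) - 1) / 2 + z‖ * (‖greenConst n z‖ * ((2 ^ (n : ℝ) * C ^ (-(n : ℝ))) *
      ((2 * C) * (2 ^ (n : ℝ) * C ^ (((n : ℝ) - 3) / 2)) * Real.pi))) := by gcongr
    _ = _ := by
      have : C ^ (-(n : ℝ)) * (C * C ^ (((n : ℝ) - 3) / 2)) = C ^ (-((n : ℝ) + 1) / 2) := by
        rw [← Real.rpow_one_add' hC0.le, ← Real.rpow_add hC0]
        · ring_nf
        · intro h; linarith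
      rw [← this]; ring

/-! ### The distance function of the ball -/

/-- The hyperbolic cosine of the distance of two points of the ball, as a rational function of the
points; see `cosh_hypDist`. -/
noncomputable def coshDist {n : ℕ} (x y : E n) : ℝ :=
  1 + 2 * ‖y - x‖ ^ 2 / ((1 - ‖x‖ ^ 2) * (1 - ‖y‖ ^ 2))

theorem mem_pBall {n : ℕ} {x : E n} : x ∈ pBall n ↔ ‖x‖ < 1 := mem_ball_zero_iff

theorem isOpen_pBall (n : ℕ) : IsOpen (pBall n) := Metric.isOpen_ball

theorem one_sub_sq_pos {n : ℕ} {x : E n} (hx : x ∈ pBall n) : 0 < 1 - ‖x‖ ^ 2 := by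
  have := mem_pBall.1 hx
  nlinarith [norm_nonneg x]

theorem one_sub_sq_le_one {n : ℕ} (x : E n) : 1 - ‖x‖ ^ 2 ≤ 1 := by nlinarith [norm_nonneg x]

theorem coshDist_comm {n : ℕ} (x y : E n) : coshDist x y = coshDist y x := by
  rw [coshDist, coshDist, norm_sub_rev, mul_comm (1 - ‖x‖ ^ 2)]

theorem coshDist_sub_one {n : ℕ} (x y : E n) :
    coshDist x y - 1 = 2 * ‖y - x‖ ^ 2 / ((1 - ‖x‖ ^ 2) * (1 - ‖y‖ ^ 2)) := by
  rw [coshDist]; ring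

/-- The Euclidean distance controls `C - 1` from below on the whole ball; this carries bounds in
`C - 1` to Euclidean kernels. -/
theorem le_coshDist_sub_one {n : ℕ} {x y : E n} (hx : x ∈ pBall n) (hy : y ∈ pBall n) :
    2 * ‖y - x‖ ^ 2 ≤ coshDist x y - 1 := by
  have h1 := one_sub_sq_pos hx
  have h2 := one_sub_sq_pos hy
  rw [coshDist_sub_one, le_div_iff₀ (by positivity)]
  have : (1 - ‖x‖ ^ 2) * (1 - ‖y‖ ^ 2) ≤ 1 :=
    mul_le_one₀ (one_sub_sq_le_one x) h2.le (one_sub_sq_le_one y)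
  nlinarith [sq_nonneg ‖y - x‖]

theorem one_le_coshDist {n : ℕ} {x y : E n} (hx : x ∈ pBall n) (hy : y ∈ pBall n) :
    1 ≤ coshDist x y := by
  nlinarith [le_coshDist_sub_one hx hy, sq_nonneg ‖y - x‖]

theorem one_lt_coshDist {n : ℕ} {x y : E n} (hx : x ∈ pBall n) (hy : y ∈ pBall n) (hne : y ≠ x) :
    1 < coshDist x y := by
  have : 0 < ‖y - x‖ := norm_pos_iff.2 (sub_ne_zero.2 hne)
  nlinarith [le_coshDist_sub_one hx hy]

theorem norm_mobius_sq {n : ℕ} {x y : E n} (hx : x ∈ pBall n) (hy : y ∈ pBall n) :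
    ‖mobius x y‖ ^ 2 = ‖y - x‖ ^ 2 / ((1 - ‖x‖ ^ 2) * (1 - ‖y‖ ^ 2) + ‖y - x‖ ^ 2) := by
  have h1 := one_sub_sq_pos hx
  have h2 := one_sub_sq_pos hy
  have hd : ‖y - x‖ ^ 2 = ‖y‖ ^ 2 - 2 * inner ℝ y x + ‖x‖ ^ 2 := norm_sub_sq_real y x
  have hD : 1 - 2 * inner ℝ y x + ‖y‖ ^ 2 * ‖x‖ ^ 2 =
      (1 - ‖x‖ ^ 2) * (1 - ‖y‖ ^ 2) + ‖y - x‖ ^ 2 := by rw [hd]; ring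
  have hpos : 0 < (1 - ‖x‖ ^ 2) * (1 - ‖y‖ ^ 2) + ‖y - x‖ ^ 2 := by positivity
  have hi : inner ℝ x (y - x) = inner ℝ y x - ‖x‖ ^ 2 := by
    rw [inner_sub_right, real_inner_self_eq_norm_sq, real_inner_comm]
  rw [mobius, hD, norm_smul, mul_pow,
    norm_sub_sq_real (‖y - x‖ ^ 2 • x), inner_smul_left, inner_smul_right, norm_smul,
    norm_smul, hi, mul_pow, mul_pow]
  simp only [norm_inv, Real.norm_eq_abs, sq_abs, inv_pow, conj_trivial]
  rw [inv_mul_eq_div, div_eq_div_iff (by positivity) hpos.ne']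
  rw [hd]
  ring

theorem norm_mobius_lt_one {n : ℕ} {x y : E n} (hx : x ∈ pBall n) (hy : y ∈ pBall n) :
    ‖mobius x y‖ < 1 := by
  have h1 := one_sub_sq_pos hx
  have h2 := one_sub_sq_pos hy
  have h : ‖mobius x y‖ ^ 2 < 1 := by
    rw [norm_mobius_sq hx hy, div_lt_one (by positivity)]
    have := mul_pos h1 h2
    linarith
  nlinarith [norm_nonneg (mobius x y)]

theorem cosh_rho {n : ℕ} {y : E n} (hy : y ∈ pBall n) :
    Real.cosh (rho y) = (1 + ‖y‖ ^ 2) / (1 - ‖y‖ ^ 2) := by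
  have h := mem_pBall.1 hy
  have h0 := norm_nonneg y
  have h1 : 0 < (1 + ‖y‖) / (1 - ‖y‖) := div_pos (by linarith) (by linarith)
  rw [rho, Real.cosh_eq, Real.exp_neg, Real.exp_log h1]
  have : (1 : ℝ) - ‖y‖ ≠ 0 := by linarith
  have h3 := (one_sub_sq_pos hy).ne'
  have h4 : (1 : ℝ) + ‖y‖ ≠ 0 := by linarith
  field_simp
  ring

theorem rho_pos {n : ℕ} {y : E n} (hy : y ∈ pBall n) (h0 : y ≠ 0) : 0 < rho y := by
  have h := mem_pBall.1 hy
  have h0 : 0 < ‖y‖ := norm_pos_iff.2 h0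
  refine Real.log_pos ?_
  rw [one_lt_div (by linarith)]
  linarith

theorem cosh_hypDist {n : ℕ} {x y : E n} (hx : x ∈ pBall n) (hy : y ∈ pBall n) :
    Real.cosh (hypDist x y) = coshDist x y := by
  have h1 := one_sub_sq_pos hx
  have h2 := one_sub_sq_pos hy
  have h12 := mul_pos h1 h2
  rw [hypDist, cosh_rho (mem_pBall.2 (norm_mobius_lt_one hx hy)), norm_mobius_sq hx hy, coshDist]
  have h3 : 0 < (1 - ‖x‖ ^ 2) * (1 - ‖y‖ ^ 2) + ‖y - x‖ ^ 2 := by positivity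
  rw [div_eq_iff]
  · field_simp
    ring
  · rw [one_sub_div h3.ne']
    have : (1 - ‖x‖ ^ 2) * (1 - ‖y‖ ^ 2) + ‖y - x‖ ^ 2 - ‖y - x‖ ^ 2 =
      (1 - ‖x‖ ^ 2) * (1 - ‖y‖ ^ 2) := by ring
    rw [this]
    positivity

theorem hypDist_pos {n : ℕ} {x y : E n} (hx : x ∈ pBall n) (hy : y ∈ pBall n) (hne : y ≠ x) :
    0 < hypDist x y := by
  refine rho_pos (mem_pBall.2 (norm_mobius_lt_one hx hy)) fun h => ?_
  have h1 := one_lt_coshDist hx hy hne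
  rw [← cosh_hypDist hx hy, hypDist, h, rho] at h1
  simp at h1

theorem green_hypDist {n : ℕ} {x y : E n} (z : ℂ) (hx : x ∈ pBall n) (hy : y ∈ pBall n)
    (hne : y ≠ x) : green n z (hypDist x y) = greenC n z (coshDist x y) := by
  rw [green_eq_greenC n z (hypDist_pos hx hy hne), cosh_hypDist hx hy]

theorem hypDist_zero {n : ℕ} (y : E n) : hypDist 0 y = rho y := by
  simp [hypDist, mobius, rho]

/-! ### Integration over the ball -/

/-- The density of the hyperbolic volume with respect to the Lebesgue measure. -/
noncomputable def hypDens {n : ℕ} (x : E n) : ℝ := (2 / (1 - ‖x‖ ^ 2)) ^ n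

theorem hypDens_pos {n : ℕ} {x : E n} (hx : x ∈ pBall n) : 0 < hypDens x := by
  have := one_sub_sq_pos hx
  unfold hypDens; positivity

theorem measurable_hypDens {n : ℕ} : Measurable (hypDens : E n → ℝ) := by
  unfold hypDens; fun_prop

theorem continuousOn_hypDens {n : ℕ} : ContinuousOn (hypDens : E n → ℝ) (pBall n) := by
  unfold hypDens
  exact (continuousOn_const.div (by fun_prop) fun x hx => (one_sub_sq_pos hx).ne').pow n

theorem integrable_hypVolume_iff {n : ℕ} {F : Type*} [NormedAddCommGroup F] [NormedSpace ℝ F]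
    {u : E n → F} :
    Integrable u (hypVolume n) ↔ IntegrableOn (fun x => hypDens x • u x) (pBall n) := by
  rw [hypVolume, integrable_withDensity_iff_integrable_smul' (by fun_prop) (by simp)]
  refine integrable_congr ?_
  refine (ae_restrict_iff' measurableSet_ball).2 (Eventually.of_forall fun x hx => ?_)
  change (ENNReal.ofReal (hypDens x)).toReal • u x = hypDens x • u x
  rw [ENNReal.toReal_ofReal (hypDens_pos hx).le]

theorem integral_hypVolume {n : ℕ} {F : Type*} [NormedAddCommGroup F] [NormedSpace ℝ F]
    (u : E n → F) : ∫ x, u x ∂(hypVolume n) = ∫ x in pBall n, hypDens x • u x := by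
  rw [hypVolume, integral_withDensity_eq_integral_toReal_smul (by fun_prop) (by simp)]
  refine setIntegral_congr_fun measurableSet_ball fun x hx => ?_
  change (ENNReal.ofReal (hypDens x)).toReal • u x = hypDens x • u x
  rw [ENNReal.toReal_ofReal (hypDens_pos hx).le]

theorem hypVolume_absolutelyContinuous (n : ℕ) : hypVolume n ≪ volume.restrict (pBall n) :=
  withDensity_absolutelyContinuous _ _

theorem ae_mem_pBall (n : ℕ) : ∀ᵐ x ∂(hypVolume n), x ∈ pBall n :=
  (hypVolume_absolutelyContinuous n).ae_le (ae_restrict_mem measurableSet_ball)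

theorem integrableOn_of_support {n : ℕ} {F : E n → ℂ} {K : Set (E n)} (hK : IsCompact K)
    (hF : ContinuousOn F K) (h0 : ∀ x ∉ K, F x = 0) : Integrable F :=
  (integrableOn_iff_integrable_of_support_subset fun x hx => by
    by_contra h; exact hx (h0 x h)).1 (hF.integrableOn_compact hK)

theorem integrable_hypVolume_of_support {n : ℕ} {F : E n → ℂ} {K : Set (E n)} (hK : IsCompact K)
    (hKb : K ⊆ pBall n) (hF : ContinuousOn F K) (h0 : ∀ x ∉ K, F x = 0) :
    Integrable F (hypVolume n) := by
  rw [integrable_hypVolume_iff]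
  refine (integrableOn_of_support hK ((continuousOn_hypDens.mono hKb).smul hF) ?_).integrableOn
  intro x hx
  simp [h0 x hx]

/-! ### Green's identity -/

/-- The standard basis vectors of the Euclidean space. -/
noncomputable def bv {n : ℕ} (i : Fin n) : E n := EuclideanSpace.basisFun (Fin n) ℝ i

theorem sum_inner_bv {n : ℕ} (x y : E n) : ∑ i, inner ℝ x (bv i) * inner ℝ y (bv i) = inner ℝ x y := by
  rw [← OrthonormalBasis.sum_inner_mul_inner (EuclideanSpace.basisFun (Fin n) ℝ) x y]
  refine Finset.sum_congr rfl fun i _ => ?_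
  rw [bv, real_inner_comm y]

theorem norm_bv {n : ℕ} (i : Fin n) : ‖(bv i : E n)‖ = 1 :=
  (EuclideanSpace.basisFun (Fin n) ℝ).orthonormal.1 i

theorem sum_inner_smul_clm {n : ℕ} (L : E n →L[ℝ] ℂ) (y : E n) :
    ∑ i, inner ℝ y (bv i) • L (bv i) = L y := by
  conv_rhs => rw [← OrthonormalBasis.sum_repr' (EuclideanSpace.basisFun (Fin n) ℝ) y]
  rw [map_sum]
  refine Finset.sum_congr rfl fun i _ => ?_
  rw [map_smul, bv, real_inner_comm y]

theorem laplacian_eq_sum {n : ℕ} {u : E n → ℂ} {x : E n} (h : ContDiffAt ℝ 2 u x) :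
    Laplacian.laplacian u x = ∑ i, fderiv ℝ (fun y => fderiv ℝ u y (bv i)) x (bv i) := by
  have hd : DifferentiableAt ℝ (fderiv ℝ u) x :=
    (h.fderiv_right (m := 1) (by norm_num)).differentiableAt (by norm_num)
  have := congrFun (InnerProductSpace.laplacian_eq_iteratedFDeriv_orthonormalBasis u
    (EuclideanSpace.basisFun (Fin n) ℝ)) x
  refine this.trans (Finset.sum_congr rfl fun i _ => ?_)
  rw [iteratedFDeriv_two_apply, fderiv_clm_apply hd (differentiableAt_const _)]
  simp [bv]

theorem integral_fderiv_eq_zero {n : ℕ} {F : E n → ℂ} (hF : ContDiff ℝ 1 F)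
    (hc : HasCompactSupport F) (v : E n) : ∫ x, fderiv ℝ F x v = 0 := by
  have hi : Integrable (fun x => fderiv ℝ F x v) := by
    refine Continuous.integrable_of_hasCompactSupport ?_ (hc.fderiv_apply ℝ v)
    exact (hF.continuous_fderiv (by norm_num)).clm_apply continuous_const
  have h := integral_mul_fderiv_eq_neg_fderiv_mul_of_integrable (μ := volume) (𝕜 := ℂ)
    (f := fun _ : E n => (1 : ℂ)) (g := F) (v := v) (by simp) (by simpa using hi)
    (by simpa using hF.continuous.integrable_of_hasCompactSupport hc)
    (fun x _ => differentiableAt_const _) (fun x _ => hF.differentiable (by norm_num) x)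
  simpa using h

/-- The conformal factor `2 / (1 - |x|²)` of the hyperbolic metric. -/
noncomputable def confFactor {n : ℕ} (x : E n) : ℝ := 2 / (1 - ‖x‖ ^ 2)

theorem hasFDerivAt_confFactor {n : ℕ} {x : E n} (hx : x ∈ pBall n) :
    HasFDerivAt confFactor (confFactor x ^ 2 • innerSL ℝ x) x := by
  have h := one_sub_sq_pos hx
  have h1 : HasFDerivAt (fun y : E n => 1 - ‖y‖ ^ 2) (-(2 • innerSL ℝ x)) x :=
    (hasStrictFDerivAt_norm_sq x).hasFDerivAt.const_sub 1
  have h2 := (hasDerivAt_inv h.ne').comp_hasFDerivAt x h1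
  have h3 := h2.const_mul 2
  refine (h3.congr_fderiv ?_).congr_of_eventuallyEq ?_
  · ext v
    simp [confFactor]
    field_simp
  · exact Eventually.of_forall fun y => by simp [confFactor, div_eq_mul_inv]

theorem contDiffOn_confFactor {n : ℕ} : ContDiffOn ℝ ∞ (confFactor : E n → ℝ) (pBall n) := by
  unfold confFactor
  exact contDiffOn_const.div (contDiffOn_const.sub (contDiff_norm_sq ℝ).contDiffOn)
    fun x hx => (one_sub_sq_pos hx).ne'

theorem two_le_infty : (2 : WithTop ℕ∞) ≤ ∞ :=
  WithTop.coe_le_coe.2 (le_top : (2 : ℕ∞) ≤ ⊤)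

/-- The `i`-th component of the vector field `W^{n-2} (v ∇φ - φ ∇v)`, with `W` the conformal factor;
the power `n - 2` makes its Euclidean divergence the hyperbolic one. In dimension two it is the
constant one. -/
noncomputable def greenField {n : ℕ} (v φ : E n → ℂ) (i : Fin n) (y : E n) : ℂ :=
  (confFactor y ^ (n - 2) : ℝ) • (v y * fderiv ℝ φ y (bv i) - φ y * fderiv ℝ v y (bv i))

theorem contDiffAt_dir {n : ℕ} {u : E n → ℂ} {y : E n} (h : ContDiffAt ℝ 2 u y) (w : E n) :
    ContDiffAt ℝ 1 (fun y => fderiv ℝ u y w) y :=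
  (h.fderiv_right (m := 1) (by norm_num)).clm_apply contDiffAt_const

theorem IsTest.eventually_zero {n : ℕ} {φ : E n → ℂ} {y : E n} (hy : y ∉ tsupport φ) :
    ∀ᶠ x in 𝓝 y, φ x = 0 ∧ fderiv ℝ φ x = 0 := by
  have h1 := (isClosed_tsupport φ).isOpen_compl.mem_nhds hy
  filter_upwards [h1] with x hx
  refine ⟨image_eq_zero_of_notMem_tsupport hx, ?_⟩
  exact image_eq_zero_of_notMem_tsupport fun h => hx (tsupport_fderiv_subset ℝ h)

theorem greenField_eventually_zero {n : ℕ} {v φ : E n → ℂ} (i : Fin n) {y : E n}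
    (hy : y ∉ tsupport φ) : greenField v φ i =ᶠ[𝓝 y] 0 := by
  filter_upwards [IsTest.eventually_zero hy] with x hx
  simp [greenField, hx.1, hx.2]

theorem contDiff_greenField {n : ℕ} {v φ : E n → ℂ} (hv : ContDiffOn ℝ 2 v (pBall n))
    (hφ : IsTest φ) (i : Fin n) : ContDiff ℝ 1 (greenField v φ i) := by
  refine contDiff_iff_contDiffAt.2 fun y => ?_
  by_cases hy : y ∈ tsupport φ
  · have hb := hφ.support_subset hy
    have hn := (isOpen_pBall n).mem_nhds hb
    have h1 : ContDiffAt ℝ 2 v y := hv.contDiffAt hn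
    have h2 : ContDiffAt ℝ 2 φ y := hφ.smooth.contDiffAt.of_le two_le_infty
    have h3 : ContDiffAt ℝ 1 (confFactor : E n → ℝ) y :=
      (contDiffOn_confFactor.contDiffAt hn).of_le (one_le_two.trans two_le_infty)
    exact (h3.pow _).smul (((h1.of_le (by norm_num)).mul (contDiffAt_dir h2 _)).sub
      ((h2.of_le (by norm_num)).mul (contDiffAt_dir h1 _)))
  · exact (contDiffAt_const (c := (0 : ℂ))).congr_of_eventuallyEq (greenField_eventually_zero i hy)

theorem hasCompactSupport_greenField {n : ℕ} {v φ : E n → ℂ} (hφ : IsTest φ) (i : Fin n) :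
    HasCompactSupport (greenField v φ i) :=
  HasCompactSupport.intro hφ.compact fun _ hy => (greenField_eventually_zero i hy).self_of_nhds

/-- The Euclidean divergence of the field is `Wⁿ (v Δ_ℍ φ - φ Δ_ℍ v)`. -/
theorem sum_fderiv_greenField {n : ℕ} (hn : 2 ≤ n) {v φ : E n → ℂ} {y : E n} (hy : y ∈ pBall n)
    (hv : ContDiffAt ℝ 2 v y) (hφ : ContDiffAt ℝ 2 φ y) :
    ∑ i, fderiv ℝ (greenField v φ i) y (bv i) =
      hypDens y • (v y * hypLaplacian φ y - hypLaplacian v y * φ y) := by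
  obtain ⟨m, rfl⟩ : ∃ m, n = m + 2 := ⟨n - 2, by omega⟩
  have h0 := one_sub_sq_pos hy
  have hW : 0 < confFactor y := by unfold confFactor; positivity
  have hM : 1 - ‖y‖ ^ 2 = 2 / confFactor y := by unfold confFactor; field_simp
  have hdv := hv.differentiableAt (by norm_num)
  have hdφ := hφ.differentiableAt (by norm_num)
  have hterm : ∀ i : Fin (m + 2), fderiv ℝ (greenField v φ i) y (bv i) =
      (confFactor y ^ m : ℝ) • (v y * fderiv ℝ (fun y => fderiv ℝ φ y (bv i)) y (bv i) -
        φ y * fderiv ℝ (fun y => fderiv ℝ v y (bv i)) y (bv i)) +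
      (m * confFactor y ^ (m + 1) : ℝ) • (v y * (inner ℝ y (bv i) • fderiv ℝ φ y (bv i)) -
        φ y * (inner ℝ y (bv i) • fderiv ℝ v y (bv i))) := by
    intro i
    have hp := (hasFDerivAt_confFactor hy).pow m
    have h1 := hdv.hasFDerivAt.mul
      ((contDiffAt_dir hφ (bv i)).differentiableAt (by norm_num)).hasFDerivAt
    have h2 := hdφ.hasFDerivAt.mul
      ((contDiffAt_dir hv (bv i)).differentiableAt (by norm_num)).hasFDerivAt
    have h := (hp.smul (h1.sub h2)).fderiv
    have e : greenField v φ i = fun y => confFactor y ^ m •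
        (v y * fderiv ℝ φ y (bv i) - φ y * fderiv ℝ v y (bv i)) := rfl
    rw [e]
    refine (congrArg (fun L => L (bv i)) h).trans ?_
    -- For `m = 0` the truncated exponent `m - 1` in the derivative of the power is harmless.
    rcases m with _ | m
    · simp
      ring
    · simp
      ring
  simp_rw [hterm]
  rw [Finset.sum_add_distrib, ← Finset.smul_sum, ← Finset.smul_sum, Finset.sum_sub_distrib,
    Finset.sum_sub_distrib, ← Finset.mul_sum, ← Finset.mul_sum, ← Finset.mul_sum, ← Finset.mul_sum,
    sum_inner_smul_clm, sum_inner_smul_clm, ← laplacian_eq_sum hv, ← laplacian_eq_sum hφ,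
    hypLaplacian, hypLaplacian, hM, show hypDens y = confFactor y ^ (m + 2) from rfl]
  simp only [Complex.real_smul]
  have hWc : (confFactor y : ℂ) ≠ 0 := by exact_mod_cast hW.ne'
  push_cast
  field_simp
  ring

theorem isTest_contDiffAt {n : ℕ} {φ : E n → ℂ} (hφ : IsTest φ) (y : E n) : ContDiffAt ℝ 2 φ y :=
  hφ.smooth.contDiffAt.of_le two_le_infty

theorem continuousAt_laplacian {n : ℕ} {u : E n → ℂ} {y : E n} (h : ContDiffAt ℝ 2 u y) :
    ContinuousAt (Laplacian.laplacian u) y := by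
  have h1 : ∀ᶠ x in 𝓝 y, ContDiffAt ℝ 2 u x := h.eventually (by simp)
  have h2 : (Laplacian.laplacian u) =ᶠ[𝓝 y]
      fun x => ∑ i, fderiv ℝ (fun y => fderiv ℝ u y (bv i)) x (bv i) := by
    filter_upwards [h1] with x hx using laplacian_eq_sum hx
  refine ContinuousAt.congr_of_eventuallyEq ?_ h2
  refine tendsto_finsetSum _ fun i _ => ?_
  have := (contDiffAt_dir h (bv i)).fderiv_right (m := 0) (by norm_num)
  exact (this.continuousAt.clm_apply continuousAt_const)

theorem continuousAt_shiftedOp {n : ℕ} (κ : ℂ) {u : E n → ℂ} {y : E n} (h : ContDiffAt ℝ 2 u y) :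
    ContinuousAt (shiftedOp κ u) y := by
  have h1 := continuousAt_laplacian h
  have h2 : ContinuousAt (fun y => fderiv ℝ u y y) y :=
    (h.fderiv_right (m := 0) (by norm_num)).continuousAt.clm_apply continuousAt_id
  have h3 := h.continuousAt
  have h4 : ContinuousAt (fun x : E n => (1 - ‖x‖ ^ 2 : ℝ)) y := by fun_prop
  have h5 : ContinuousAt (fun x : E n => ((1 - ‖x‖ ^ 2) / 4 : ℝ)) y := h4.div_const 4
  have h6 : ContinuousAt (fun x => (1 - ‖x‖ ^ 2) • Laplacian.laplacian u x) y := h4.smul h1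
  have h7 : ContinuousAt (hypLaplacian u) y := 
    h5.smul (h6.add ((continuousAt_const (y := 2 * ((n : ℝ) - 2))).smul h2))
  have h8 := (h3.const_mul (((n : ℂ) - 1) ^ 2 / 4))
  exact (h7.neg.sub h8).add (h3.const_mul κ)

theorem shiftedOp_eq_zero {n : ℕ} (κ : ℂ) {φ : E n → ℂ} {y : E n} (hy : y ∉ tsupport φ) :
    shiftedOp κ φ y = 0 := by
  have h : φ =ᶠ[𝓝 y] fun _ => 0 := (IsTest.eventually_zero hy).mono fun x hx => hx.1
  have h1 : Laplacian.laplacian φ y = 0 := by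
    rw [(InnerProductSpace.laplacian_congr_nhds h).self_of_nhds, laplacian_eq_sum contDiffAt_const]
    simp
  simp [shiftedOp, hypLaplacian, h1, h.self_of_nhds, (IsTest.eventually_zero hy).self_of_nhds.2]

/-- Green's identity for a test function: the operator is symmetric with respect to the hyperbolic
volume, for the bilinear pairing without complex conjugation. -/
theorem green_identity {n : ℕ} (hn : 2 ≤ n) (κ : ℂ) {v φ : E n → ℂ}
    (hv : ContDiffOn ℝ 2 v (pBall n)) (hφ : IsTest φ) :
    ∫ y, v y * shiftedOp κ φ y ∂(hypVolume n) = ∫ y, shiftedOp κ v y * φ y ∂(hypVolume n) := by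
  have hvat : ∀ y ∈ pBall n, ContDiffAt ℝ 2 v y := fun y hy =>
    hv.contDiffAt ((isOpen_pBall n).mem_nhds hy)
  have i1 : Integrable (fun y => v y * shiftedOp κ φ y) (hypVolume n) := by
    refine integrable_hypVolume_of_support hφ.compact hφ.support_subset ?_ ?_
    · intro y hy
      exact ((hvat y (hφ.support_subset hy)).continuousAt.mul
        (continuousAt_shiftedOp κ (isTest_contDiffAt hφ y))).continuousWithinAt
    · intro y hy
      rw [shiftedOp_eq_zero κ hy, mul_zero]
  have i2 : Integrable (fun y => shiftedOp κ v y * φ y) (hypVolume n) := by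
    refine integrable_hypVolume_of_support hφ.compact hφ.support_subset ?_ ?_
    · intro y hy
      exact ((continuousAt_shiftedOp κ (hvat y (hφ.support_subset hy))).mul
        hφ.smooth.continuous.continuousAt).continuousWithinAt
    · intro y hy
      rw [image_eq_zero_of_notMem_tsupport hy, mul_zero]
  rw [← sub_eq_zero, ← integral_sub i1 i2, integral_hypVolume]
  have h1 : ∫ y in pBall n, hypDens y • (v y * shiftedOp κ φ y - shiftedOp κ v y * φ y) =
      ∫ y in pBall n, -∑ i, fderiv ℝ (greenField v φ i) y (bv i) := by
    refine setIntegral_congr_fun measurableSet_ball fun y hy => ?_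
    rw [sum_fderiv_greenField hn hy (hvat y hy) (isTest_contDiffAt hφ y), ← smul_neg]
    congr 1
    simp only [shiftedOp]
    ring
  have h2 : ∀ y ∉ pBall n, -∑ i, fderiv ℝ (greenField v φ i) y (bv i) = 0 := by
    intro y hy
    rw [neg_eq_zero]
    refine Finset.sum_eq_zero fun i _ => ?_
    have := (greenField_eventually_zero (v := v) (φ := φ) i
      (fun h => hy (hφ.support_subset h))).fderiv_eq (𝕜 := ℝ)
    rw [this]
    simp
  rw [h1, setIntegral_eq_integral_of_forall_compl_eq_zero h2, integral_neg, integral_finsetSum]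
  · simp [integral_fderiv_eq_zero (contDiff_greenField hv hφ _) (hasCompactSupport_greenField hφ _)]
  · intro i _
    exact Continuous.integrable_of_hasCompactSupport
      (((contDiff_greenField hv hφ i).continuous_fderiv (by norm_num)).clm_apply continuous_const)
      ((hasCompactSupport_greenField hφ i).fderiv_apply ℝ _)

/-! ### The Laplacian of a function of the distance -/

theorem contDiffOn_coshDist {n : ℕ} {x : E n} (hx : x ∈ pBall n) :
    ContDiffOn ℝ ∞ (coshDist x) (pBall n) := by
  unfold coshDist
  refine contDiffOn_const.add (ContDiffOn.div ?_ ?_ fun y hy =>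
    (mul_pos (one_sub_sq_pos hx) (one_sub_sq_pos hy)).ne')
  · exact contDiffOn_const.mul ((contDiff_norm_sq ℝ).comp (contDiff_id.sub contDiff_const)).contDiffOn
  · exact contDiffOn_const.mul (contDiffOn_const.sub (contDiff_norm_sq ℝ).contDiffOn)

/-- The Euclidean derivative of `coshDist x` at `y` in the direction `v`. -/
noncomputable def coshDistDir {n : ℕ} (x y v : E n) : ℝ :=
  4 / (1 - ‖x‖ ^ 2) * ((inner ℝ (y - x) v * (1 - ‖y‖ ^ 2) + ‖y - x‖ ^ 2 * inner ℝ y v) /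
    (1 - ‖y‖ ^ 2) ^ 2)

theorem fderiv_coshDist {n : ℕ} {x y : E n} (hx : x ∈ pBall n) (hy : y ∈ pBall n) (v : E n) :
    fderiv ℝ (coshDist x) y v = coshDistDir x y v := by
  have h0 := (one_sub_sq_pos hx).ne'
  have h := (one_sub_sq_pos hy).ne'
  have h1 : HasFDerivAt (fun y : E n => 1 - ‖y‖ ^ 2) (-(2 • innerSL ℝ y)) y :=
    (hasStrictFDerivAt_norm_sq y).hasFDerivAt.const_sub 1
  have h2 : HasFDerivAt (fun y : E n => ‖y - x‖ ^ 2) (2 • innerSL ℝ (y - x)) y :=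
    (((hasFDerivAt_id y).sub_const x).norm_sq).congr_fderiv (by ext w; simp)
  have h3 := (((h2.const_mul 2).mul ((hasDerivAt_inv (mul_ne_zero h0 h)).comp_hasFDerivAt y
    (h1.const_mul (1 - ‖x‖ ^ 2)))).const_add 1).fderiv
  have e : coshDist x = fun y : E n => 1 + 2 * ‖y - x‖ ^ 2 *
      ((fun t : ℝ => t⁻¹) ∘ fun y : E n => (1 - ‖x‖ ^ 2) * (1 - ‖y‖ ^ 2)) y := by
    funext y; simp [coshDist, div_eq_mul_inv]
  rw [e]
  refine (congrArg (fun L => L v) h3).trans ?_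
  simp [coshDistDir, inner_sub_left]
  field_simp
  ring

theorem fderiv_coshDistDir {n : ℕ} {x y : E n} (hx : x ∈ pBall n) (hy : y ∈ pBall n) (v : E n) :
    fderiv ℝ (fun y => coshDistDir x y v) y v =
      4 / (1 - ‖x‖ ^ 2) * (‖v‖ ^ 2 * (1 - ‖y‖ ^ 2 + ‖y - x‖ ^ 2) / (1 - ‖y‖ ^ 2) ^ 2 +
        4 * (inner ℝ y v * inner ℝ (y - x) v * (1 - ‖y‖ ^ 2) +
          ‖y - x‖ ^ 2 * (inner ℝ y v * inner ℝ y v)) / (1 - ‖y‖ ^ 2) ^ 3) := by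
  have h0 := (one_sub_sq_pos hx).ne'
  have h := (one_sub_sq_pos hy).ne'
  have h1 : HasFDerivAt (fun y : E n => 1 - ‖y‖ ^ 2) (-(2 • innerSL ℝ y)) y :=
    (hasStrictFDerivAt_norm_sq y).hasFDerivAt.const_sub 1
  have h2 : HasFDerivAt (fun y : E n => ‖y - x‖ ^ 2) (2 • innerSL ℝ (y - x)) y :=
    (((hasFDerivAt_id y).sub_const x).norm_sq).congr_fderiv (by ext w; simp)
  have h4 : HasFDerivAt (fun y : E n => inner ℝ v y) (innerSL ℝ v) y := (innerSL ℝ v).hasFDerivAt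
  have h5 : HasFDerivAt (fun y : E n => inner ℝ v (y - x)) (innerSL ℝ v) y :=
    (innerSL ℝ v).hasFDerivAt.comp y ((hasFDerivAt_id y).sub_const x)
  have h3 := ((((h5.mul h1).add (h2.mul h4)).mul ((hasDerivAt_inv (pow_ne_zero 2 h)).comp_hasFDerivAt
    y (h1.pow 2))).const_mul (4 / (1 - ‖x‖ ^ 2))).fderiv
  have e : (fun y => coshDistDir x y v) = fun y : E n => 4 / (1 - ‖x‖ ^ 2) *
      ((inner ℝ v (y - x) * (1 - ‖y‖ ^ 2) + ‖y - x‖ ^ 2 * inner ℝ v y) *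
      ((fun t : ℝ => t⁻¹) ∘ fun y : E n => (1 - ‖y‖ ^ 2) ^ 2) y) := by
    funext y; simp [coshDistDir, div_eq_mul_inv, real_inner_comm v]
  rw [e]
  refine (congrArg (fun L => L v) h3).trans ?_
  simp only [real_inner_comm v]
  simp [inner_sub_right]
  simp only [real_inner_comm v]
  field_simp
  ring

/-- The squared hyperbolic gradient of `C = cosh ρ(x, ·)` is `sinh² ρ = C² - 1`. -/
theorem sum_coshDistDir_sq {n : ℕ} {x y : E n} (hx : x ∈ pBall n) (hy : y ∈ pBall n) :
    (1 - ‖y‖ ^ 2) ^ 2 / 4 * ∑ i, coshDistDir x y (bv i) ^ 2 = coshDist x y ^ 2 - 1 := by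
  have h0 := (one_sub_sq_pos hx).ne'
  have h := (one_sub_sq_pos hy).ne'
  have e : ∀ i : Fin n, coshDistDir x y (bv i) ^ 2 = 16 / ((1 - ‖x‖ ^ 2) ^ 2 * (1 - ‖y‖ ^ 2) ^ 4) *
      ((1 - ‖y‖ ^ 2) ^ 2 * (inner ℝ (y - x) (bv i) * inner ℝ (y - x) (bv i)) +
        2 * ‖y - x‖ ^ 2 * (1 - ‖y‖ ^ 2) * (inner ℝ (y - x) (bv i) * inner ℝ y (bv i)) +
        (‖y - x‖ ^ 2) ^ 2 * (inner ℝ y (bv i) * inner ℝ y (bv i))) := by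
    intro i
    unfold coshDistDir
    field_simp
    ring
  simp_rw [e]
  rw [← Finset.mul_sum, Finset.sum_add_distrib, Finset.sum_add_distrib, ← Finset.mul_sum,
    ← Finset.mul_sum, ← Finset.mul_sum, sum_inner_bv, sum_inner_bv, sum_inner_bv,
    real_inner_self_eq_norm_sq, real_inner_self_eq_norm_sq, inner_sub_left,
    real_inner_self_eq_norm_sq, coshDist]
  have hd : ‖y - x‖ ^ 2 = ‖y‖ ^ 2 - 2 * inner ℝ x y + ‖x‖ ^ 2 := by
    rw [norm_sub_sq_real, real_inner_comm]
  rw [hd]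
  field_simp
  ring

/-- The Laplacian of the distance function: `Δ_ℍ C = n C`. -/
theorem sum_fderiv_coshDistDir {n : ℕ} {x y : E n} (hx : x ∈ pBall n) (hy : y ∈ pBall n) :
    (1 - ‖y‖ ^ 2) / 4 * ((1 - ‖y‖ ^ 2) * ∑ i, fderiv ℝ (fun y => coshDistDir x y (bv i)) y (bv i) +
      2 * ((n : ℝ) - 2) * coshDistDir x y y) = n * coshDist x y := by
  have h0 := (one_sub_sq_pos hx).ne'
  have h := (one_sub_sq_pos hy).ne'
  have e : ∀ i : Fin n, fderiv ℝ (fun y => coshDistDir x y (bv i)) y (bv i) =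
      4 / (1 - ‖x‖ ^ 2) * ((1 - ‖y‖ ^ 2 + ‖y - x‖ ^ 2) / (1 - ‖y‖ ^ 2) ^ 2) +
      (16 / ((1 - ‖x‖ ^ 2) * (1 - ‖y‖ ^ 2) ^ 2) * (inner ℝ y (bv i) * inner ℝ (y - x) (bv i)) +
      16 * ‖y - x‖ ^ 2 / ((1 - ‖x‖ ^ 2) * (1 - ‖y‖ ^ 2) ^ 3) *
        (inner ℝ y (bv i) * inner ℝ y (bv i))) := by
    intro i
    rw [fderiv_coshDistDir hx hy, norm_bv]
    field_simp
    ring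
  simp_rw [e]
  rw [Finset.sum_add_distrib, Finset.sum_add_distrib, ← Finset.mul_sum, ← Finset.mul_sum,
    ← Finset.mul_sum,
    sum_inner_bv, sum_inner_bv, Finset.sum_const, Finset.card_univ, Fintype.card_fin,
    real_inner_self_eq_norm_sq,
    inner_sub_right, real_inner_self_eq_norm_sq, coshDistDir, inner_sub_left,
    real_inner_self_eq_norm_sq, coshDist]
  have hd : ‖y - x‖ ^ 2 = ‖y‖ ^ 2 - 2 * inner ℝ x y + ‖x‖ ^ 2 := by
    rw [norm_sub_sq_real, real_inner_comm]
  rw [hd, real_inner_comm x y]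
  rw [nsmul_eq_mul]
  field_simp
  ring

/-- The radial form of the Laplacian: `Δ_ℍ (q ∘ C) = (C² - 1) q'' + n C q'` for
`C = cosh ρ(x, ·)`. -/
theorem hypLaplacian_comp_coshDist {n : ℕ} {x y : E n} (hx : x ∈ pBall n) (hy : y ∈ pBall n)
    {q q₁ : ℝ → ℂ} {q₂ : ℂ} (hq : ∀ᶠ C in 𝓝 (coshDist x y), HasDerivAt q (q₁ C) C)
    (hq₁ : HasDerivAt q₁ q₂ (coshDist x y)) (hs : ContDiffAt ℝ 2 q (coshDist x y)) :
    hypLaplacian (fun y => q (coshDist x y)) y =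
      ((coshDist x y : ℂ) ^ 2 - 1) * q₂ + n * coshDist x y * q₁ (coshDist x y) := by
  have hC : ∀ y ∈ pBall n, ContDiffAt ℝ 2 (coshDist x) y := fun y hy =>
    ((contDiffOn_coshDist hx).contDiffAt ((isOpen_pBall n).mem_nhds hy)).of_le two_le_infty
  have hdC : ∀ y ∈ pBall n, HasFDerivAt (coshDist x) (fderiv ℝ (coshDist x) y) y := fun y hy =>
    ((hC y hy).differentiableAt (by norm_num)).hasFDerivAt
  have hu : ContDiffAt ℝ 2 (fun y => q (coshDist x y)) y := hs.comp y (hC y hy)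
  have hfd : ∀ᶠ w in 𝓝 y, ∀ v, fderiv ℝ (fun y => q (coshDist x y)) w v =
      coshDistDir x w v • q₁ (coshDist x w) := by
    filter_upwards [(hC y hy).continuousAt.eventually hq, (isOpen_pBall n).mem_nhds hy] with w hw hwb v
    have := (hw.hasFDerivAt.comp w (hdC w hwb)).fderiv
    refine (congrArg (fun L => L v) this).trans ?_
    rw [← fderiv_coshDist hx hwb v]
    simp
  have hdir : ∀ v : E n, DifferentiableAt ℝ (fun w => coshDistDir x w v) y := by
    intro v
    have h1 : ContDiffAt ℝ 1 (fun w => fderiv ℝ (coshDist x) w v) y :=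
      ((hC y hy).fderiv_right (m := 1) (by norm_num)).clm_apply contDiffAt_const
    refine (h1.differentiableAt (by norm_num)).congr_of_eventuallyEq ?_
    filter_upwards [(isOpen_pBall n).mem_nhds hy] with w hw
    rw [fderiv_coshDist hx hw]
  have hsec : ∀ i : Fin n, fderiv ℝ (fun w => fderiv ℝ (fun y => q (coshDist x y)) w (bv i)) y (bv i) =
      ((coshDistDir x y (bv i) ^ 2 : ℝ) : ℂ) * q₂ +
        ((fderiv ℝ (fun w => coshDistDir x w (bv i)) y (bv i) : ℝ) : ℂ) * q₁ (coshDist x y) := by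
    intro i
    have he : (fun w => fderiv ℝ (fun y => q (coshDist x y)) w (bv i)) =ᶠ[𝓝 y]
        fun w => coshDistDir x w (bv i) • q₁ (coshDist x w) := hfd.mono fun w hw => hw _
    rw [he.fderiv_eq]
    have h2 := ((hdir (bv i)).hasFDerivAt.smul (hq₁.hasFDerivAt.comp y (hdC y hy))).fderiv
    refine (congrArg (fun L => L (bv i)) h2).trans ?_
    rw [add_apply, smul_apply, ContinuousLinearMap.smulRight_apply,
      ContinuousLinearMap.comp_apply, ContinuousLinearMap.toSpanSingleton_apply,
      fderiv_coshDist hx hy]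
    simp only [Complex.real_smul, Function.comp_apply]
    push_cast
    ring
  have h1 := sum_coshDistDir_sq hx hy
  have h2 := sum_fderiv_coshDistDir hx hy
  rw [hypLaplacian, laplacian_eq_sum hu, hfd.self_of_nhds]
  simp_rw [hsec]
  rw [Finset.sum_add_distrib, ← Finset.sum_mul, ← Finset.sum_mul, ← Complex.ofReal_sum,
    ← Complex.ofReal_sum]
  simp only [Complex.real_smul]
  have h1' := congrArg (fun r : ℝ => (r : ℂ)) h1
  have h2' := congrArg (fun r : ℝ => (r : ℂ)) h2
  generalize ∑ i, coshDistDir x y (bv i) ^ 2 = S1 at *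
  generalize ∑ i, fderiv ℝ (fun y => coshDistDir x y (bv i)) y (bv i) = S2 at *
  push_cast at h1' h2' ⊢
  linear_combination q₂ * h1' + q₁ (coshDist x y) * h2'

/-! ### The profile of the approximate identity -/

/-- The profile `(2|ζ|² + 1)^{-(n/2+1)}` of the approximate identity produced by the regularised
Green function. -/
noncomputable def profile {n : ℕ} (ζ : E n) : ℝ := (2 * ‖ζ‖ ^ 2 + 1) ^ (-((n : ℝ) / 2 + 1))

theorem hasDerivAt_profile_primitive {n : ℕ} (hn : 2 ≤ n) (r : ℝ) :
    HasDerivAt (fun r : ℝ => r ^ n * (2 * r ^ 2 + 1) ^ (-((n : ℝ) / 2)) / n)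
      (r ^ (n - 1) * (2 * r ^ 2 + 1) ^ (-((n : ℝ) / 2 + 1))) r := by
  have hpos : 0 < 2 * r ^ 2 + 1 := by positivity
  have hn0 : (n : ℝ) ≠ 0 := by positivity
  have h1 : HasDerivAt (fun r : ℝ => 2 * r ^ 2 + 1) (2 * (2 * r)) r := by
    simpa using ((hasDerivAt_pow 2 r).const_mul 2).add_const 1
  have h2 := h1.rpow_const (p := -((n : ℝ) / 2)) (Or.inl hpos.ne')
  have h3 := ((hasDerivAt_pow n r).mul h2).div_const (n : ℝ)
  refine h3.congr_deriv ?_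
  have e1 : (2 * r ^ 2 + 1) ^ (-((n : ℝ) / 2)) =
      (2 * r ^ 2 + 1) * (2 * r ^ 2 + 1) ^ (-((n : ℝ) / 2 + 1)) := by
    rw [show -((n : ℝ) / 2) = 1 + -((n : ℝ) / 2 + 1) by ring, Real.rpow_add hpos, Real.rpow_one]
  have e2 : -((n : ℝ) / 2) - 1 = -((n : ℝ) / 2 + 1) := by ring
  have e3 : r ^ n = r ^ (n - 1) * r := by rw [← pow_succ]; congr 1; omega
  rw [e2, e1, e3]
  field_simp
  ring

/-- The radial integral of the profile, with the primitive of `hasDerivAt_profile_primitive`. -/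
theorem profile_radial {n : ℕ} (hn : 2 ≤ n) :
    IntegrableOn (fun r : ℝ => r ^ (n - 1) * (2 * r ^ 2 + 1) ^ (-((n : ℝ) / 2 + 1))) (Set.Ioi 0) ∧
    ∫ r in Set.Ioi (0 : ℝ), r ^ (n - 1) * (2 * r ^ 2 + 1) ^ (-((n : ℝ) / 2 + 1)) =
      (2 : ℝ) ^ (-((n : ℝ) / 2)) / n := by
  have hlim : Tendsto (fun r : ℝ => r ^ n * (2 * r ^ 2 + 1) ^ (-((n : ℝ) / 2)) / n) atTop
      (𝓝 ((2 : ℝ) ^ (-((n : ℝ) / 2)) / n)) := by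
    refine Tendsto.div_const ?_ _
    have h1 : Tendsto (fun r : ℝ => (2 + (r ^ 2)⁻¹) ^ (-((n : ℝ) / 2))) atTop
        (𝓝 ((2 + 0) ^ (-((n : ℝ) / 2)))) :=
      (((tendsto_pow_atTop (by norm_num)).inv_tendsto_atTop).const_add 2).rpow_const
        (Or.inl (by norm_num))
    rw [add_zero] at h1
    refine h1.congr' ?_
    filter_upwards [eventually_gt_atTop 0] with r hr
    have e1 : r ^ n = (r ^ 2) ^ ((n : ℝ) / 2) := by
      rw [← Real.rpow_natCast r 2, ← Real.rpow_mul hr.le, ← Real.rpow_natCast]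
      congr 1; push_cast; ring
    have e2 : (2 : ℝ) + (r ^ 2)⁻¹ = (2 * r ^ 2 + 1) / r ^ 2 := by field_simp
    rw [e2, Real.div_rpow (by positivity) (by positivity), e1, Real.rpow_neg (by positivity : 0 ≤ r ^ 2)]
    field_simp
  have hnn : ∀ r ∈ Set.Ioi (0 : ℝ), 0 ≤ r ^ (n - 1) * (2 * r ^ 2 + 1) ^ (-((n : ℝ) / 2 + 1)) := by
    intro r hr
    have : (0 : ℝ) < r := hr
    positivity
  refine ⟨integrableOn_Ioi_deriv_of_nonneg' (fun r _ => hasDerivAt_profile_primitive hn r) hnn hlim,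
    ?_⟩
  rw [integral_Ioi_of_hasDerivAt_of_nonneg' (fun r _ => hasDerivAt_profile_primitive hn r) hnn hlim]
  have : n ≠ 0 := by omega
  simp [this]

theorem nontrivial_E {n : ℕ} (hn : 2 ≤ n) : Nontrivial (E n) := by
  have : Nonempty (Fin n) := ⟨⟨0, by omega⟩⟩
  infer_instance

theorem integrable_profile {n : ℕ} (hn : 2 ≤ n) : Integrable (profile : E n → ℝ) := by
  have := nontrivial_E hn
  have h := (integrable_fun_norm_addHaar (volume : Measure (E n))
    (f := fun r : ℝ => (2 * r ^ 2 + 1) ^ (-((n : ℝ) / 2 + 1)))).2 (by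
      simpa using (profile_radial hn).1)
  exact h

theorem integral_profile {n : ℕ} (hn : 2 ≤ n) :
    ∫ ζ : E n, profile ζ = 2 ^ (-((n : ℝ) / 2)) * Real.pi ^ ((n : ℝ) / 2) /
      Real.Gamma ((n : ℝ) / 2 + 1) := by
  have := nontrivial_E hn
  have hne : Nonempty (Fin n) := ⟨⟨0, by omega⟩⟩
  have hn0 : (n : ℝ) ≠ 0 := by positivity
  have h := integral_fun_norm_addHaar (volume : Measure (E n))
    (fun r : ℝ => (2 * r ^ 2 + 1) ^ (-((n : ℝ) / 2 + 1)))
  have hG : 0 < Real.Gamma ((n : ℝ) / 2 + 1) := Real.Gamma_pos_of_pos (by positivity)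
  have hv : (volume : Measure (E n)).real (Metric.ball 0 1) =
      Real.pi ^ ((n : ℝ) / 2) / Real.Gamma ((n : ℝ) / 2 + 1) := by
    rw [Measure.real, EuclideanSpace.volume_ball]
    simp only [ENNReal.ofReal_one, one_pow, one_mul, Fintype.card_fin]
    rw [ENNReal.toReal_ofReal (by positivity), Real.sqrt_eq_rpow, ← Real.rpow_natCast,
      ← Real.rpow_mul Real.pi_pos.le]
    ring_nf
  refine h.trans ?_
  rw [hv]
  simp only [smul_eq_mul, finrank_euclideanSpace, Fintype.card_fin, nsmul_eq_mul]
  rw [(profile_radial hn).2]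
  field_simp

theorem integral_comp_affine {n : ℕ} {F : Type*} [NormedAddCommGroup F] [NormedSpace ℝ F]
    (f : E n → F) (x : E n) {s : ℝ} (hs : 0 < s) :
    ∫ y, f y = ∫ ζ : E n, s ^ n • f (x + s • ζ) := by
  rw [integral_smul, Measure.integral_comp_smul volume (fun y => f (x + y)) s,
    integral_add_left_eq_self, finrank_euclideanSpace, Fintype.card_fin, smul_smul,
    abs_of_pos (by positivity), mul_inv_cancel₀ (by positivity), one_smul]

theorem integrable_comp_affine {n : ℕ} {F : Type*} [NormedAddCommGroup F] [NormedSpace ℝ F]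
    {f : E n → F} (hf : Integrable f) (x : E n) {s : ℝ} (hs : s ≠ 0) :
    Integrable fun ζ : E n => f (x + s • ζ) :=
  ((hf.comp_add_left x)).comp_smul hs

/-- The profile at scale `s`. The bounds of the regularisation error appear in the form on the left. -/
theorem profile_scale {n : ℕ} {s : ℝ} (hs : 0 < s) (ζ : E n) :
    s ^ n * (s ^ 2 * (2 * ‖s • ζ‖ ^ 2 + s ^ 2) ^ (-((n : ℝ) / 2 + 1))) = profile ζ := by
  have e1 : 2 * ‖s • ζ‖ ^ 2 + s ^ 2 = s ^ 2 * (2 * ‖ζ‖ ^ 2 + 1) := by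
    rw [norm_smul, mul_pow, Real.norm_eq_abs, sq_abs]; ring
  have e2 : (s ^ 2) ^ (-((n : ℝ) / 2 + 1)) = (s ^ n * s ^ 2)⁻¹ := by
    rw [Real.rpow_neg (by positivity), ← pow_add, ← Real.rpow_natCast s 2,
      ← Real.rpow_mul hs.le, ← Real.rpow_natCast s (n + 2)]
    congr 2; push_cast; ring
  rw [e1, Real.mul_rpow (by positivity) (by positivity), e2, profile]
  field_simp

/-- The total mass of the rescaled profiles does not depend on the scale. -/
theorem integral_scaled_profile {n : ℕ} (hn : 2 ≤ n) (x : E n) {s : ℝ} (hs : 0 < s) :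
    Integrable (fun y : E n => s ^ 2 * (2 * ‖y - x‖ ^ 2 + s ^ 2) ^ (-((n : ℝ) / 2 + 1))) ∧
    ∫ y : E n, s ^ 2 * (2 * ‖y - x‖ ^ 2 + s ^ 2) ^ (-((n : ℝ) / 2 + 1)) = ∫ ζ : E n, profile ζ := by
  have hk : ∀ ζ : E n, s ^ n • (s ^ 2 * (2 * ‖x + s • ζ - x‖ ^ 2 + s ^ 2) ^ (-((n : ℝ) / 2 + 1))) =
      profile ζ := fun ζ => by rw [add_sub_cancel_left, smul_eq_mul, profile_scale hs]
  constructor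
  · have h1 := (integrable_comp_affine (integrable_profile hn) (-(s⁻¹ • x))
      (inv_ne_zero hs.ne')).const_mul (s ^ n)⁻¹
    refine h1.congr (Eventually.of_forall fun y => ?_)
    simp only
    rw [← hk]
    have : x + s • (-(s⁻¹ • x) + s⁻¹ • y) = y := by
      rw [smul_add, smul_neg, smul_smul, smul_smul, mul_inv_cancel₀ hs.ne', one_smul, one_smul]
      abel
    rw [this, smul_eq_mul, inv_mul_cancel_left₀ (by positivity)]
  · rw [integral_comp_affine _ x hs]
    simp_rw [hk]

/-! ### The regularised Green function -/

/-- The image of the regularised Green function `C ↦ g(C + δ)` under the radial form of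
`-Δ_ℍ - (n-1)²/4 + z²`, simplified by the radial equation at `C + δ` (`regErr_eq`). It is formally of
order `δ`, so that it concentrates at `C = 1` as `δ → 0`. -/
noncomputable def regErr (n : ℕ) (z : ℂ) (δ C : ℝ) : ℂ :=
  δ * (2 * C + δ) * ((2 * Real.pi) ^ 2 * greenC (n + 4) z (C + δ)) -
    n * δ * (2 * Real.pi * greenC (n + 2) z (C + δ))

theorem regErr_eq {n : ℕ} (hn : 2 ≤ n) {z : ℂ} (hz : 0 ≤ z.re) {δ C : ℝ} (hC : 1 < C + δ) :
    -(((C : ℂ) ^ 2 - 1) * ((2 * Real.pi) ^ 2 * greenC (n + 4) z (C + δ)) +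
      n * C * (-(2 * Real.pi) * greenC (n + 2) z (C + δ))) -
      ((n : ℂ) - 1) ^ 2 / 4 * greenC n z (C + δ) + z ^ 2 * greenC n z (C + δ) =
      regErr n z δ C := by
  have h := greenC_ode hn hz hC
  push_cast at h
  rw [regErr]
  linear_combination -h

theorem norm_greenC_add_two_le {n : ℕ} (hn : 2 ≤ n) {z : ℂ} (hz : 0 ≤ z.re) {C : ℝ} (hC : 1 < C) :
    ‖greenC (n + 2) z C‖ ≤ greenBd (n + 2) z * (C / (C - 1)) ^ ((n : ℝ) / 2) *
      (C ^ (-((n : ℝ) - 1) / 2 - z.re) / C) := by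
  refine (norm_greenC_le (n := n + 2) (by omega) hz hC).trans_eq ?_
  rw [← Real.rpow_sub_one (by linarith : C ≠ 0)]
  congr 2
  · congr 1; push_cast; ring
  · push_cast; ring

theorem norm_greenC_add_four_le {n : ℕ} (hn : 2 ≤ n) {z : ℂ} (hz : 0 ≤ z.re) {C : ℝ} (hC : 1 < C) :
    ‖greenC (n + 4) z C‖ ≤ greenBd (n + 4) z * (C / (C - 1)) ^ ((n : ℝ) / 2 + 1) *
      (C ^ (-((n : ℝ) - 1) / 2 - z.re) / C / C) := by
  refine (norm_greenC_le (n := n + 4) (by omega) hz hC).trans_eq ?_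
  rw [← Real.rpow_sub_one (by linarith : C ≠ 0), ← Real.rpow_sub_one (by linarith : C ≠ 0)]
  congr 2
  · congr 1; push_cast; ring
  · push_cast; ring

/-- The worse of the two terms of the error decides the power `n/2 + 1` of the singular factor. -/
theorem norm_regErr_le {n : ℕ} (hn : 2 ≤ n) {z : ℂ} (hz : 0 ≤ z.re) :
    ∃ K : ℝ, 0 ≤ K ∧ ∀ δ C : ℝ, 0 < δ → 1 ≤ C →
      ‖regErr n z δ C‖ ≤ K * (δ * ((C + δ) / (C + δ - 1)) ^ ((n : ℝ) / 2 + 1)) *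
        (C + δ) ^ (-((n : ℝ) - 1) / 2 - z.re) := by
  have hB4 := greenBd_nonneg (n + 4) z
  have hB2 := greenBd_nonneg (n + 2) z
  refine ⟨2 * (2 * Real.pi) ^ 2 * greenBd (n + 4) z + n * (2 * Real.pi) * greenBd (n + 2) z,
    by positivity, fun δ C hδ hC => ?_⟩
  have hC' : 1 < C + δ := by linarith
  have h4 := norm_greenC_add_four_le hn hz hC'
  have h2 := norm_greenC_add_two_le hn hz hC'
  have hb : 2 * C + δ ≤ 2 * (C + δ) := by linarith
  have hb0 : 0 ≤ 2 * C + δ := by linarith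
  rw [regErr]
  generalize C + δ = D at *
  have h0 : 0 < D := by linarith
  have h01 : 0 < D - 1 := by linarith
  have hq : 1 ≤ D / (D - 1) := by rw [le_div_iff₀ h01]; linarith
  have hR : 0 < D ^ (-((n : ℝ) - 1) / 2 - z.re) := Real.rpow_pos_of_pos h0 _
  set R := D ^ (-((n : ℝ) - 1) / 2 - z.re)
  have hQ : (D / (D - 1)) ^ ((n : ℝ) / 2) ≤ (D / (D - 1)) ^ ((n : ℝ) / 2 + 1) :=
    Real.rpow_le_rpow_of_exponent_le hq (by linarith)
  set Q := (D / (D - 1)) ^ ((n : ℝ) / 2 + 1)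
  have hQ0 : 0 < Q := by positivity
  have h2' : ‖greenC (n + 2) z D‖ ≤ greenBd (n + 2) z * Q * R := by
    refine h2.trans ?_
    gcongr
    exact div_le_self hR.le hC'.le
  have h4' : ‖greenC (n + 4) z D‖ ≤ greenBd (n + 4) z * Q * R / D := by
    refine h4.trans ?_
    rw [mul_div_assoc]
    gcongr
    exact div_le_self hR.le hC'.le
  have hpi := Real.pi_pos
  refine (norm_sub_le _ _).trans ?_
  have e1 : ‖(δ : ℂ) * (2 * C + δ) * ((2 * Real.pi) ^ 2 * greenC (n + 4) z D)‖ =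
      δ * (2 * C + δ) * ((2 * Real.pi) ^ 2 * ‖greenC (n + 4) z D‖) := by
    have : (δ : ℂ) * (2 * C + δ) * ((2 * Real.pi) ^ 2 * greenC (n + 4) z D) =
      ((δ * (2 * C + δ) * (2 * Real.pi) ^ 2 : ℝ) : ℂ) * greenC (n + 4) z D := by push_cast; ring
    rw [this, norm_mul, Complex.norm_real, Real.norm_eq_abs, abs_of_nonneg (by positivity)]
    ring
  have e2 : ‖(n : ℂ) * δ * (2 * Real.pi * greenC (n + 2) z D)‖ =
      n * δ * (2 * Real.pi * ‖greenC (n + 2) z D‖) := by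
    have : (n : ℂ) * δ * (2 * Real.pi * greenC (n + 2) z D) =
      ((n * δ * (2 * Real.pi) : ℝ) : ℂ) * greenC (n + 2) z D := by push_cast; ring
    rw [this, norm_mul, Complex.norm_real, Real.norm_eq_abs, abs_of_nonneg (by positivity)]
    ring
  rw [e1, e2]
  calc _ ≤ δ * (2 * D) * ((2 * Real.pi) ^ 2 * (greenBd (n + 4) z * Q * R / D)) +
        n * δ * (2 * Real.pi * (greenBd (n + 2) z * Q * R)) := by gcongr
    _ = _ := by field_simp

theorem two_mul_sq_add_le {n : ℕ} {x y : E n} (hx : x ∈ pBall n) (hy : y ∈ pBall n) (δ : ℝ) :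
    2 * ‖y - x‖ ^ 2 + δ ≤ coshDist x y + δ - 1 := by
  linarith [le_coshDist_sub_one hx hy]

theorem continuousAt_greenC {n : ℕ} (hn : 2 ≤ n) {z : ℂ} (hz : 0 ≤ z.re) {C : ℝ} (hC : 1 < C) :
    ContinuousAt (greenC n z) C := (hasDerivAt_greenC hn hz hC).continuousAt

theorem continuousAt_regErr {n : ℕ} (hn : 2 ≤ n) {z : ℂ} (hz : 0 ≤ z.re) {δ C : ℝ}
    (hC : 1 < C + δ) : ContinuousAt (regErr n z δ) C := by
  have hs : ContinuousAt (fun C : ℝ => C + δ) C := by fun_prop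
  have h4 : ContinuousAt (fun C : ℝ => greenC (n + 4) z (C + δ)) C :=
    ContinuousAt.comp (f := fun C : ℝ => C + δ) (continuousAt_greenC (by omega) hz hC) hs
  have h2 : ContinuousAt (fun C : ℝ => greenC (n + 2) z (C + δ)) C :=
    ContinuousAt.comp (f := fun C : ℝ => C + δ) (continuousAt_greenC (by omega) hz hC) hs
  unfold regErr
  fun_prop

theorem continuousOn_coshDist {n : ℕ} {x : E n} (hx : x ∈ pBall n) :
    ContinuousOn (coshDist x) (pBall n) := (contDiffOn_coshDist hx).continuousOn

/-- The rescaled regularisation error converges to a multiple of the profile. The argument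
`(1 - |x|²)⁻¹ ζ` is the displacement `ζ` measured in the hyperbolic metric at `x`, up to a factor two.
Only the term of `g_{n+4}` survives. -/
theorem tendsto_regErr_scaled {n : ℕ} (hn : 2 ≤ n) {z : ℂ} (hz : 0 ≤ z.re) {x : E n}
    (hx : x ∈ pBall n) (ζ : E n) :
    Tendsto (fun s : ℝ => ((s ^ n : ℝ) : ℂ) * regErr n z (s ^ 2) (coshDist x (x + s • ζ))) (𝓝[>] 0)
      (𝓝 ((2 * (2 * Real.pi) ^ 2 * (2 ^ (-((n : ℝ) / 2 + 1)) * singConst (n + 4)) *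
        profile ((1 - ‖x‖ ^ 2)⁻¹ • ζ) : ℝ) : ℂ)) := by
  have hA := one_sub_sq_pos hx
  have hyc : Tendsto (fun s : ℝ => x + s • ζ) (𝓝[>] 0) (𝓝 x) := by
    have : Tendsto (fun s : ℝ => x + s • ζ) (𝓝 0) (𝓝 (x + (0 : ℝ) • ζ)) :=
      (by fun_prop : Continuous fun s : ℝ => x + s • ζ).tendsto 0
    simp only [zero_smul, add_zero] at this
    exact this.mono_left nhdsWithin_le_nhds
  have hmem : ∀ᶠ s : ℝ in 𝓝[>] 0, x + s • ζ ∈ pBall n :=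
    hyc.eventually ((isOpen_pBall n).mem_nhds hx)
  have hpos : ∀ᶠ s : ℝ in 𝓝[>] 0, 0 < s := self_mem_nhdsWithin
  have hs2 : Tendsto (fun s : ℝ => s ^ 2) (𝓝[>] 0) (𝓝 0) := by
    have : Tendsto (fun s : ℝ => s ^ 2) (𝓝 0) (𝓝 (0 ^ 2)) := (continuous_pow 2).tendsto 0
    simp only [ne_eq, OfNat.ofNat_ne_zero, not_false_eq_true, zero_pow] at this
    exact this.mono_left nhdsWithin_le_nhds
  set D : ℝ → ℝ := fun s => coshDist x (x + s • ζ) + s ^ 2 with hD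
  have hDlim : Tendsto D (𝓝[>] 0) (𝓝[>] 1) := by
    refine tendsto_nhdsWithin_iff.2 ⟨?_, ?_⟩
    · have h1 : Tendsto (fun s : ℝ => coshDist x (x + s • ζ)) (𝓝[>] 0) (𝓝 (coshDist x x)) :=
        (((continuousOn_coshDist hx).continuousAt ((isOpen_pBall n).mem_nhds hx)).tendsto).comp hyc
      have h2 := h1.add hs2
      have h3 : coshDist x x + 0 = 1 := by simp [coshDist]
      rwa [h3] at h2
    · filter_upwards [hmem, hpos] with s h1 h2
      have := one_le_coshDist hx h1
      have h3 : 0 < s ^ 2 := by positivity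
      simp only [Set.mem_Ioi, hD]; linarith
  -- All singular powers are powers of `D - 1`, and `(D - 1)/s²` has a positive limit.
  have hτ : 0 < 2 * ‖(1 - ‖x‖ ^ 2)⁻¹ • ζ‖ ^ 2 + 1 := by positivity
  have hratio : Tendsto (fun s => (D s - 1) / s ^ 2) (𝓝[>] 0)
      (𝓝 (2 * ‖(1 - ‖x‖ ^ 2)⁻¹ • ζ‖ ^ 2 + 1)) := by
    have h1 : Tendsto (fun s : ℝ => 2 * ‖ζ‖ ^ 2 / ((1 - ‖x‖ ^ 2) * (1 - ‖x + s • ζ‖ ^ 2)) + 1)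
        (𝓝[>] 0) (𝓝 (2 * ‖ζ‖ ^ 2 / ((1 - ‖x‖ ^ 2) * (1 - ‖x‖ ^ 2)) + 1)) := by
      refine Tendsto.add_const 1 (Tendsto.div tendsto_const_nhds ?_ (by positivity))
      exact (((hyc.norm.pow 2).const_sub 1).const_mul _)
    have e : 2 * ‖(1 - ‖x‖ ^ 2)⁻¹ • ζ‖ ^ 2 + 1 =
        2 * ‖ζ‖ ^ 2 / ((1 - ‖x‖ ^ 2) * (1 - ‖x‖ ^ 2)) + 1 := by
      rw [norm_smul, norm_inv, Real.norm_eq_abs, abs_of_pos hA]; field_simp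
    rw [e]
    refine h1.congr' ?_
    filter_upwards [hmem, hpos] with s h1 h2
    have := one_sub_sq_pos h1
    simp only [hD, coshDist, add_sub_cancel_left, norm_smul, Real.norm_eq_abs, mul_pow, sq_abs]
    field_simp
    ring
  have hpow : ∀ (k : ℝ) (s : ℝ), 0 < s → 0 < D s - 1 → (s ^ 2) ^ k =
      ((D s - 1) / s ^ 2) ^ (-k) * (D s - 1) ^ k := by
    intro k s hs hd
    rw [Real.div_rpow hd.le (by positivity), Real.rpow_neg hd.le, Real.rpow_neg (by positivity)]
    have : (D s - 1) ^ k ≠ 0 := (Real.rpow_pos_of_pos hd k).ne'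
    field_simp
  have hr4 := hratio.rpow_const (p := -((n : ℝ) / 2 + 1)) (Or.inl hτ.ne')
  have hr2 := hratio.rpow_const (p := -((n : ℝ) / 2)) (Or.inl hτ.ne')
  have hg4 := (tendsto_greenC_one (n := n + 4) (by omega) hz).comp hDlim
  have hg2 := (tendsto_greenC_one (n := n + 2) (by omega) hz).comp hDlim
  have hc4 : (((n + 4 : ℕ) : ℝ) - 2) / 2 = (n : ℝ) / 2 + 1 := by push_cast; ring
  have hc2 : (((n + 2 : ℕ) : ℝ) - 2) / 2 = (n : ℝ) / 2 := by push_cast; ring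
  have hc4' : -(((n + 4 : ℕ) : ℝ) - 2) / 2 = -((n : ℝ) / 2 + 1) := by push_cast; ring
  rw [hc4, hc4'] at hg4
  rw [hc2] at hg2
  have hD1 : Tendsto (fun s => ((2 * D s - s ^ 2 : ℝ) : ℂ)) (𝓝[>] 0) (𝓝 ((2 * 1 - 0 : ℝ) : ℂ)) :=
    (Complex.continuous_ofReal.tendsto _).comp
      (((hDlim.mono_right nhdsWithin_le_nhds).const_mul 2).sub hs2)
  have hs2c : Tendsto (fun s : ℝ => ((s ^ 2 : ℝ) : ℂ)) (𝓝[>] 0) (𝓝 ((0 : ℝ) : ℂ)) :=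
    (Complex.continuous_ofReal.tendsto _).comp hs2
  have hr4c := (Complex.continuous_ofReal.tendsto _).comp hr4
  have hr2c := (Complex.continuous_ofReal.tendsto _).comp hr2
  have hfin := ((hD1.mul ((hr4c.mul hg4).const_mul ((2 * Real.pi : ℂ) ^ 2))).sub
    ((hs2c.mul (hr2c.mul hg2)).const_mul ((n : ℂ) * (2 * Real.pi))))
  have hval : ((2 * (2 * Real.pi) ^ 2 * (2 ^ (-((n : ℝ) / 2 + 1)) * singConst (n + 4)) *
        profile ((1 - ‖x‖ ^ 2)⁻¹ • ζ) : ℝ) : ℂ) =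
      ((2 * 1 - 0 : ℝ) : ℂ) * ((2 * Real.pi : ℂ) ^ 2 *
        ((((2 * ‖(1 - ‖x‖ ^ 2)⁻¹ • ζ‖ ^ 2 + 1) ^ (-((n : ℝ) / 2 + 1)) : ℝ) : ℂ) *
        ((2 ^ (-((n : ℝ) / 2 + 1)) * singConst (n + 4) : ℝ) : ℂ))) - (n : ℂ) * (2 * Real.pi) *
        (((0 : ℝ) : ℂ) * ((((2 * ‖(1 - ‖x‖ ^ 2)⁻¹ • ζ‖ ^ 2 + 1) ^ (-((n : ℝ) / 2)) : ℝ) : ℂ) *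
        ((2 ^ (-(((n + 2 : ℕ) : ℝ) - 2) / 2) * singConst (n + 2) : ℝ) : ℂ))) := by
    rw [profile]; push_cast; ring
  rw [hval]
  refine hfin.congr' ?_
  filter_upwards [hpos, hDlim.eventually self_mem_nhdsWithin] with s hs hDs
  have hd : 0 < D s - 1 := sub_pos.2 hDs
  have hp4 := hpow ((n : ℝ) / 2 + 1) s hs hd
  have hp2 := hpow ((n : ℝ) / 2) s hs hd
  have e4 : (s ^ 2) ^ ((n : ℝ) / 2 + 1) = s ^ n * s ^ 2 := by
    rw [← pow_add, ← Real.rpow_natCast s 2, ← Real.rpow_mul hs.le, ← Real.rpow_natCast s (n + 2)]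
    congr 1; push_cast; ring
  have e2 : (s ^ 2) ^ ((n : ℝ) / 2) = s ^ n := by
    rw [← Real.rpow_natCast s 2, ← Real.rpow_mul hs.le, ← Real.rpow_natCast s n]
    congr 1; push_cast; ring
  rw [e4] at hp4
  rw [e2] at hp2
  have hp4c := congrArg (fun r : ℝ => (r : ℂ)) hp4
  have hp2c := congrArg (fun r : ℝ => (r : ℂ)) hp2
  simp only [Function.comp_apply, regErr]
  have eD : coshDist x (x + s • ζ) = D s - s ^ 2 := by simp [hD]
  rw [eD, sub_add_cancel]
  push_cast at hp4c hp2c ⊢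
  linear_combination -((2 * D s - (s : ℂ) ^ 2) * (2 * Real.pi : ℂ) ^ 2 * greenC (n + 4) z (D s)) * hp4c
    + ((n : ℂ) * (2 * Real.pi) * (s : ℂ) ^ 2 * greenC (n + 2) z (D s)) * hp2c

/-- The limit of the rescaled regularisation errors has total mass one. The factor `2ⁿ` is that of
the hyperbolic density, whose other factor is the Jacobian of `ζ ↦ (1 - |x|²)⁻¹ ζ`. -/
theorem profile_mass_normalised {n : ℕ} (hn : 2 ≤ n) :
    2 * (2 * Real.pi) ^ 2 * (2 ^ (-((n : ℝ) / 2 + 1)) * singConst (n + 4)) *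
      (2 ^ n * ∫ ζ : E n, profile ζ) = 1 := by
  have hG : 0 < Real.Gamma ((n : ℝ) / 2 + 1) := Real.Gamma_pos_of_pos (by positivity)
  have hpi := Real.pi_pos
  rw [integral_profile hn, singConst]
  have e1 : ((n + 4 : ℕ) : ℝ) / 2 - 1 = (n : ℝ) / 2 + 1 := by push_cast; ring
  have e2 : Real.pi ^ (-((n + 4 : ℕ) : ℝ) / 2) = (Real.pi ^ ((n : ℝ) / 2))⁻¹ / Real.pi ^ 2 := by
    rw [← Real.rpow_neg hpi.le, ← Real.rpow_natCast Real.pi 2, ← Real.rpow_sub hpi]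
    congr 1; push_cast; ring
  have e3 : (2 : ℝ) ^ (-((n : ℝ) / 2 + 1)) = (2 ^ ((n : ℝ) / 2))⁻¹ / 2 := by
    rw [← Real.rpow_neg (by norm_num), ← Real.rpow_sub_one (by norm_num)]
    congr 1; ring
  have e4 : (2 : ℝ) ^ n = 2 ^ ((n : ℝ) / 2) * 2 ^ ((n : ℝ) / 2) := by
    rw [← Real.rpow_add (by norm_num), ← Real.rpow_natCast]; congr 1; ring
  have e5 : (2 : ℝ) ^ (-((n : ℝ) / 2)) = (2 ^ ((n : ℝ) / 2))⁻¹ := Real.rpow_neg (by norm_num) _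
  rw [e1, e2, e3, e4, e5]
  have : (0 : ℝ) < 2 ^ ((n : ℝ) / 2) := by positivity
  have : (0 : ℝ) < Real.pi ^ ((n : ℝ) / 2) := by positivity
  field_simp
  norm_num

/-! ### The approximate identity -/

theorem decay_exp_nonpos {n : ℕ} (hn : 2 ≤ n) {z : ℂ} (hz : 0 ≤ z.re) :
    -((n : ℝ) - 1) / 2 - z.re ≤ 0 := by
  have : (2 : ℝ) ≤ n := by exact_mod_cast hn
  linarith

/-- The bound near the pole: an approximate identity, with a constant that depends on `C`. -/
theorem norm_regErr_le_local {n : ℕ} (hn : 2 ≤ n) {z : ℂ} (hz : 0 ≤ z.re) :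
    ∃ K : ℝ, 0 ≤ K ∧ ∀ (x y : E n) (s : ℝ), x ∈ pBall n → y ∈ pBall n → 0 < s → s ≤ 1 →
      ‖regErr n z (s ^ 2) (coshDist x y)‖ ≤ K * (coshDist x y + 1) ^ ((n : ℝ) / 2 + 1) *
        (s ^ 2 * (2 * ‖y - x‖ ^ 2 + s ^ 2) ^ (-((n : ℝ) / 2 + 1))) := by
  obtain ⟨K, hK, h⟩ := norm_regErr_le hn hz
  refine ⟨K, hK, fun x y s hx hy hs hs1 => ?_⟩
  have hs2 : 0 < s ^ 2 := by positivity
  have hC := one_le_coshDist hx hy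
  have hd := two_mul_sq_add_le hx hy (s ^ 2)
  have hs1' : s ^ 2 ≤ 1 := pow_le_one₀ hs.le hs1
  refine (h (s ^ 2) (coshDist x y) hs2 hC).trans ?_
  set D := coshDist x y + s ^ 2
  have hpos : 0 < 2 * ‖y - x‖ ^ 2 + s ^ 2 := by positivity
  have h1 : D ^ (-((n : ℝ) - 1) / 2 - z.re) ≤ 1 :=
    Real.rpow_le_one_of_one_le_of_nonpos (by linarith) (decay_exp_nonpos hn hz)
  have h2 : (D / (D - 1)) ^ ((n : ℝ) / 2 + 1) ≤ (coshDist x y + 1) ^ ((n : ℝ) / 2 + 1) *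
      (2 * ‖y - x‖ ^ 2 + s ^ 2) ^ (-((n : ℝ) / 2 + 1)) := by
    rw [Real.rpow_neg hpos.le, ← div_eq_mul_inv, ← Real.div_rpow (by linarith) hpos.le]
    refine Real.rpow_le_rpow (div_nonneg (by linarith) (by linarith)) ?_ (by positivity)
    exact div_le_div₀ (by linarith) (by linarith) hpos hd
  calc _ ≤ K * (s ^ 2 * ((coshDist x y + 1) ^ ((n : ℝ) / 2 + 1) *
      (2 * ‖y - x‖ ^ 2 + s ^ 2) ^ (-((n : ℝ) / 2 + 1)))) * 1 := by gcongr
    _ = _ := by ring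

theorem ratio_rpow_le {D p : ℝ} (hD : 1 < D) (hp : 0 ≤ p) :
    (D / (D - 1)) ^ p ≤ 2 ^ p * (1 + (D - 1) ^ (-p)) := by
  have h0 : 0 < D - 1 := by linarith
  have hq : (D - 1) ^ (-p) = ((D - 1)⁻¹) ^ p := by
    rw [Real.inv_rpow h0.le, Real.rpow_neg h0.le]
  rcases le_total (D - 1) 1 with h | h
  · have h1 : D / (D - 1) ≤ 2 * (D - 1)⁻¹ := by
      rw [div_eq_mul_inv]; gcongr; linarith
    calc (D / (D - 1)) ^ p ≤ (2 * (D - 1)⁻¹) ^ p := by gcongr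
      _ = 2 ^ p * (D - 1) ^ (-p) := by rw [Real.mul_rpow (by norm_num) (by positivity), hq]
      _ ≤ _ := by gcongr; linarith
  · have h1 : D / (D - 1) ≤ 2 := by rw [div_le_iff₀ h0]; linarith
    calc (D / (D - 1)) ^ p ≤ 2 ^ p := by gcongr
      _ ≤ _ := le_mul_of_one_le_right (by positivity) (by
        have : 0 ≤ (D - 1) ^ (-p) := by positivity
        linarith)

/-- The bound on the whole ball: besides the approximate identity there is a bounded term, and both
carry the decay of the Green function. -/
theorem norm_regErr_le_global {n : ℕ} (hn : 2 ≤ n) {z : ℂ} (hz : 0 ≤ z.re) :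
    ∃ K : ℝ, 0 ≤ K ∧ ∀ (x y : E n) (s : ℝ), x ∈ pBall n → y ∈ pBall n → 0 < s → s ≤ 1 →
      ‖regErr n z (s ^ 2) (coshDist x y)‖ ≤
        K * (1 + s ^ 2 * (2 * ‖y - x‖ ^ 2 + s ^ 2) ^ (-((n : ℝ) / 2 + 1))) *
          coshDist x y ^ (-((n : ℝ) - 1) / 2 - z.re) := by
  obtain ⟨K, hK, h⟩ := norm_regErr_le hn hz
  refine ⟨K * 2 ^ ((n : ℝ) / 2 + 1), by positivity, fun x y s hx hy hs hs1 => ?_⟩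
  have hs2 : 0 < s ^ 2 := by positivity
  have hC := one_le_coshDist hx hy
  have hd := two_mul_sq_add_le hx hy (s ^ 2)
  have hs1' : s ^ 2 ≤ 1 := pow_le_one₀ hs.le hs1
  refine (h (s ^ 2) (coshDist x y) hs2 hC).trans ?_
  set D := coshDist x y + s ^ 2
  have hpos : 0 < 2 * ‖y - x‖ ^ 2 + s ^ 2 := by positivity
  have h1 : D ^ (-((n : ℝ) - 1) / 2 - z.re) ≤ coshDist x y ^ (-((n : ℝ) - 1) / 2 - z.re) :=
    Real.rpow_le_rpow_of_nonpos (by linarith) (by linarith) (decay_exp_nonpos hn hz)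
  have h3 := ratio_rpow_le (D := D) (p := (n : ℝ) / 2 + 1) (by linarith) (by positivity)
  have h2 : s ^ 2 * (D / (D - 1)) ^ ((n : ℝ) / 2 + 1) ≤ 2 ^ ((n : ℝ) / 2 + 1) *
      (1 + s ^ 2 * (2 * ‖y - x‖ ^ 2 + s ^ 2) ^ (-((n : ℝ) / 2 + 1))) := by
    have h4 : (D - 1) ^ (-((n : ℝ) / 2 + 1)) ≤ (2 * ‖y - x‖ ^ 2 + s ^ 2) ^ (-((n : ℝ) / 2 + 1)) := by
      refine Real.rpow_le_rpow_of_nonpos hpos (by linarith) ?_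
      have : (0 : ℝ) ≤ n := Nat.cast_nonneg n
      linarith
    calc s ^ 2 * (D / (D - 1)) ^ ((n : ℝ) / 2 + 1) ≤ s ^ 2 * (2 ^ ((n : ℝ) / 2 + 1) *
          (1 + (2 * ‖y - x‖ ^ 2 + s ^ 2) ^ (-((n : ℝ) / 2 + 1)))) := by
          gcongr
          exact h3.trans (by gcongr)
      _ = 2 ^ ((n : ℝ) / 2 + 1) * (s ^ 2 + s ^ 2 * (2 * ‖y - x‖ ^ 2 + s ^ 2) ^ (-((n : ℝ) / 2 + 1))) := by
          ring
      _ ≤ _ := by gcongr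
  have h5 : 0 ≤ D ^ (-((n : ℝ) - 1) / 2 - z.re) := Real.rpow_nonneg (by linarith) _
  calc _ ≤ K * (2 ^ ((n : ℝ) / 2 + 1) *
      (1 + s ^ 2 * (2 * ‖y - x‖ ^ 2 + s ^ 2) ^ (-((n : ℝ) / 2 + 1)))) *
        coshDist x y ^ (-((n : ℝ) - 1) / 2 - z.re) := by gcongr
    _ = _ := by ring

/-- Continuous functions whose support is a compact subset of the ball. The image of a test function
under the operator is of this kind without any discussion of its smoothness. -/
structure IsContTest {n : ℕ} (φ : E n → ℂ) : Prop where
  continuous : Continuous φ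
  compact : HasCompactSupport φ
  support_subset : tsupport φ ⊆ pBall n

theorem IsTest.isContTest {n : ℕ} {φ : E n → ℂ} (hφ : IsTest φ) : IsContTest φ :=
  ⟨hφ.smooth.continuous, hφ.compact, hφ.support_subset⟩

theorem IsTest.isContTest_shiftedOp {n : ℕ} {φ : E n → ℂ} (hφ : IsTest φ) (κ : ℂ) :
    IsContTest (shiftedOp κ φ) := by
  have hsub : tsupport (shiftedOp κ φ) ⊆ tsupport φ := by
    refine closure_minimal (fun y hy => ?_) (isClosed_tsupport φ)
    by_contra h
    exact hy (shiftedOp_eq_zero κ h)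
  exact ⟨continuous_iff_continuousAt.2 fun y => continuousAt_shiftedOp κ (isTest_contDiffAt hφ y),
    hφ.compact.of_isClosed_subset (isClosed_tsupport _) hsub, hsub.trans hφ.support_subset⟩

/-- A test function multiplied by the hyperbolic density: the pairing with it over the Euclidean
space is the pairing with the function over the ball (`integral_mul_test`). -/
noncomputable def densTest {n : ℕ} (φ : E n → ℂ) (y : E n) : ℂ := hypDens y • φ y

theorem densTest_eq_zero {n : ℕ} {φ : E n → ℂ} {y : E n} (hy : y ∉ tsupport φ) :
    densTest φ y = 0 := by
  rw [densTest, image_eq_zero_of_notMem_tsupport hy, smul_zero]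

theorem continuousOn_densTest {n : ℕ} {φ : E n → ℂ} (hφ : IsContTest φ) :
    ContinuousOn (densTest φ) (pBall n) :=
  continuousOn_hypDens.smul hφ.continuous.continuousOn

theorem exists_bound_densTest {n : ℕ} {φ : E n → ℂ} (hφ : IsContTest φ) :
    ∃ B : ℝ, 0 ≤ B ∧ ∀ y, ‖densTest φ y‖ ≤ B := by
  obtain ⟨B, hB⟩ := hφ.compact.exists_bound_of_continuousOn
    ((continuousOn_densTest hφ).mono hφ.support_subset)
  refine ⟨max B 0, le_max_right _ _, fun y => ?_⟩
  by_cases hy : y ∈ tsupport φ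
  · exact (hB y hy).trans (le_max_left _ _)
  · rw [densTest_eq_zero hy, norm_zero]; exact le_max_right _ _

theorem integral_mul_test {n : ℕ} {φ : E n → ℂ} (hφ : IsContTest φ) (F : E n → ℂ) :
    ∫ y, F y * φ y ∂(hypVolume n) = ∫ y, F y * densTest φ y := by
  rw [integral_hypVolume]
  have : ∀ y, hypDens y • (F y * φ y) = F y * densTest φ y := fun y => by
    rw [densTest, mul_smul_comm]
  simp_rw [this]
  refine setIntegral_eq_integral_of_forall_compl_eq_zero fun y hy => ?_
  rw [densTest_eq_zero fun h => hy (hφ.support_subset h), mul_zero]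

theorem integrable_mul_test_iff {n : ℕ} {φ : E n → ℂ} (hφ : IsContTest φ) (F : E n → ℂ) :
    Integrable (fun y => F y * φ y) (hypVolume n) ↔ Integrable fun y => F y * densTest φ y := by
  rw [integrable_hypVolume_iff]
  have : (fun y => hypDens y • (F y * φ y)) = fun y => F y * densTest φ y := by
    funext y; rw [densTest, mul_smul_comm]
  rw [this]
  refine integrableOn_iff_integrable_of_support_subset fun y hy => ?_
  by_contra h
  exact hy (by simp only [densTest_eq_zero fun h' => h (hφ.support_subset h'), mul_zero])

theorem exists_bound_coshDist {n : ℕ} {x : E n} (hx : x ∈ pBall n) {K : Set (E n)}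
    (hK : IsCompact K) (hKb : K ⊆ pBall n) : ∃ M : ℝ, 1 ≤ M ∧ ∀ y ∈ K, coshDist x y ≤ M := by
  obtain ⟨M, hM⟩ := hK.exists_bound_of_continuousOn ((continuousOn_coshDist hx).mono hKb)
  exact ⟨max M 1, le_max_right _ _, fun y hy =>
    (le_abs_self _).trans ((hM y hy).trans (le_max_left _ _))⟩

theorem integrable_regErr_mul {n : ℕ} (hn : 2 ≤ n) {z : ℂ} (hz : 0 ≤ z.re) {x : E n}
    (hx : x ∈ pBall n) {φ : E n → ℂ} (hφ : IsContTest φ) {s : ℝ} (hs : 0 < s) :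
    Integrable fun y => regErr n z (s ^ 2) (coshDist x y) * densTest φ y := by
  refine integrableOn_of_support hφ.compact ?_ fun y hy => by rw [densTest_eq_zero hy, mul_zero]
  intro y hy
  have hyb := hφ.support_subset hy
  have hnh := (isOpen_pBall n).mem_nhds hyb
  have h1 : 1 < coshDist x y + s ^ 2 := by
    have := one_le_coshDist hx hyb
    have : 0 < s ^ 2 := by positivity
    linarith
  have h2 : ContinuousAt (fun y => regErr n z (s ^ 2) (coshDist x y)) y :=
    ContinuousAt.comp (f := coshDist x) (continuousAt_regErr hn hz h1)
      ((continuousOn_coshDist hx).continuousAt hnh)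
  exact (h2.mul ((continuousOn_densTest hφ).continuousAt hnh)).continuousWithinAt

/-- The regularised Green function solves the equation up to an approximate identity at `x`. -/
theorem tendsto_integral_regErr {n : ℕ} (hn : 2 ≤ n) {z : ℂ} (hz : 0 ≤ z.re) {x : E n}
    (hx : x ∈ pBall n) {φ : E n → ℂ} (hφ : IsContTest φ) :
    Tendsto (fun s : ℝ => ∫ y, regErr n z (s ^ 2) (coshDist x y) * φ y ∂(hypVolume n)) (𝓝[>] 0)
      (𝓝 (φ x)) := by
  have hA := one_sub_sq_pos hx
  obtain ⟨B, hB0, hB⟩ := exists_bound_densTest hφ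
  obtain ⟨M, hM1, hM⟩ := exists_bound_coshDist hx hφ.compact hφ.support_subset
  obtain ⟨K, hK, hreg⟩ := norm_regErr_le_local (n := n) hn hz
  set c : ℝ := 2 * (2 * Real.pi) ^ 2 * (2 ^ (-((n : ℝ) / 2 + 1)) * singConst (n + 4)) with hc
  -- In the variable `y = x + sζ` the kernels have an integrable majorant independent of `s`.
  have hlim : Tendsto (fun s : ℝ => ∫ ζ : E n, s ^ n •
      (regErr n z (s ^ 2) (coshDist x (x + s • ζ)) * densTest φ (x + s • ζ))) (𝓝[>] 0)
      (𝓝 (∫ ζ : E n, ((c * profile ((1 - ‖x‖ ^ 2)⁻¹ • ζ) : ℝ) : ℂ) * densTest φ x)) := by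
    have hsmall : ∀ᶠ s : ℝ in 𝓝[>] 0, 0 < s ∧ s < 1 := Ioo_mem_nhdsGT (by norm_num)
    refine tendsto_integral_filter_of_dominated_convergence
      (fun ζ => K * (M + 1) ^ ((n : ℝ) / 2 + 1) * B * profile ζ) ?_ ?_
      ((integrable_profile hn).const_mul _) ?_
    · filter_upwards [hsmall] with s hs
      exact ((integrable_comp_affine (integrable_regErr_mul hn hz hx hφ hs.1) x hs.1.ne').smul
        (s ^ n)).aestronglyMeasurable
    · filter_upwards [hsmall] with s hs
      refine Eventually.of_forall fun ζ => ?_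
      have hpr : 0 ≤ profile ζ := Real.rpow_nonneg (by positivity) _
      by_cases hy : x + s • ζ ∈ tsupport φ
      · have h1 := hreg x (x + s • ζ) s hx (hφ.support_subset hy) hs.1 hs.2.le
        rw [add_sub_cancel_left] at h1
        have h2 : (coshDist x (x + s • ζ) + 1) ^ ((n : ℝ) / 2 + 1) ≤
            (M + 1) ^ ((n : ℝ) / 2 + 1) := by
          refine Real.rpow_le_rpow ?_ ?_ (by positivity)
          · linarith [one_le_coshDist hx (hφ.support_subset hy)]
          · linarith [hM _ hy]
        rw [norm_smul, norm_mul, Real.norm_eq_abs, abs_of_pos (pow_pos hs.1 n), ← profile_scale hs.1]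
        have hs0 := hs.1
        calc s ^ n * (‖regErr n z (s ^ 2) (coshDist x (x + s • ζ))‖ * ‖densTest φ (x + s • ζ)‖)
            ≤ s ^ n * ((K * (M + 1) ^ ((n : ℝ) / 2 + 1) *
              (s ^ 2 * (2 * ‖s • ζ‖ ^ 2 + s ^ 2) ^ (-((n : ℝ) / 2 + 1)))) * B) := by
              gcongr
              · exact h1.trans (by gcongr)
              · exact hB _
          _ = _ := by ring
      · rw [densTest_eq_zero hy, mul_zero, smul_zero, norm_zero]
        positivity
    · refine Eventually.of_forall fun ζ => ?_
      have h1 := tendsto_regErr_scaled hn hz hx ζ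
      have hyc : Tendsto (fun s : ℝ => x + s • ζ) (𝓝[>] 0) (𝓝 x) := by
        have : Tendsto (fun s : ℝ => x + s • ζ) (𝓝 0) (𝓝 (x + (0 : ℝ) • ζ)) :=
          (by fun_prop : Continuous fun s : ℝ => x + s • ζ).tendsto 0
        simp only [zero_smul, add_zero] at this
        exact this.mono_left nhdsWithin_le_nhds
      have h2 : Tendsto (fun s : ℝ => densTest φ (x + s • ζ)) (𝓝[>] 0) (𝓝 (densTest φ x)) :=
        (((continuousOn_densTest hφ).continuousAt ((isOpen_pBall n).mem_nhds hx)).tendsto).comp hyc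
      refine (h1.mul h2).congr fun s => ?_
      rw [Complex.real_smul, mul_assoc]
  have hval : ∫ ζ : E n, ((c * profile ((1 - ‖x‖ ^ 2)⁻¹ • ζ) : ℝ) : ℂ) * densTest φ x = φ x := by
    rw [integral_mul_const, integral_complex_ofReal, integral_const_mul,
      Measure.integral_comp_smul, finrank_euclideanSpace, Fintype.card_fin, densTest, hypDens,
      abs_of_pos (by positivity), smul_eq_mul, Complex.real_smul, ← mul_assoc, ← Complex.ofReal_mul]
    have hnorm := profile_mass_normalised hn
    rw [← hc] at hnorm
    have : c * (((1 - ‖x‖ ^ 2)⁻¹ ^ n)⁻¹ * ∫ ζ : E n, profile ζ) * (2 / (1 - ‖x‖ ^ 2)) ^ n = 1 := by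
      refine Eq.trans ?_ hnorm
      rw [div_pow, inv_pow]
      field_simp
    rw [this, Complex.ofReal_one, one_mul]
  rw [hval] at hlim
  refine hlim.congr' ?_
  filter_upwards [self_mem_nhdsWithin] with s hs
  rw [integral_mul_test hφ]
  exact (integral_comp_affine (fun y => regErr n z (s ^ 2) (coshDist x y) * densTest φ y) x hs).symm

/-! ### The Green function is a fundamental solution -/

theorem contDiffOn_greenC_nat (m : ℕ) {n : ℕ} (hn : 2 ≤ n) {z : ℂ} (hz : 0 ≤ z.re) :
    ContDiffOn ℝ m (greenC n z) (Set.Ioi 1) := by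
  induction m generalizing n with
  | zero =>
    rw [Nat.cast_zero, contDiffOn_zero]
    exact fun C hC => (continuousAt_greenC hn hz hC).continuousWithinAt
  | succ m ih =>
    push_cast
    rw [contDiffOn_succ_iff_deriv_of_isOpen isOpen_Ioi]
    refine ⟨fun C hC => (hasDerivAt_greenC hn hz hC).differentiableAt.differentiableWithinAt,
      by simp, ?_⟩
    refine (contDiffOn_const.mul (ih (n := n + 2) (by omega))).congr fun C hC =>
      (hasDerivAt_greenC hn hz hC).deriv

theorem contDiffOn_greenC {n : ℕ} (hn : 2 ≤ n) {z : ℂ} (hz : 0 ≤ z.re) :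
    ContDiffOn ℝ ∞ (greenC n z) (Set.Ioi 1) :=
  contDiffOn_infty.2 fun m => contDiffOn_greenC_nat m hn hz

theorem hasDerivAt_greenC_shift {n : ℕ} (hn : 2 ≤ n) {z : ℂ} (hz : 0 ≤ z.re) {δ C : ℝ}
    (hC : 1 < C + δ) :
    HasDerivAt (fun C => greenC n z (C + δ)) (-(2 * Real.pi) * greenC (n + 2) z (C + δ)) C :=
  HasDerivAt.comp_add_const C δ (hasDerivAt_greenC hn hz hC)

theorem hasDerivAt_greenC_shift_two {n : ℕ} (hn : 2 ≤ n) {z : ℂ} (hz : 0 ≤ z.re) {δ C : ℝ}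
    (hC : 1 < C + δ) :
    HasDerivAt (fun C => -(2 * Real.pi) * greenC (n + 2) z (C + δ))
      ((2 * Real.pi) ^ 2 * greenC (n + 4) z (C + δ)) C := by
  refine ((hasDerivAt_greenC_shift (n := n + 2) (by omega) hz hC).const_mul
    (-(2 * Real.pi : ℂ))).congr_deriv ?_
  ring

theorem contDiffAt_greenC_shift {n : ℕ} (hn : 2 ≤ n) {z : ℂ} (hz : 0 ≤ z.re) {δ C : ℝ}
    (hC : 1 < C + δ) : ContDiffAt ℝ ∞ (fun C => greenC n z (C + δ)) C :=
  ContDiffAt.comp (f := fun C : ℝ => C + δ) C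
    ((contDiffOn_greenC hn hz).contDiffAt (isOpen_Ioi.mem_nhds hC))
    (contDiffAt_id.add contDiffAt_const)

theorem shiftedOp_greenC_shift {n : ℕ} (hn : 2 ≤ n) {z : ℂ} (hz : 0 ≤ z.re) {x y : E n}
    (hx : x ∈ pBall n) (hy : y ∈ pBall n) {δ : ℝ} (hδ : 0 < δ) :
    shiftedOp (z ^ 2) (fun y => greenC n z (coshDist x y + δ)) y =
      regErr n z δ (coshDist x y) := by
  have hC : 1 < coshDist x y + δ := by linarith [one_le_coshDist hx hy]
  have h := hypLaplacian_comp_coshDist hx hy (q := fun C => greenC n z (C + δ))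
    (q₁ := fun C => -(2 * Real.pi) * greenC (n + 2) z (C + δ))
    (q₂ := (2 * Real.pi) ^ 2 * greenC (n + 4) z (coshDist x y + δ))
    (by
      have : ∀ᶠ C : ℝ in 𝓝 (coshDist x y), 1 < C + δ :=
        (continuous_id.add continuous_const).tendsto _ |>.eventually (lt_mem_nhds hC)
      filter_upwards [this] with C h using hasDerivAt_greenC_shift hn hz h)
    (hasDerivAt_greenC_shift_two hn hz hC)
    ((contDiffAt_greenC_shift hn hz hC).of_le two_le_infty)
  rw [shiftedOp, h, ← regErr_eq hn hz hC]

theorem integral_greenC_shift {n : ℕ} (hn : 2 ≤ n) {z : ℂ} (hz : 0 ≤ z.re) {x : E n}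
    (hx : x ∈ pBall n) {φ : E n → ℂ} (hφ : IsTest φ) {δ : ℝ} (hδ : 0 < δ) :
    ∫ y, greenC n z (coshDist x y + δ) * shiftedOp (z ^ 2) φ y ∂(hypVolume n) =
      ∫ y, regErr n z δ (coshDist x y) * φ y ∂(hypVolume n) := by
  have hv : ContDiffOn ℝ 2 (fun y => greenC n z (coshDist x y + δ)) (pBall n) := by
    intro y hy
    have hC : 1 < coshDist x y + δ := by linarith [one_le_coshDist hx hy]
    have h1 := (contDiffAt_greenC_shift hn hz hC).comp y
      ((contDiffOn_coshDist hx).contDiffAt ((isOpen_pBall n).mem_nhds hy))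
    exact (h1.of_le two_le_infty).contDiffWithinAt
  rw [green_identity hn (z ^ 2) hv hφ]
  refine integral_congr_ae ?_
  filter_upwards [ae_mem_pBall n] with y hy
  rw [shiftedOp_greenC_shift hn hz hx hy hδ]

/-- The majorant `1 + |y - x|^{1-n}` of the Green function near its pole. It is set to zero for
`|y - x| ≥ 2`, a distance that two points of the ball never reach, so that it is integrable over the
whole Euclidean space with an integral that does not depend on `x`. -/
noncomputable def singMajorant {n : ℕ} (x y : E n) : ℝ :=
  (Metric.ball (0 : E n) 2).indicator (fun w => 1 + (‖w‖ ^ (n - 1))⁻¹) (y - x)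

theorem singMajorant_nonneg {n : ℕ} (x y : E n) : 0 ≤ singMajorant x y :=
  Set.indicator_nonneg (fun _ _ => by positivity) _

theorem singMajorant_eq {n : ℕ} {x y : E n} (hx : x ∈ pBall n) (hy : y ∈ pBall n) :
    singMajorant x y = 1 + (‖y - x‖ ^ (n - 1))⁻¹ := by
  refine Set.indicator_of_mem ?_ _
  rw [mem_ball_zero_iff]
  linarith [norm_sub_le y x, mem_pBall.1 hx, mem_pBall.1 hy]

theorem integrableOn_inv_norm_pow {n : ℕ} (hn : 2 ≤ n) (r : ℝ) :
    IntegrableOn (fun w : E n => (‖w‖ ^ (n - 1))⁻¹) (Metric.ball 0 r) := by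
  have := nontrivial_E hn
  refine (integrableOn_fun_norm_addHaar (volume : Measure (E n))
    (f := fun t : ℝ => (t ^ (n - 1))⁻¹)).2 ?_
  refine (integrableOn_const (C := (1 : ℝ)) (by simp)).congr_fun (fun t ht => ?_) measurableSet_Ioo
  have h0 : t ^ (n - 1) ≠ 0 := (pow_pos ht.1 _).ne'
  simp [h0]

theorem integrable_singMajorant {n : ℕ} (hn : 2 ≤ n) (x : E n) : Integrable (singMajorant x) := by
  have h : IntegrableOn (fun w : E n => 1 + (‖w‖ ^ (n - 1))⁻¹) (Metric.ball 0 2) :=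
    (integrableOn_const measure_ball_lt_top.ne).add (integrableOn_inv_norm_pow hn 2)
  exact ((integrable_indicator_iff measurableSet_ball).2 h).comp_sub_right x

theorem integral_singMajorant {n : ℕ} (x : E n) :
    ∫ y, singMajorant x y = ∫ y, singMajorant (0 : E n) y := by
  simp only [singMajorant, sub_zero]
  exact integral_sub_right_eq_self _ x

theorem norm_greenC_le_singMajorant {n : ℕ} (hn : 2 ≤ n) {z : ℂ} (hz : 0 ≤ z.re) {x y : E n}
    (hx : x ∈ pBall n) (hy : y ∈ pBall n) (hne : y ≠ x) {D : ℝ} (hD : coshDist x y ≤ D) :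
    ‖greenC n z D‖ ≤ greenBd n z * 2 ^ n * singMajorant x y *
      D ^ (-((n : ℝ) - 1) / 2 - z.re) := by
  have hn' : (2 : ℝ) ≤ n := by exact_mod_cast hn
  have h1 : 1 < D := (one_lt_coshDist hx hy hne).trans_le hD
  have hd := le_coshDist_sub_one hx hy
  have hr : 0 < ‖y - x‖ := norm_pos_iff.2 (sub_ne_zero.2 hne)
  refine (norm_greenC_le_crude hn hz h1).trans ?_
  have hB := greenBd_nonneg n z
  rw [mul_assoc (greenBd n z) (2 ^ n)]
  refine mul_le_mul_of_nonneg_right (mul_le_mul_of_nonneg_left ?_ hB)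
    (Real.rpow_nonneg (by linarith) _)
  rw [singMajorant_eq hx hy]
  refine (ratio_rpow_le h1 (by linarith)).trans ?_
  have e : (‖y - x‖ ^ 2) ^ (-(((n : ℝ) - 1) / 2)) = (‖y - x‖ ^ (n - 1))⁻¹ := by
    rw [Real.rpow_neg (by positivity), ← Real.rpow_natCast _ 2, ← Real.rpow_mul hr.le,
      ← Real.rpow_natCast _ (n - 1), Nat.cast_sub (by omega)]
    congr 2; push_cast; ring
  have h2 : (D - 1) ^ (-(((n : ℝ) - 1) / 2)) ≤ (‖y - x‖ ^ (n - 1))⁻¹ := by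
    rw [← e]
    refine Real.rpow_le_rpow_of_nonpos (by positivity) (by nlinarith) (by linarith)
  gcongr
  rw [← Real.rpow_natCast]
  exact Real.rpow_le_rpow_of_exponent_le (by norm_num) (by linarith)

theorem norm_greenC_le_singMajorant' {n : ℕ} (hn : 2 ≤ n) {z : ℂ} (hz : 0 ≤ z.re) {x y : E n}
    (hx : x ∈ pBall n) (hy : y ∈ pBall n) (hne : y ≠ x) {D : ℝ} (hD : coshDist x y ≤ D) :
    ‖greenC n z D‖ ≤ greenBd n z * 2 ^ n * singMajorant x y := by
  have h1 : 1 < D := (one_lt_coshDist hx hy hne).trans_le hD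
  refine (norm_greenC_le_singMajorant hn hz hx hy hne hD).trans (mul_le_of_le_one_right ?_ ?_)
  · have := greenBd_nonneg n z
    have := singMajorant_nonneg x y
    positivity
  · exact Real.rpow_le_one_of_one_le_of_nonpos h1.le (decay_exp_nonpos hn hz)

theorem ae_ne {n : ℕ} (hn : 2 ≤ n) (x : E n) : ∀ᵐ y : E n, y ≠ x := by
  have := nontrivial_E hn
  exact Measure.ae_ne volume x

theorem aestronglyMeasurable_greenC_shift {n : ℕ} (hn : 2 ≤ n) {z : ℂ} (hz : 0 ≤ z.re) {x : E n}
    (hx : x ∈ pBall n) {δ : ℝ} (hδ : 0 ≤ δ) :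
    AEStronglyMeasurable (fun y => greenC n z (coshDist x y + δ)) (volume.restrict (pBall n)) := by
  have hU : IsOpen (pBall n \ {x}) := (isOpen_pBall n).sdiff isClosed_singleton
  have hc : ContinuousOn (fun y => greenC n z (coshDist x y + δ)) (pBall n \ {x}) := by
    intro y hy
    have h1 : 1 < coshDist x y + δ := by linarith [one_lt_coshDist hx hy.1 hy.2]
    have h2 : ContinuousAt (fun y => coshDist x y + δ) y :=
      ((continuousOn_coshDist hx).continuousAt ((isOpen_pBall n).mem_nhds hy.1)).add
        continuousAt_const
    exact (ContinuousAt.comp (f := fun y => coshDist x y + δ) (continuousAt_greenC hn hz h1)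
      h2).continuousWithinAt
  have := nontrivial_E hn
  have hr : volume.restrict (pBall n) = volume.restrict (pBall n \ {x}) :=
    (Measure.restrict_congr_set (sdiff_null_ae_eq_self (by simp))).symm
  rw [hr]
  exact hc.aestronglyMeasurable hU.measurableSet

theorem aestronglyMeasurable_greenC_mul {n : ℕ} (hn : 2 ≤ n) {z : ℂ} (hz : 0 ≤ z.re) {x : E n}
    (hx : x ∈ pBall n) {f : E n → ℂ} (hf : IsContTest f) {δ : ℝ} (hδ : 0 ≤ δ) :
    AEStronglyMeasurable (fun y => greenC n z (coshDist x y + δ) * densTest f y) volume := by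
  have h1 := (aestronglyMeasurable_greenC_shift hn hz hx hδ).mul
    ((continuousOn_densTest hf).aestronglyMeasurable (μ := volume) measurableSet_ball)
  have h2 := (aestronglyMeasurable_indicator_iff measurableSet_ball).2 h1
  refine h2.congr (Eventually.of_forall fun y => ?_)
  by_cases hy : y ∈ pBall n
  · rw [Set.indicator_of_mem (show y ∈ Metric.ball 0 1 from hy)]; rfl
  · change _ = greenC n z (coshDist x y + δ) * densTest f y
    rw [Set.indicator_of_notMem (show y ∉ Metric.ball 0 1 from hy),
      densTest_eq_zero fun h => hy (hf.support_subset h), mul_zero]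

theorem norm_greenC_mul_densTest_le {n : ℕ} (hn : 2 ≤ n) {z : ℂ} (hz : 0 ≤ z.re) {x y : E n}
    (hx : x ∈ pBall n) {f : E n → ℂ} (hf : IsContTest f) {B : ℝ} (hB : ∀ y, ‖densTest f y‖ ≤ B)
    (hne : y ≠ x) {δ : ℝ} (hδ : 0 ≤ δ) :
    ‖greenC n z (coshDist x y + δ) * densTest f y‖ ≤
      greenBd n z * 2 ^ n * singMajorant x y * B := by
  have h0 := greenBd_nonneg n z
  have h1 := singMajorant_nonneg x y
  have h2 : 0 ≤ B := (norm_nonneg _).trans (hB y)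
  by_cases hy : y ∈ tsupport f
  · rw [norm_mul]
    gcongr
    · exact norm_greenC_le_singMajorant' hn hz hx (hf.support_subset hy) hne (by linarith)
    · exact hB y
  · rw [densTest_eq_zero hy, mul_zero, norm_zero]
    positivity

theorem integrable_greenC_mul {n : ℕ} (hn : 2 ≤ n) {z : ℂ} (hz : 0 ≤ z.re) {x : E n}
    (hx : x ∈ pBall n) {f : E n → ℂ} (hf : IsContTest f) {δ : ℝ} (hδ : 0 ≤ δ) :
    Integrable fun y => greenC n z (coshDist x y + δ) * densTest f y := by
  obtain ⟨B, hB0, hB⟩ := exists_bound_densTest hf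
  refine Integrable.mono' (((integrable_singMajorant hn x).const_mul (greenBd n z * 2 ^ n)).mul_const B)
    (aestronglyMeasurable_greenC_mul hn hz hx hf hδ) ?_
  filter_upwards [ae_ne hn x] with y hy using norm_greenC_mul_densTest_le hn hz hx hf hB hy hδ

/-- The Green function is a fundamental solution: Green's identity for the regularised function, in
the limit. -/
theorem integral_greenC_mul_shiftedOp {n : ℕ} (hn : 2 ≤ n) {z : ℂ} (hz : 0 ≤ z.re) {x : E n}
    (hx : x ∈ pBall n) {φ : E n → ℂ} (hφ : IsTest φ) :
    ∫ y, greenC n z (coshDist x y) * shiftedOp (z ^ 2) φ y ∂(hypVolume n) = φ x := by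
  have hL := hφ.isContTest_shiftedOp (z ^ 2)
  obtain ⟨B, hB0, hB⟩ := exists_bound_densTest hL
  have h1 := tendsto_integral_regErr hn hz hx hφ.isContTest
  have h2 : Tendsto (fun s : ℝ =>
      ∫ y, greenC n z (coshDist x y + s ^ 2) * densTest (shiftedOp (z ^ 2) φ) y) (𝓝[>] 0)
      (𝓝 (∫ y, greenC n z (coshDist x y) * densTest (shiftedOp (z ^ 2) φ) y)) := by
    refine tendsto_integral_filter_of_dominated_convergence
      (fun y => greenBd n z * 2 ^ n * singMajorant x y * B) ?_ ?_
      (((integrable_singMajorant hn x).const_mul _).mul_const B) ?_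
    · exact Eventually.of_forall fun s =>
        aestronglyMeasurable_greenC_mul hn hz hx hL (sq_nonneg s)
    · refine Eventually.of_forall fun s => ?_
      filter_upwards [ae_ne hn x] with y hy using
        norm_greenC_mul_densTest_le hn hz hx hL hB hy (sq_nonneg s)
    · filter_upwards [ae_ne hn x] with y hy
      by_cases hyb : y ∈ pBall n
      · refine Tendsto.mul_const _ ?_
        have hc := (continuousAt_greenC hn hz (one_lt_coshDist hx hyb hy)).tendsto
        have hs : Tendsto (fun s : ℝ => coshDist x y + s ^ 2) (𝓝[>] 0) (𝓝 (coshDist x y)) := by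
          have : Tendsto (fun s : ℝ => coshDist x y + s ^ 2) (𝓝 0) (𝓝 (coshDist x y + 0 ^ 2)) :=
            (by fun_prop : Continuous fun s : ℝ => coshDist x y + s ^ 2).tendsto 0
          rw [zero_pow two_ne_zero, add_zero] at this
          exact this.mono_left nhdsWithin_le_nhds
        exact hc.comp hs
      · simp only [densTest_eq_zero fun h => hyb (hL.support_subset h), mul_zero]
        exact tendsto_const_nhds
  rw [integral_mul_test hL]
  refine tendsto_nhds_unique h2 (h1.congr' ?_)
  filter_upwards [self_mem_nhdsWithin] with s hs
  have hs2 : 0 < s ^ 2 := pow_pos hs 2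
  rw [← integral_greenC_shift hn hz hx hφ hs2, integral_mul_test hL]

theorem ae_hypVolume_ne {n : ℕ} (hn : 2 ≤ n) (x : E n) : ∀ᵐ y ∂(hypVolume n), y ≠ x :=
  (hypVolume_absolutelyContinuous n).ae_le (ae_restrict_of_ae (ae_ne hn x))

theorem green_hypDist_ae {n : ℕ} (hn : 2 ≤ n) (z : ℂ) {x : E n} (hx : x ∈ pBall n) :
    (fun y => green n z (hypDist x y)) =ᵐ[hypVolume n] fun y => greenC n z (coshDist x y) := by
  filter_upwards [ae_mem_pBall n, ae_hypVolume_ne hn x] with y h1 h2 using green_hypDist z hx h1 h2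

theorem integral_green_mul {n : ℕ} (hn : 2 ≤ n) (z : ℂ) {x : E n} (hx : x ∈ pBall n)
    (f : E n → ℂ) : ∫ y, green n z (hypDist x y) * f y ∂(hypVolume n) =
      ∫ y, greenC n z (coshDist x y) * f y ∂(hypVolume n) := by
  refine integral_congr_ae ?_
  filter_upwards [green_hypDist_ae hn z hx] with y hy
  rw [hy]

theorem locallyIntegrableOn_green {n : ℕ} (hn : 2 ≤ n) {z : ℂ} (hz : 0 ≤ z.re) {x : E n}
    (hx : x ∈ pBall n) :
    LocallyIntegrableOn (fun y => green n z (hypDist x y)) (pBall n) (hypVolume n) := by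
  rw [locallyIntegrableOn_iff (isOpen_pBall n).isLocallyClosed]
  intro K hKb hK
  rw [← integrable_indicator_iff hK.measurableSet]
  have h1 : Integrable (K.indicator fun y => greenC n z (coshDist x y)) (hypVolume n) := by
    rw [integrable_hypVolume_iff]
    obtain ⟨M, hM⟩ := hK.exists_bound_of_continuousOn (continuousOn_hypDens.mono hKb)
    have hM0 : 0 ≤ max M 0 := le_max_right _ _
    refine Integrable.mono' (g := fun y => max M 0 * (greenBd n z * 2 ^ n * singMajorant x y))
      (((integrable_singMajorant hn x).const_mul _).const_mul _).integrableOn ?_ ?_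
    · have := aestronglyMeasurable_greenC_shift hn hz hx (le_refl (0 : ℝ))
      simp only [add_zero] at this
      exact (continuousOn_hypDens.aestronglyMeasurable measurableSet_ball).smul
        (this.indicator hK.measurableSet)
    · filter_upwards [ae_restrict_of_ae (ae_ne hn x)] with y hy
      have h0 := greenBd_nonneg n z
      have h1 := singMajorant_nonneg x y
      by_cases hyK : y ∈ K
      · rw [Set.indicator_of_mem hyK, norm_smul]
        gcongr
        · exact (hM y hyK).trans (le_max_left _ _)
        · exact norm_greenC_le_singMajorant' hn hz hx (hKb hyK) hy le_rfl
      · rw [Set.indicator_of_notMem hyK, smul_zero, norm_zero]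
        positivity
  refine h1.congr ?_
  filter_upwards [green_hypDist_ae hn z hx] with y hy
  by_cases hyK : y ∈ K
  · rw [Set.indicator_of_mem hyK, Set.indicator_of_mem hyK, hy]
  · rw [Set.indicator_of_notMem hyK, Set.indicator_of_notMem hyK]

theorem isFundamentalSolution_green {n : ℕ} (hn : 2 ≤ n) {z : ℂ} (hz : 0 ≤ z.re) {x : E n}
    (hx : x ∈ pBall n) :
    IsFundamentalSolution (z ^ 2) x (fun y => green n z (hypDist x y)) :=
  ⟨locallyIntegrableOn_green hn hz hx, fun _ hφ =>
    (integral_green_mul hn z hx _).trans (integral_greenC_mul_shiftedOp hn hz hx hφ)⟩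

/-! ### Behaviour at infinity -/

theorem coshDist_eq {n : ℕ} {x y : E n} (hx : x ∈ pBall n) (hy : y ∈ pBall n) :
    coshDist x y = ((1 + ‖x‖ ^ 2) * (1 + ‖y‖ ^ 2) - 4 * inner ℝ x y) /
      ((1 - ‖x‖ ^ 2) * (1 - ‖y‖ ^ 2)) := by
  have h1 := (one_sub_sq_pos hx).ne'
  have h2 := (one_sub_sq_pos hy).ne'
  rw [coshDist, norm_sub_sq_real, real_inner_comm]
  field_simp
  ring

/-- The distance from a point at Euclidean distance at most `r < 1` from the centre is bounded below
by the distance from the centre, up to a constant. -/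
theorem mul_cosh_rho_le_coshDist {n : ℕ} {x y : E n} {r : ℝ} (hr : r < 1) (hxr : ‖x‖ ≤ r)
    (hy : y ∈ pBall n) : (1 - r) ^ 2 * Real.cosh (rho y) ≤ coshDist x y := by
  have hx : x ∈ pBall n := mem_pBall.2 (hxr.trans_lt hr)
  have h1 := one_sub_sq_pos hx
  have h2 := one_sub_sq_pos hy
  have hi : inner ℝ x y ≤ ‖x‖ * ‖y‖ := real_inner_le_norm x y
  have hx0 := norm_nonneg x
  have hy0 := norm_nonneg y
  have h3 : (1 - r) ^ 2 ≤ (1 - ‖x‖) ^ 2 := by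
    apply pow_le_pow_left₀ <;> linarith
  refine (mul_le_mul_of_nonneg_right h3 (Real.cosh_pos _).le).trans ?_
  rw [coshDist_eq hx hy, cosh_rho hy, mul_div_assoc', div_le_div_iff₀ h2 (by positivity)]
  have h4 : (1 - ‖x‖) ^ 2 * (1 + ‖y‖ ^ 2) ≤
      (1 + ‖x‖ ^ 2) * (1 + ‖y‖ ^ 2) - 4 * inner ℝ x y := by
    nlinarith [mul_nonneg hx0 (sq_nonneg (1 - ‖y‖))]
  have h5 : 0 ≤ (1 - ‖x‖) ^ 2 * (1 + ‖y‖ ^ 2) := by positivity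
  have h6 := one_sub_sq_le_one x
  calc (1 - ‖x‖) ^ 2 * (1 + ‖y‖ ^ 2) * ((1 - ‖x‖ ^ 2) * (1 - ‖y‖ ^ 2))
      ≤ ((1 - ‖x‖) ^ 2 * (1 + ‖y‖ ^ 2)) * (1 * (1 - ‖y‖ ^ 2)) := by gcongr
    _ ≤ _ := by rw [one_mul]; gcongr

theorem eventually_mem_pBall (n : ℕ) : ∀ᶠ y in atInfinity n, y ∈ pBall n :=
  mem_inf_of_right (mem_principal_self _)

theorem tendsto_rho (n : ℕ) : Tendsto (rho : E n → ℝ) (atInfinity n) atTop :=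
  tendsto_comap.mono_left inf_le_left

theorem tendsto_cosh_atTop : Tendsto Real.cosh atTop atTop := by
  refine tendsto_atTop_mono (fun t => ?_) (Real.tendsto_exp_atTop.atTop_div_const (zero_lt_two))
  rw [Real.cosh_eq]
  linarith [Real.exp_pos (-t)]

theorem tendsto_coshDist {n : ℕ} {x : E n} (hx : x ∈ pBall n) :
    Tendsto (coshDist x) (atInfinity n) atTop := by
  have hx1 := mem_pBall.1 hx
  have h0 : 0 < (1 - ‖x‖) ^ 2 := by
    have : 0 < 1 - ‖x‖ := by linarith
    positivity
  refine tendsto_atTop_mono' _ ?_ ((tendsto_cosh_atTop.comp (tendsto_rho n)).const_mul_atTop h0)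
  filter_upwards [eventually_mem_pBall n] with y hy
  exact mul_cosh_rho_le_coshDist hx1 le_rfl hy

theorem eventually_atInfinity {n : ℕ} {x : E n} (hx : x ∈ pBall n) :
    ∀ᶠ y in atInfinity n, y ∈ pBall n ∧ y ≠ x ∧ 2 ≤ coshDist x y ∧ 0 < rho y ∧ 0 < ‖y‖ := by
  filter_upwards [eventually_mem_pBall n, (tendsto_coshDist hx).eventually_ge_atTop 2,
    (tendsto_rho n).eventually_gt_atTop 0] with y h1 h2 h3
  refine ⟨h1, ?_, h2, h3, ?_⟩
  · rintro rfl
    simp [coshDist] at h2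
  · rw [norm_pos_iff]
    rintro rfl
    simp [rho] at h3

theorem coshDist_rpow_le_sinh {n : ℕ} {x y : E n} (hx : x ∈ pBall n) (hy : y ∈ pBall n)
    (hρ : 0 < rho y) {k : ℝ} (hk : k ≤ 0) :
    coshDist x y ^ k ≤ ((1 - ‖x‖) ^ 2) ^ k * Real.sinh (rho y) ^ k := by
  have hx1 := mem_pBall.1 hx
  have h0 : 0 < (1 - ‖x‖) ^ 2 := by
    have : 0 < 1 - ‖x‖ := by linarith
    positivity
  have hs := Real.sinh_pos_iff.2 hρ
  have h1 := mul_cosh_rho_le_coshDist hx1 le_rfl hy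
  rw [← Real.mul_rpow h0.le hs.le]
  refine Real.rpow_le_rpow_of_nonpos (by positivity) ?_ hk
  exact (mul_le_mul_of_nonneg_left (Real.sinh_lt_cosh _).le h0.le).trans h1

theorem norm_greenC_le_of_two_le {n : ℕ} (hn : 2 ≤ n) {z : ℂ} (hz : 0 ≤ z.re) {C : ℝ} (hC : 2 ≤ C) :
    ‖greenC n z C‖ ≤ greenBd n z * 2 ^ (((n : ℝ) - 1) / 2) * C ^ (-((n : ℝ) - 1) / 2 - z.re) := by
  have hn' : (2 : ℝ) ≤ n := by exact_mod_cast hn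
  refine (norm_greenC_le_crude hn hz (by linarith)).trans ?_
  have := greenBd_nonneg n z
  have h1 : C / (C - 1) ≤ 2 := by rw [div_le_iff₀] <;> linarith
  have h2 : 0 ≤ C / (C - 1) := div_nonneg (by linarith) (by linarith)
  gcongr ?_ * ?_ * ?_
  exact Real.rpow_le_rpow h2 h1 (by linarith)

theorem isBigO_green {n : ℕ} (hn : 2 ≤ n) {z : ℂ} (hz : 0 ≤ z.re) {x : E n} (hx : x ∈ pBall n) :
    (fun y => green n z (hypDist x y)) =O[atInfinity n]
      fun y => Real.sinh (rho y) ^ (-((n : ℝ) - 1) / 2) := by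
  have hn' : (2 : ℝ) ≤ n := by exact_mod_cast hn
  refine IsBigO.of_bound (greenBd n z * 2 ^ (((n : ℝ) - 1) / 2) *
    ((1 - ‖x‖) ^ 2) ^ (-((n : ℝ) - 1) / 2)) ?_
  filter_upwards [eventually_atInfinity hx] with y ⟨hy, hne, h2, hρ, hy0⟩
  rw [green_hypDist z hx hy hne, Real.norm_of_nonneg
    (Real.rpow_nonneg (Real.sinh_pos_iff.2 hρ).le _), mul_assoc]
  refine (norm_greenC_le_of_two_le hn hz h2).trans ?_
  have := greenBd_nonneg n z
  gcongr
  refine le_trans ?_ (coshDist_rpow_le_sinh hx hy hρ (by linarith))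
  exact Real.rpow_le_rpow_of_exponent_le (by linarith) (by linarith)

/-! ### The radiation conditions -/

theorem tanh_half_rho {n : ℕ} {y : E n} (hy : y ∈ pBall n) : Real.tanh (rho y / 2) = ‖y‖ := by
  have h := mem_pBall.1 hy
  have h0 := norm_nonneg y
  have e : rho y / 2 = Real.artanh ‖y‖ := by
    rw [Real.artanh_eq_half_log ⟨by linarith, h.le⟩, rho]; ring
  rw [e, Real.tanh_artanh ⟨by linarith, h⟩]

/-- The derivative of `C = cosh ρ(x, ·)` along the geodesic rays from the origin is `C` up to a
bounded error. -/
theorem radial_coshDist {n : ℕ} {x y : E n} (hx : x ∈ pBall n) (hy : y ∈ pBall n) (hy0 : 0 < ‖y‖) :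
    |(1 - ‖y‖ ^ 2) / 2 * coshDistDir x y (‖y‖⁻¹ • y) - coshDist x y| ≤ 4 / (1 - ‖x‖ ^ 2) := by
  have h1 := one_sub_sq_pos hx
  have h2 := one_sub_sq_pos hy
  have hx1 := mem_pBall.1 hx
  have hy1 := mem_pBall.1 hy
  obtain ⟨q, hq⟩ : ∃ q, inner ℝ x y = ‖y‖ * q := ⟨inner ℝ x y / ‖y‖, by field_simp⟩
  have hqb : |q| ≤ 1 := by
    have := abs_real_inner_le_norm x y
    rw [hq, abs_mul, abs_of_pos hy0, mul_comm] at this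
    exact (le_of_mul_le_mul_right this hy0).trans hx1.le
  have e : (1 - ‖y‖ ^ 2) / 2 * coshDistDir x y (‖y‖⁻¹ • y) - coshDist x y =
      -((1 + ‖x‖ ^ 2 + 2 * q) * (1 - ‖y‖) / (1 + ‖y‖)) / (1 - ‖x‖ ^ 2) := by
    rw [coshDist_eq hx hy, coshDistDir, inner_smul_right, inner_smul_right, inner_sub_left,
      real_inner_self_eq_norm_sq, norm_sub_sq_real, real_inner_comm x y, hq]
    have h3 : 1 - ‖y‖ ^ 2 = (1 - ‖y‖) * (1 + ‖y‖) := by ring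
    have h4 : (1 : ℝ) - ‖y‖ ≠ 0 := by linarith
    have h5 : (1 : ℝ) + ‖y‖ ≠ 0 := by linarith
    rw [h3]
    field_simp
    ring
  rw [e, abs_div, abs_of_pos h1, abs_neg]
  gcongr
  rw [abs_div, abs_mul, abs_of_pos (by linarith : (0 : ℝ) < 1 + ‖y‖),
    abs_of_pos (by linarith : (0 : ℝ) < 1 - ‖y‖), div_le_iff₀ (by linarith)]
  have h6 : |1 + ‖x‖ ^ 2 + 2 * q| ≤ 4 := by
    rw [abs_le] at hqb ⊢
    constructor <;> nlinarith [norm_nonneg x]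
  nlinarith [abs_nonneg (1 + ‖x‖ ^ 2 + 2 * q)]

/-- The factor `tanh(ρ/2) = |y|` is one up to an error of order `1 / C`. -/
theorem one_sub_norm_le {n : ℕ} {x y : E n} (hx : x ∈ pBall n) (hy : y ∈ pBall n)
    (hC : 0 < coshDist x y) : |‖y‖ - 1| ≤ 8 / (1 - ‖x‖ ^ 2) * (coshDist x y)⁻¹ := by
  have h1 := one_sub_sq_pos hx
  have h2 := one_sub_sq_pos hy
  have hx1 := mem_pBall.1 hx
  have hy1 := mem_pBall.1 hy
  have hx0 := norm_nonneg x
  have hy0 := norm_nonneg y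
  rw [← div_eq_mul_inv, div_div, abs_sub_comm, abs_of_pos (by linarith),
    le_div_iff₀ (by positivity)]
  have h3 : (1 - ‖x‖ ^ 2) * (1 - ‖y‖ ^ 2) * coshDist x y =
      (1 + ‖x‖ ^ 2) * (1 + ‖y‖ ^ 2) - 4 * inner ℝ x y := by
    rw [coshDist_eq hx hy]; field_simp
  have h4 := (abs_le.1 (abs_real_inner_le_norm x y)).1
  have h5 : ‖x‖ * ‖y‖ ≤ 1 := by nlinarith
  have h6 : (1 - ‖x‖ ^ 2) * (1 - ‖y‖ ^ 2) * coshDist x y ≤ 8 := by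
    rw [h3]; nlinarith
  refine le_trans ?_ h6
  calc (1 - ‖y‖) * ((1 - ‖x‖ ^ 2) * coshDist x y)
      ≤ (1 - ‖y‖ ^ 2) * ((1 - ‖x‖ ^ 2) * coshDist x y) := by
        gcongr
        nlinarith
    _ = _ := by ring

theorem differentiableAt_green_and_fderiv {n : ℕ} (hn : 2 ≤ n) {z : ℂ} (hz : 0 ≤ z.re) {x y : E n}
    (hx : x ∈ pBall n) (hy : y ∈ pBall n) (hne : y ≠ x) :
    DifferentiableAt ℝ (fun y => green n z (hypDist x y)) y ∧
    ∀ v, fderiv ℝ (fun y => green n z (hypDist x y)) y v =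
      coshDistDir x y v • (-(2 * Real.pi) * greenC (n + 2) z (coshDist x y)) := by
  have hev : (fun y => green n z (hypDist x y)) =ᶠ[𝓝 y] fun y => greenC n z (coshDist x y) := by
    filter_upwards [(isOpen_pBall n).mem_nhds hy, isOpen_compl_singleton.mem_nhds hne] with w h1 h2
    exact green_hypDist z hx h1 h2
  have hC : DifferentiableAt ℝ (coshDist x) y :=
    ((contDiffOn_coshDist hx).contDiffAt ((isOpen_pBall n).mem_nhds hy)).differentiableAt (by simp)
  have h := (hasDerivAt_greenC hn hz (one_lt_coshDist hx hy hne)).hasFDerivAt.comp y hC.hasFDerivAt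
  refine ⟨(h.differentiableAt).congr_of_eventuallyEq hev, fun v => ?_⟩
  rw [hev.fderiv_eq]
  refine (congrArg (fun L => L v) h.fderiv).trans ?_
  rw [ContinuousLinearMap.comp_apply, ContinuousLinearMap.toSpanSingleton_apply,
    fderiv_coshDist hx hy]

/-- Both radiation conditions at once: the coefficient is `(n-1)/2 + z`, with `z = ∓μ i` the
outgoing and the ingoing case. -/
theorem isBigO_radiation {n : ℕ} (hn : 2 ≤ n) {z : ℂ} (hz : 0 ≤ z.re) {x : E n}
    (hx : x ∈ pBall n) :
    (fun y => radialDeriv (fun y => green n z (hypDist x y)) y +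
        (((n : ℂ) - 1) / 2 + z) * ((Real.tanh (rho y / 2) : ℝ) : ℂ) * green n z (hypDist x y))
      =O[atInfinity n] fun y => Real.sinh (rho y) ^ (-((n : ℝ) + 1) / 2) := by
  have hn' : (2 : ℝ) ≤ n := by exact_mod_cast hn
  have hx1 := mem_pBall.1 hx
  have hA := one_sub_sq_pos hx
  obtain ⟨K, hK⟩ := norm_radiation_greenC_le hn hz
  set c : ℝ := ((1 - ‖x‖) ^ 2) ^ (-((n : ℝ) + 1) / 2) with hc
  have hB2 := greenBd_nonneg (n + 2) z
  have hB := greenBd_nonneg n z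
  set K1 : ℝ := 4 / (1 - ‖x‖ ^ 2) * (2 * Real.pi * (greenBd (n + 2) z *
    2 ^ ((((n + 2 : ℕ) : ℝ) - 1) / 2))) with hK1
  set K2 : ℝ := ‖((n : ℂ) - 1) / 2 + z‖ * (8 / (1 - ‖x‖ ^ 2)) *
    (greenBd n z * 2 ^ (((n : ℝ) - 1) / 2)) with hK2
  have hK1' : 0 ≤ K1 := by have := Real.pi_pos; positivity
  have hK2' : 0 ≤ K2 := by positivity
  have hKK : 0 ≤ K := by
    have := (norm_nonneg _).trans (hK 2 le_rfl)
    exact nonneg_of_mul_nonneg_left this (by positivity)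
  refine IsBigO.of_bound ((K1 + K + K2) * c) ?_
  filter_upwards [eventually_atInfinity hx] with y ⟨hy, hne, h2, hρ, hy0⟩
  set C := coshDist x y with hCdef
  have hC0 : 0 < C := by linarith
  have hpow : C ^ (-((n : ℝ) + 1) / 2) ≤ c * Real.sinh (rho y) ^ (-((n : ℝ) + 1) / 2) :=
    coshDist_rpow_le_sinh hx hy hρ (by linarith)
  rw [Real.norm_of_nonneg (Real.rpow_nonneg (Real.sinh_pos_iff.2 hρ).le _)]
  refine le_trans ?_ ((mul_le_mul_of_nonneg_left hpow
    (by positivity : 0 ≤ K1 + K + K2)).trans_eq (mul_assoc _ _ _).symm)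
  set R := (1 - ‖y‖ ^ 2) / 2 * coshDistDir x y (‖y‖⁻¹ • y) with hR
  have hrad : radialDeriv (fun y => green n z (hypDist x y)) y =
      R * (-(2 * Real.pi) * greenC (n + 2) z C) := by
    rw [radialDeriv, (differentiableAt_green_and_fderiv hn hz hx hy hne).2, hR]
    simp only [Complex.real_smul]
    push_cast
    ring
  have hRC : |R - C| ≤ 4 / (1 - ‖x‖ ^ 2) := radial_coshDist hx hy hy0
  rw [hrad, tanh_half_rho hy, green_hypDist z hx hy hne, ← hCdef]
  -- Replace `∂C/∂ρ` by `C` and `tanh(ρ/2)` by one; the middle term is the cancellation.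
  have hsplit : R * (-(2 * Real.pi) * greenC (n + 2) z C) +
      (((n : ℂ) - 1) / 2 + z) * (‖y‖ : ℂ) * greenC n z C =
      ((R - C : ℝ) : ℂ) * (-(2 * Real.pi) * greenC (n + 2) z C) +
      (C * (-(2 * Real.pi) * greenC (n + 2) z C) + (((n : ℂ) - 1) / 2 + z) * greenC n z C) +
      (((n : ℂ) - 1) / 2 + z) * ((‖y‖ - 1 : ℝ) : ℂ) * greenC n z C := by
    push_cast; ring
  rw [hsplit]
  have t1 : ‖((R - C : ℝ) : ℂ) * (-(2 * Real.pi) * greenC (n + 2) z C)‖ ≤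
      K1 * C ^ (-((n : ℝ) + 1) / 2) := by
    have h3 := norm_greenC_le_of_two_le (n := n + 2) (by omega) hz h2
    have h4 : C ^ (-(((n + 2 : ℕ) : ℝ) - 1) / 2 - z.re) ≤ C ^ (-((n : ℝ) + 1) / 2) := by
      refine Real.rpow_le_rpow_of_exponent_le (by linarith) ?_
      push_cast; linarith
    have h5 : ‖(-(2 * Real.pi : ℂ))‖ = 2 * Real.pi := by
      rw [norm_neg, ← Complex.ofReal_ofNat, ← Complex.ofReal_mul, Complex.norm_real,
        Real.norm_of_nonneg Real.two_pi_pos.le]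
    rw [norm_mul, norm_mul, h5, Complex.norm_real, Real.norm_eq_abs, hK1]
    calc _ ≤ 4 / (1 - ‖x‖ ^ 2) * (2 * Real.pi * (greenBd (n + 2) z *
        2 ^ ((((n + 2 : ℕ) : ℝ) - 1) / 2) * C ^ (-((n : ℝ) + 1) / 2))) := by
          have := Real.pi_pos
          gcongr
          exact h3.trans (by gcongr)
      _ = _ := by ring
  have t3 : ‖(((n : ℂ) - 1) / 2 + z) * ((‖y‖ - 1 : ℝ) : ℂ) * greenC n z C‖ ≤
      K2 * C ^ (-((n : ℝ) + 1) / 2) := by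
    have h3 := norm_greenC_le_of_two_le hn hz h2
    have h4 : C ^ (-((n : ℝ) - 1) / 2 - z.re) ≤ C ^ (-((n : ℝ) - 1) / 2) :=
      Real.rpow_le_rpow_of_exponent_le (by linarith) (by linarith)
    have h6 : |‖y‖ - 1| ≤ 8 / (1 - ‖x‖ ^ 2) * C⁻¹ := one_sub_norm_le hx hy hC0
    have h7 : C ^ (-((n : ℝ) + 1) / 2) = C⁻¹ * C ^ (-((n : ℝ) - 1) / 2) := by
      rw [← Real.rpow_neg_one, ← Real.rpow_add hC0]; congr 1; ring
    rw [norm_mul, norm_mul, Complex.norm_real, Real.norm_eq_abs, hK2, h7]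
    calc _ ≤ ‖((n : ℂ) - 1) / 2 + z‖ * (8 / (1 - ‖x‖ ^ 2) * C⁻¹) *
        (greenBd n z * 2 ^ (((n : ℝ) - 1) / 2) * C ^ (-((n : ℝ) - 1) / 2)) := by
          gcongr
          exact h3.trans (by gcongr)
      _ = _ := by ring
  calc _ ≤ K1 * C ^ (-((n : ℝ) + 1) / 2) + K * C ^ (-((n : ℝ) + 1) / 2) +
        K2 * C ^ (-((n : ℝ) + 1) / 2) :=
        (norm_add_le _ _).trans (add_le_add ((norm_add_le _ _).trans (add_le_add t1 (hK C h2))) t3)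
    _ = _ := by ring

theorem isOutgoing_green {n : ℕ} (hn : 2 ≤ n) (μ : ℝ) {x : E n} (hx : x ∈ pBall n) :
    IsOutgoing μ (fun y => green n (-((μ : ℂ) * Complex.I)) (hypDist x y)) := by
  have hz : 0 ≤ (-((μ : ℂ) * Complex.I)).re := by simp
  constructor
  · filter_upwards [eventually_atInfinity hx] with y h
    exact (differentiableAt_green_and_fderiv hn hz hx h.1 h.2.1).1
  · refine (isBigO_radiation hn hz hx).congr_left fun y => ?_
    ring

theorem isIngoing_green {n : ℕ} (hn : 2 ≤ n) (μ : ℝ) {x : E n} (hx : x ∈ pBall n) :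
    IsIngoing μ (fun y => green n ((μ : ℂ) * Complex.I) (hypDist x y)) := by
  have hz : 0 ≤ ((μ : ℂ) * Complex.I).re := by simp
  constructor
  · filter_upwards [eventually_atInfinity hx] with y h
    exact (differentiableAt_green_and_fderiv hn hz hx h.1 h.2.1).1
  · refine (isBigO_radiation hn hz hx).congr_left fun y => ?_
    ring

/-! ### Continuity in the spectral parameter -/

/-- The Gamma factors are evaluated at points of positive real part, away from the poles. -/
theorem continuousAt_greenConst {n : ℕ} (hn : 2 ≤ n) {z : ℂ} (hz : 0 ≤ z.re) :
    ContinuousAt (greenConst n) z := by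
  have hn' : (2 : ℝ) ≤ n := by exact_mod_cast hn
  have hG : ∀ s : ℂ, 0 < s.re → ContinuousAt Complex.Gamma s := fun s hs =>
    (Complex.differentiableAt_Gamma s fun m h => by
      rw [h] at hs
      simp only [Complex.neg_re, Complex.natCast_re] at hs
      linarith [(Nat.cast_nonneg m : (0 : ℝ) ≤ m)]).continuousAt
  have h1 : 0 < (((n : ℂ) - 1) / 2 + z).re := by
    simp; linarith
  have h2 : 0 < (z + 1 / 2).re := by
    simp; linarith
  have c1 : ContinuousAt (fun z : ℂ => Complex.Gamma (((n : ℂ) - 1) / 2 + z)) z :=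
    ContinuousAt.comp (f := fun z : ℂ => ((n : ℂ) - 1) / 2 + z) (hG _ h1) (by fun_prop)
  have c2 : ContinuousAt (fun z : ℂ => Complex.Gamma (z + 1 / 2)) z :=
    ContinuousAt.comp (f := fun z : ℂ => z + 1 / 2) (hG _ h2) (by fun_prop)
  have c3 : ContinuousAt (fun z : ℂ => (2 : ℂ) ^ (z + 1 / 2)) z :=
    ContinuousAt.const_cpow (by fun_prop) (Or.inl two_ne_zero)
  unfold greenConst
  refine (continuousAt_const.mul c1).div (c3.mul c2) (mul_ne_zero ?_ ?_)
  · rw [Ne, Complex.cpow_eq_zero_iff]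
    simp
  · exact Complex.Gamma_ne_zero_of_re_pos h2

theorem rpow_sub_le_add {P b e : ℝ} (hP : 0 < P) (h0 : 0 ≤ e) (h1 : e ≤ 1) :
    P ^ (b - e) ≤ P ^ b + P ^ (b - 1) := by
  rcases le_total 1 P with h | h
  · exact (Real.rpow_le_rpow_of_exponent_le h (by linarith)).trans
      (le_add_of_nonneg_right (by positivity))
  · exact (Real.rpow_le_rpow_of_exponent_ge hP h (by linarith)).trans
      (le_add_of_nonneg_left (by positivity))

theorem tendsto_ofReal_add_nhdsGT (w : ℂ) :
    Tendsto (fun ε : ℝ => (ε : ℂ) + w) (𝓝[>] 0) (𝓝 w) := by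
  have : Tendsto (fun ε : ℝ => (ε : ℂ) + w) (𝓝 0) (𝓝 (((0 : ℝ) : ℂ) + w)) :=
    (by fun_prop : Continuous fun ε : ℝ => (ε : ℂ) + w).tendsto 0
  rw [Complex.ofReal_zero, zero_add] at this
  exact this.mono_left nhdsWithin_le_nhds

theorem tendsto_legInt_absorption (b : ℝ) {w : ℂ} (hw : w.re = 0) {C : ℝ} (hC : 1 < C) :
    Tendsto (fun ε : ℝ => legInt (b - ((ε : ℂ) + w)) ((ε : ℂ) + w) C) (𝓝[>] 0)
      (𝓝 (legInt (b - w) w C)) := by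
  have hsmall : ∀ᶠ ε : ℝ in 𝓝[>] 0, 0 < ε ∧ ε < 1 := Ioo_mem_nhdsGT (by norm_num)
  refine tendsto_integral_filter_of_dominated_convergence
    (fun _ => ((C - 1) ^ b + (C - 1) ^ (b - 1)) + ((C + 1) ^ b + (C + 1) ^ (b - 1))) ?_ ?_
    (integrableOn_const (by simp)) ?_
  · exact Eventually.of_forall fun ε => aestronglyMeasurable_legKer _ _ hC.le
  · filter_upwards [hsmall] with ε hε
    refine (ae_restrict_iff' measurableSet_Ioo).2 (Eventually.of_forall fun t ht => ?_)
    refine (norm_legKer_le _ (by simp [hw, hε.1.le]) hC le_rfl le_rfl ht).trans ?_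
    have e : ((b : ℂ) - ((ε : ℂ) + w)).re = b - ε := by simp [hw]
    rw [e]
    exact add_le_add (rpow_sub_le_add (by linarith) hε.1.le hε.2.le)
      (rpow_sub_le_add (by linarith) hε.1.le hε.2.le)
  · refine (ae_restrict_iff' measurableSet_Ioo).2 (Eventually.of_forall fun t ht => ?_)
    have h1 : ((C + Real.cos t : ℝ) : ℂ) ≠ 0 := by exact_mod_cast (add_cos_pos hC.le ht).ne'
    have h2 : ((Real.sin t : ℝ) : ℂ) ≠ 0 := by exact_mod_cast (sin_pos_of_mem ht).ne'
    have hc : Continuous fun z : ℂ => legKer (b - z) z C t := by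
      unfold legKer
      exact (Continuous.const_cpow (by fun_prop) (Or.inl h1)).mul
        (Continuous.const_cpow (by fun_prop) (Or.inl h2))
    exact (hc.tendsto w).comp (tendsto_ofReal_add_nhdsGT w)

theorem tendsto_greenC_absorption {n : ℕ} (hn : 2 ≤ n) {w : ℂ} (hw : w.re = 0) {C : ℝ} (hC : 1 < C) :
    Tendsto (fun ε : ℝ => greenC n ((ε : ℂ) + w) C) (𝓝[>] 0) (𝓝 (greenC n w C)) := by
  have h1 := ((continuousAt_greenConst hn hw.ge).tendsto).comp (tendsto_ofReal_add_nhdsGT w)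
  have h2 := tendsto_legInt_absorption (((n : ℝ) - 3) / 2) hw hC
  simp only [← half_cast] at h2
  exact (h1.mul_const _).mul h2

theorem tendsto_green_absorption {n : ℕ} (hn : 2 ≤ n) {w : ℂ} (hw : w.re = 0) {ρ : ℝ} (hρ : 0 < ρ) :
    Tendsto (fun ε : ℝ => green n ((ε : ℂ) + w) ρ) (𝓝[>] 0) (𝓝 (green n w ρ)) := by
  simp only [fun z : ℂ => green_eq_greenC n z hρ]
  exact tendsto_greenC_absorption hn hw (Real.one_lt_cosh.2 hρ.ne')

theorem eventually_greenBd_le {n : ℕ} (hn : 2 ≤ n) {w : ℂ} (hw : w.re = 0) :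
    ∃ B : ℝ, ∀ᶠ ε : ℝ in 𝓝[>] 0, greenBd n ((ε : ℂ) + w) ≤ B := by
  have hc : ContinuousAt (greenBd n) w := by
    unfold greenBd
    refine (continuousAt_greenConst hn hw.ge).norm.mul (continuousAt_const.mul ?_)
    exact ContinuousAt.rpow continuousAt_const Complex.continuous_re.continuousAt
      (Or.inl two_ne_zero)
  have h := hc.tendsto.comp (tendsto_ofReal_add_nhdsGT w)
  exact ⟨greenBd n w + 1, h.eventually_le_const (by linarith)⟩

theorem tendsto_integral_green_absorption {n : ℕ} (hn : 2 ≤ n) {w : ℂ} (hw : w.re = 0) {f : E n → ℂ}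
    (hf : IsContTest f) {x : E n} (hx : x ∈ pBall n) :
    Tendsto (fun ε : ℝ => ∫ y, green n ((ε : ℂ) + w) (hypDist x y) * f y ∂(hypVolume n))
      (𝓝[>] 0) (𝓝 (∫ y, green n w (hypDist x y) * f y ∂(hypVolume n))) := by
  simp only [fun z : ℂ => integral_green_mul hn z hx f, integral_mul_test hf]
  obtain ⟨B, hB0, hB⟩ := exists_bound_densTest hf
  obtain ⟨G, hG⟩ := eventually_greenBd_le hn hw
  have hpos : ∀ᶠ ε : ℝ in 𝓝[>] 0, 0 ≤ ((ε : ℂ) + w).re := by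
    filter_upwards [self_mem_nhdsWithin] with ε hε
    simp [hw, (Set.mem_Ioi.1 hε).le]
  refine tendsto_integral_filter_of_dominated_convergence
    (fun y => G * 2 ^ n * singMajorant x y * B) ?_ ?_
    (((integrable_singMajorant hn x).const_mul _).mul_const B) ?_
  · filter_upwards [hpos] with ε hε
    simpa using aestronglyMeasurable_greenC_mul hn hε hx hf (le_refl (0 : ℝ))
  · filter_upwards [hpos, hG] with ε hε hGε
    filter_upwards [ae_ne hn x] with y hy
    have := norm_greenC_mul_densTest_le hn hε hx hf hB hy (le_refl (0 : ℝ))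
    rw [add_zero] at this
    have h1 := singMajorant_nonneg x y
    exact this.trans (by gcongr)
  · filter_upwards [ae_ne hn x] with y hy
    by_cases hyb : y ∈ pBall n
    · exact (tendsto_greenC_absorption hn hw (one_lt_coshDist hx hyb hy)).mul_const _
    · simp only [densTest_eq_zero fun h => hyb (hf.support_subset h), mul_zero]
      exact tendsto_const_nhds

/-! ### Square integrability -/

/-- The decay `(cosh ρ(x))^{-(n-1)/2-γ}` of the resolvent applied to a test function, with `γ` the real
part of the spectral parameter. -/
noncomputable def decay {n : ℕ} (γ : ℝ) (x : E n) : ℝ :=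
  Real.cosh (rho x) ^ (-((n : ℝ) - 1) / 2 - γ)

theorem decay_nonneg {n : ℕ} (γ : ℝ) (x : E n) : 0 ≤ decay γ x :=
  Real.rpow_nonneg (Real.cosh_pos _).le _

theorem measurable_decay {n : ℕ} (γ : ℝ) : Measurable (decay γ : E n → ℝ) := by
  have : Measurable (rho : E n → ℝ) := by unfold rho; fun_prop
  unfold decay
  fun_prop

theorem integrableOn_one_sub_rpow {p : ℝ} (hp : -1 < p) :
    IntegrableOn (fun r : ℝ => (1 - r) ^ p) (Set.Ioo 0 1) := by
  have h := (intervalIntegral.intervalIntegrable_rpow' (a := 0) (b := 1) hp).comp_sub_left 1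
  rw [sub_zero, sub_self] at h
  exact (intervalIntegrable_iff_integrableOn_Ioo_of_le zero_le_one).1 h.symm

/-- The square of the decay against the hyperbolic density is `(1 - |x|²)^{2γ-1}` up to constants,
which is integrable up to the boundary because `γ > 0`. The summand one covers the exponents `2γ - 1 ≥ 0`. -/
theorem hypDens_mul_decay_sq_le {n : ℕ} (γ : ℝ) {x : E n} (hx : x ∈ pBall n) (hn : 2 ≤ n)
    (hγ : 0 < γ) :
    hypDens x * decay γ x ^ 2 ≤ 2 ^ n * (1 + (1 - ‖x‖) ^ (2 * γ - 1)) := by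
  have hn' : (2 : ℝ) ≤ n := by exact_mod_cast hn
  have h1 := one_sub_sq_pos hx
  have hx1 := mem_pBall.1 hx
  have hx0 := norm_nonneg x
  -- `1 / cosh ρ = (1 - |x|²) / (1 + |x|²) ≤ 1 - |x|²`
  have h2 : decay γ x ≤ (1 - ‖x‖ ^ 2) ^ (((n : ℝ) - 1) / 2 + γ) := by
    rw [decay, cosh_rho hx, show -((n : ℝ) - 1) / 2 - γ = -(((n : ℝ) - 1) / 2 + γ) by ring,
      Real.rpow_neg (by positivity), ← Real.inv_rpow (by positivity), inv_div]
    refine Real.rpow_le_rpow (by positivity) ?_ (by linarith)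
    rw [div_le_iff₀ (by positivity)]
    nlinarith
  have h3 : ((1 - ‖x‖ ^ 2) ^ (((n : ℝ) - 1) / 2 + γ)) ^ 2 =
      (1 - ‖x‖ ^ 2) ^ n * (1 - ‖x‖ ^ 2) ^ (2 * γ - 1) := by
    rw [← Real.rpow_natCast _ 2, ← Real.rpow_mul h1.le, ← Real.rpow_natCast _ n,
      ← Real.rpow_add h1]
    congr 1; push_cast; ring
  have h4 : (1 - ‖x‖ ^ 2) ^ (2 * γ - 1) ≤ 1 + (1 - ‖x‖) ^ (2 * γ - 1) := by
    have h5 : 0 ≤ (1 - ‖x‖) ^ (2 * γ - 1) := Real.rpow_nonneg (by linarith) _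
    rcases le_total 0 (2 * γ - 1) with h | h
    · have := Real.rpow_le_one h1.le (one_sub_sq_le_one x) h
      linarith
    · have := Real.rpow_le_rpow_of_nonpos (by linarith : 0 < 1 - ‖x‖)
        (by nlinarith : 1 - ‖x‖ ≤ 1 - ‖x‖ ^ 2) h
      linarith
  have hd := (hypDens_pos hx).le
  calc hypDens x * decay γ x ^ 2
      ≤ hypDens x * ((1 - ‖x‖ ^ 2) ^ (((n : ℝ) - 1) / 2 + γ)) ^ 2 := by
        have := decay_nonneg γ x
        gcongr
    _ = 2 ^ n * (1 - ‖x‖ ^ 2) ^ (2 * γ - 1) := by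
        rw [h3, hypDens, div_pow]; field_simp
    _ ≤ _ := by gcongr

theorem memLp_decay {n : ℕ} (hn : 2 ≤ n) {γ : ℝ} (hγ : 0 < γ) :
    MemLp (decay γ : E n → ℝ) 2 (hypVolume n) := by
  have := nontrivial_E hn
  rw [memLp_two_iff_integrable_sq (measurable_decay γ).aestronglyMeasurable,
    integrable_hypVolume_iff]
  simp only [smul_eq_mul]
  have hrad : IntegrableOn (fun x : E n => 2 ^ n * (1 + (1 - ‖x‖) ^ (2 * γ - 1))) (pBall n) := by
    refine (integrableOn_fun_norm_addHaar (volume : Measure (E n))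
      (f := fun r : ℝ => 2 ^ n * (1 + (1 - r) ^ (2 * γ - 1)))).2 ?_
    have h : IntegrableOn (fun r : ℝ => 2 ^ n * (1 + (1 - r) ^ (2 * γ - 1))) (Set.Ioo 0 1) :=
      ((integrableOn_const (by simp)).add
        (integrableOn_one_sub_rpow (p := 2 * γ - 1) (by linarith))).const_mul _
    refine Integrable.bdd_mul (c := 1) h (by fun_prop) ?_
    refine (ae_restrict_iff' measurableSet_Ioo).2 (Eventually.of_forall fun r hr => ?_)
    rw [norm_pow, Real.norm_of_nonneg hr.1.le]
    exact pow_le_one₀ hr.1.le hr.2.le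
  refine Integrable.mono' hrad ?_ ?_
  · exact (measurable_hypDens.mul ((measurable_decay γ).pow_const 2)).aestronglyMeasurable
  · refine (ae_restrict_iff' measurableSet_ball).2 (Eventually.of_forall fun x hx => ?_)
    rw [Real.norm_of_nonneg (mul_nonneg (hypDens_pos hx).le (sq_nonneg _))]
    exact hypDens_mul_decay_sq_le γ hx hn hγ

theorem memLp_contTest {n : ℕ} {f : E n → ℂ} (hf : IsContTest f) : MemLp f 2 (hypVolume n) := by
  rw [memLp_two_iff_integrable_sq_norm hf.continuous.aestronglyMeasurable]
  have h := integrable_hypVolume_of_support (F := fun x => ((‖f x‖ ^ 2 : ℝ) : ℂ)) hf.compact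
    hf.support_subset (by have := hf.continuous; fun_prop) fun x hx => by
      rw [image_eq_zero_of_notMem_tsupport hx]; simp
  refine h.re.congr (Eventually.of_forall fun x => ?_)
  exact Complex.ofReal_re _

theorem integrable_contTest {n : ℕ} {f : E n → ℂ} (hf : IsContTest f) :
    Integrable f (hypVolume n) :=
  integrable_hypVolume_of_support hf.compact hf.support_subset hf.continuous.continuousOn
    fun _ hx => image_eq_zero_of_notMem_tsupport hx

theorem locallyIntegrableOn_of_memLp_two {n : ℕ} {u : E n → ℂ} (hu : MemLp u 2 (hypVolume n)) :
    LocallyIntegrableOn u (pBall n) (hypVolume n) := by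
  rw [locallyIntegrableOn_iff (isOpen_pBall n).isLocallyClosed]
  intro K hKb hK
  have h := integrable_hypVolume_of_support (F := K.indicator fun _ : E n => (1 : ℂ)) hK hKb
    (continuousOn_const.congr fun x hx => Set.indicator_of_mem hx _)
    fun x hx => Set.indicator_of_notMem hx _
  rw [integrable_indicator_iff hK.measurableSet] at h
  have hfin : hypVolume n K < ⊤ := by
    rw [IntegrableOn, integrable_const_iff] at h
    simpa [isFiniteMeasure_restrict, lt_top_iff_ne_top] using h
  have : IsFiniteMeasure ((hypVolume n).restrict K) := isFiniteMeasure_restrict.2 hfin.ne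
  exact (hu.restrict K).integrable one_le_two

/-- The decay in `ρ(x, y)` is the decay in `ρ(x)`, locally uniformly in `y`. -/
theorem exists_coshDist_rpow_le_decay {n : ℕ} (hn : 2 ≤ n) {γ : ℝ} (hγ : 0 ≤ γ) {K : Set (E n)}
    (hK : IsCompact K) (hKb : K ⊆ pBall n) : ∃ c : ℝ, 0 ≤ c ∧ ∀ x ∈ pBall n, ∀ y ∈ K,
      coshDist x y ^ (-((n : ℝ) - 1) / 2 - γ) ≤ c * decay γ x := by
  have hn' : (2 : ℝ) ≤ n := by exact_mod_cast hn
  obtain ⟨r, hr, hKr⟩ : ∃ r < 1, ∀ y ∈ K, ‖y‖ ≤ r := by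
    rcases K.eq_empty_or_nonempty with rfl | hne
    · exact ⟨0, zero_lt_one, by simp⟩
    · obtain ⟨y, hy, hmax⟩ := hK.exists_isMaxOn hne continuous_norm.continuousOn
      exact ⟨‖y‖, mem_pBall.1 (hKb hy), hmax⟩
  have h0 : 0 < (1 - r) ^ 2 := by
    have : 0 < 1 - r := by linarith
    positivity
  refine ⟨((1 - r) ^ 2) ^ (-((n : ℝ) - 1) / 2 - γ), by positivity, fun x hx y hy => ?_⟩
  have hc := Real.cosh_pos (rho x)
  rw [decay, ← Real.mul_rpow h0.le hc.le, coshDist_comm]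
  exact Real.rpow_le_rpow_of_nonpos (by positivity) (mul_cosh_rho_le_coshDist hr (hKr y hy) hx)
    (by linarith)

/-! ### The resolvent -/

theorem continuousAt_coshDist_prod {n : ℕ} {p : E n × E n} (h1 : p.1 ∈ pBall n)
    (h2 : p.2 ∈ pBall n) : ContinuousAt (fun p : E n × E n => coshDist p.1 p.2) p := by
  have h1 := one_sub_sq_pos h1
  have h2 := one_sub_sq_pos h2
  unfold coshDist
  refine continuousAt_const.add (ContinuousAt.div (by fun_prop) (by fun_prop) ?_)
  positivity

/-- The kernel is continuous off the diagonal, which is a null set. -/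
theorem aestronglyMeasurable_prod_greenC {n : ℕ} (hn : 2 ≤ n) {z : ℂ} (hz : 0 ≤ z.re) :
    AEStronglyMeasurable (fun p : E n × E n => greenC n z (coshDist p.1 p.2))
      ((hypVolume n).prod (hypVolume n)) := by
  have hac : (hypVolume n).prod (hypVolume n) ≪
      (volume.prod volume).restrict (pBall n ×ˢ pBall n) := by
    rw [← Measure.prod_restrict]
    exact (hypVolume_absolutelyContinuous n).prod (hypVolume_absolutelyContinuous n)
  refine AEStronglyMeasurable.mono_ac hac ?_
  set U : Set (E n × E n) := (pBall n ×ˢ pBall n) \ {p | p.2 = p.1} with hU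
  have hcl : IsClosed {p : E n × E n | p.2 = p.1} := isClosed_eq continuous_snd continuous_fst
  have hUo : IsOpen U := ((isOpen_pBall n).prod (isOpen_pBall n)).sdiff hcl
  have hnull : (volume.prod volume) {p : E n × E n | p.2 = p.1} = 0 := by
    rw [Measure.measure_prod_null hcl.measurableSet]
    exact Eventually.of_forall fun x => by simpa using ae_iff.1 (ae_ne hn x)
  have hr : (volume.prod volume).restrict (pBall n ×ˢ pBall n) =
      (volume.prod volume).restrict U :=
    (Measure.restrict_congr_set (sdiff_null_ae_eq_self hnull)).symm
  rw [hr]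
  refine ContinuousOn.aestronglyMeasurable ?_ hUo.measurableSet
  intro p hp
  exact (ContinuousAt.comp (f := fun p : E n × E n => coshDist p.1 p.2)
    (continuousAt_greenC hn hz (one_lt_coshDist hp.1.1 hp.1.2 hp.2))
    (continuousAt_coshDist_prod hp.1.1 hp.1.2)).continuousWithinAt

instance sFinite_hypVolume (n : ℕ) : SFinite (hypVolume n) := by
  unfold hypVolume; infer_instance

theorem integrable_greenC_mul_test {n : ℕ} (hn : 2 ≤ n) {z : ℂ} (hz : 0 ≤ z.re) {x : E n}
    (hx : x ∈ pBall n) {f : E n → ℂ} (hf : IsContTest f) :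
    Integrable (fun y => greenC n z (coshDist x y) * f y) (hypVolume n) := by
  rw [integrable_mul_test_iff hf]
  simpa using integrable_greenC_mul hn hz hx hf (le_refl (0 : ℝ))

/-- The Green potential of a test function decays like the Green function. -/
theorem exists_integral_norm_greenC_mul_le {n : ℕ} (hn : 2 ≤ n) {z : ℂ} (hz : 0 ≤ z.re)
    {f : E n → ℂ} (hf : IsContTest f) : ∃ K : ℝ, 0 ≤ K ∧ ∀ x ∈ pBall n,
      ∫ y, ‖greenC n z (coshDist x y) * f y‖ ∂(hypVolume n) ≤ K * decay z.re x := by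
  obtain ⟨B, hB0, hB⟩ := exists_bound_densTest hf
  obtain ⟨c, hc0, hc⟩ := exists_coshDist_rpow_le_decay hn hz hf.compact hf.support_subset
  have hG := greenBd_nonneg n z
  have hI : 0 ≤ ∫ y, singMajorant (0 : E n) y := integral_nonneg fun y => singMajorant_nonneg 0 y
  refine ⟨greenBd n z * 2 ^ n * c * B * ∫ y, singMajorant (0 : E n) y, by positivity,
    fun x hx => ?_⟩
  have hd := decay_nonneg z.re x
  have hnorm : ∫ y, ‖greenC n z (coshDist x y) * f y‖ ∂(hypVolume n) =
      ∫ y, ‖greenC n z (coshDist x y) * densTest f y‖ := by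
    have h1 : ∀ y ∈ pBall n, hypDens y • ‖greenC n z (coshDist x y) * f y‖ =
        ‖greenC n z (coshDist x y) * densTest f y‖ := fun y hy => by
      rw [densTest, norm_mul, norm_mul, norm_smul, Real.norm_of_nonneg (hypDens_pos hy).le,
        smul_eq_mul]
      ring
    rw [integral_hypVolume, setIntegral_congr_fun (isOpen_pBall n).measurableSet h1]
    refine setIntegral_eq_integral_of_forall_compl_eq_zero fun y hy => ?_
    rw [densTest_eq_zero fun h => hy (hf.support_subset h), mul_zero, norm_zero]
  have hint : Integrable fun y => greenBd n z * 2 ^ n * c * decay z.re x * B * singMajorant x y :=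
    (integrable_singMajorant hn x).const_mul _
  have hgi : Integrable fun y => greenC n z (coshDist x y) * densTest f y := by
    simpa using integrable_greenC_mul hn hz hx hf (le_refl (0 : ℝ))
  rw [hnorm]
  calc ∫ y, ‖greenC n z (coshDist x y) * densTest f y‖
      ≤ ∫ y, greenBd n z * 2 ^ n * c * decay z.re x * B * singMajorant x y := by
        refine integral_mono_ae hgi.norm hint ?_
        filter_upwards [ae_ne hn x] with y hy
        have hs := singMajorant_nonneg x y
        by_cases hyf : y ∈ tsupport f
        · rw [norm_mul]
          calc _ ≤ (greenBd n z * 2 ^ n * singMajorant x y * (c * decay z.re x)) * B := by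
                gcongr
                · refine (norm_greenC_le_singMajorant hn hz hx (hf.support_subset hyf) hy
                    le_rfl).trans ?_
                  gcongr
                  exact hc x hx y hyf
                · exact hB y
            _ = _ := by ring
        · rw [densTest_eq_zero hyf, mul_zero, norm_zero]
          positivity
    _ = _ := by rw [integral_const_mul, integral_singMajorant]; ring

theorem integrable_prod_greenC {n : ℕ} (hn : 2 ≤ n) {z : ℂ} (hz : 0 < z.re) {f g : E n → ℂ}
    (hf : IsContTest f) (hg : MemLp g 2 (hypVolume n)) :
    Integrable (fun p : E n × E n => greenC n z (coshDist p.1 p.2) * f p.2 * g p.1)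
      ((hypVolume n).prod (hypVolume n)) := by
  obtain ⟨K, hK0, hK⟩ := exists_integral_norm_greenC_mul_le hn hz.le hf
  have hm : AEStronglyMeasurable
      (fun p : E n × E n => greenC n z (coshDist p.1 p.2) * f p.2 * g p.1)
      ((hypVolume n).prod (hypVolume n)) :=
    ((aestronglyMeasurable_prod_greenC hn hz.le).mul
      (hf.continuous.comp continuous_snd).aestronglyMeasurable).mul hg.1.comp_fst
  rw [integrable_prod_iff hm]
  constructor
  · filter_upwards [ae_mem_pBall n] with x hx
    exact (integrable_greenC_mul_test hn hz.le hx hf).mul_const _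
  · refine Integrable.mono' (g := fun x => K * (decay z.re x * ‖g x‖))
      (((memLp_decay hn hz).integrable_mul hg.norm).const_mul K) hm.norm.integral_prod_right' ?_
    filter_upwards [ae_mem_pBall n] with x hx
    rw [Real.norm_of_nonneg (integral_nonneg fun y => norm_nonneg _)]
    simp only [norm_mul _ (g x)]
    rw [integral_mul_const, ← mul_assoc]
    exact mul_le_mul_of_nonneg_right (hK x hx) (norm_nonneg _)

/-- The Green potential of a test function is a square integrable weak solution: by Fubini and the
symmetry of the distance this is the statement that the Green function is a fundamental solution. -/
theorem isL2Solution_greenC {n : ℕ} (hn : 2 ≤ n) {z : ℂ} (hz : 0 < z.re) {f : E n → ℂ}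
    (hf : IsTest f) :
    IsL2Solution (z ^ 2) f fun x => ∫ y, greenC n z (coshDist x y) * f y ∂(hypVolume n) := by
  have hfc := hf.isContTest
  constructor
  · obtain ⟨K, hK0, hK⟩ := exists_integral_norm_greenC_mul_le hn hz.le hfc
    refine MemLp.of_le_mul (c := K) (memLp_decay hn hz) ?_ ?_
    · exact ((aestronglyMeasurable_prod_greenC hn hz.le).mul
        (hfc.continuous.comp continuous_snd).aestronglyMeasurable).integral_prod_right'
    · filter_upwards [ae_mem_pBall n] with x hx
      rw [Real.norm_of_nonneg (decay_nonneg _ _)]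
      exact (norm_integral_le_integral_norm _).trans (hK x hx)
  · intro φ hφ
    have hi := integrable_prod_greenC hn hz hfc (memLp_contTest (hφ.isContTest_shiftedOp (z ^ 2)))
    simp only [← integral_mul_const]
    rw [integral_integral_swap hi]
    refine integral_congr_ae ?_
    filter_upwards [ae_mem_pBall n] with y hy
    have h := integral_greenC_mul_shiftedOp hn hz.le hy hφ
    rw [← h, ← integral_const_mul]
    refine integral_congr_ae (Eventually.of_forall fun x => ?_)
    simp only [coshDist_comm x y]
    ring

/-! ### Truncated regularised Green functions -/

/-- A smooth cutoff on the line, equal to one on `[-1, 1]` and vanishing outside `(-2, 2)`. -/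
noncomputable def cutoff : ContDiffBump (0 : ℝ) := ⟨1, 2, one_pos, one_lt_two⟩

theorem cutoff_eventually_one {t : ℝ} (ht : |t| < 1) : (cutoff : ℝ → ℝ) =ᶠ[𝓝 t] 1 :=
  cutoff.eventuallyEq_one_of_mem_ball (by simpa [cutoff] using ht)

theorem cutoff_eventually_zero {t : ℝ} (ht : 2 < |t|) : (cutoff : ℝ → ℝ) =ᶠ[𝓝 t] 0 := by
  have : {t : ℝ | 2 < |t|} ∈ 𝓝 t := (isOpen_lt continuous_const continuous_abs).mem_nhds ht
  filter_upwards [this] with r hr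
  exact cutoff.zero_of_le_dist (by simpa [cutoff] using (show 2 < |r| from hr).le)

theorem contDiff_cutoff : ContDiff ℝ ∞ (cutoff : ℝ → ℝ) := cutoff.contDiff

theorem contDiff_deriv_cutoff : ContDiff ℝ ∞ (deriv cutoff) :=
  (contDiff_infty_iff_deriv.1 contDiff_cutoff).2

theorem deriv_cutoff_eq_zero {t : ℝ} (ht : |t| < 1 ∨ 2 < |t|) :
    deriv cutoff t = 0 ∧ deriv (deriv cutoff) t = 0 := by
  have h : ∃ c : ℝ, (cutoff : ℝ → ℝ) =ᶠ[𝓝 t] fun _ => c := by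
    rcases ht with h | h
    exacts [⟨1, cutoff_eventually_one h⟩, ⟨0, cutoff_eventually_zero h⟩]
  obtain ⟨c, hc⟩ := h
  have h1 : deriv cutoff =ᶠ[𝓝 t] fun _ => 0 := by simpa using hc.deriv
  exact ⟨h1.self_of_nhds, by simpa using h1.deriv.self_of_nhds⟩

theorem exists_bound_deriv_cutoff :
    ∃ S : ℝ, 0 ≤ S ∧ ∀ t, |deriv cutoff t| ≤ S ∧ |deriv (deriv cutoff) t| ≤ S := by
  have hc : HasCompactSupport (deriv cutoff) := cutoff.hasCompactSupport.deriv
  obtain ⟨a, ha⟩ := contDiff_deriv_cutoff.continuous.bounded_above_of_compact_support hc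
  obtain ⟨b, hb⟩ := (contDiff_infty_iff_deriv.1
    contDiff_deriv_cutoff).2.continuous.bounded_above_of_compact_support hc.deriv
  refine ⟨max a b, (norm_nonneg _).trans ((ha 0).trans (le_max_left _ _)), fun t => ⟨?_, ?_⟩⟩
  · exact (ha t).trans (le_max_left _ _)
  · exact (hb t).trans (le_max_right _ _)

/-- The regularised Green function, cut off where `C` exceeds `1 / s`. The regularisation `s²` and the
cutoff are tied to one parameter. -/
noncomputable def cutGreen (n : ℕ) (z : ℂ) (s C : ℝ) : ℂ :=
  (cutoff (s * C) : ℂ) * greenC n z (C + s ^ 2)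

/-- The image of the truncated regularised Green function under the radial form of the operator: the
cutoff times `regErr`, and the terms where a derivative falls on the cutoff (`shiftedOp_cutTest`). -/
noncomputable def cutErr (n : ℕ) (z : ℂ) (s C : ℝ) : ℂ :=
  (cutoff (s * C) : ℂ) * regErr n z (s ^ 2) C -
    (((C : ℂ) ^ 2 - 1) * ((s ^ 2 * deriv (deriv cutoff) (s * C) : ℝ) * greenC n z (C + s ^ 2) +
      2 * (s * deriv cutoff (s * C) : ℝ) * (-(2 * Real.pi) * greenC (n + 2) z (C + s ^ 2))) +
      n * C * ((s * deriv cutoff (s * C) : ℝ) * greenC n z (C + s ^ 2)))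

theorem cutErr_eq_regErr (n : ℕ) (z : ℂ) {s C : ℝ} (h : |s * C| < 1) :
    cutErr n z s C = regErr n z (s ^ 2) C := by
  have h1 := deriv_cutoff_eq_zero (Or.inl h)
  have h2 : cutoff (s * C) = 1 := (cutoff_eventually_one h).self_of_nhds
  rw [cutErr, h1.1, h1.2, h2]
  simp

/-- The terms with a derivative of the cutoff live on `1 ≤ s C ≤ 2`, where each power of `C` in the
operator is matched by a factor `s` or by the extra decay of `g_{n+2}`. So they are of the size of
the Green function itself, uniformly in `s`. -/
theorem norm_cutErr_sub_le {n : ℕ} (hn : 2 ≤ n) {z : ℂ} (hz : 0 ≤ z.re) :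
    ∃ K : ℝ, 0 ≤ K ∧ ∀ s C : ℝ, 0 < s → s ≤ 1 / 2 → 1 ≤ C →
      ‖cutErr n z s C - (cutoff (s * C) : ℂ) * regErr n z (s ^ 2) C‖ ≤
        K * C ^ (-((n : ℝ) - 1) / 2 - z.re) := by
  have hn' : (2 : ℝ) ≤ n := by exact_mod_cast hn
  obtain ⟨S, hS0, hS⟩ := exists_bound_deriv_cutoff
  have hpi := Real.pi_pos
  set a := greenBd n z * 2 ^ (((n : ℝ) - 1) / 2) with ha
  set b := greenBd (n + 2) z * 2 ^ ((((n + 2 : ℕ) : ℝ) - 1) / 2) with hb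
  have ha0 : 0 ≤ a := mul_nonneg (greenBd_nonneg _ _) (by positivity)
  have hb0 : 0 ≤ b := mul_nonneg (greenBd_nonneg _ _) (by positivity)
  refine ⟨4 * S * a + 8 * Real.pi * S * b + n * (2 * S * a), by positivity,
    fun s C hs hs1 hC => ?_⟩
  have hC0 : 0 < C := by linarith
  have hpow : 0 ≤ C ^ (-((n : ℝ) - 1) / 2 - z.re) := by positivity
  -- Away from `1 ≤ s C ≤ 2` the cutoff is locally constant.
  by_cases hsC : |s * C| < 1 ∨ 2 < |s * C|
  · obtain ⟨h1, h2⟩ := deriv_cutoff_eq_zero hsC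
    rw [cutErr, h1, h2]
    simp only [mul_zero, Complex.ofReal_zero, zero_mul, add_zero, sub_zero, sub_self, norm_zero]
    positivity
  · push Not at hsC
    rw [abs_of_pos (by positivity)] at hsC
    set D := C + s ^ 2 with hD
    have hC2 : 2 ≤ C := by nlinarith
    have hDC : C ≤ D := by rw [hD]; nlinarith
    have hk := decay_exp_nonpos hn hz
    have hg : ‖greenC n z D‖ ≤ a * C ^ (-((n : ℝ) - 1) / 2 - z.re) :=
      (norm_greenC_le_of_two_le hn hz (hC2.trans hDC)).trans
        (mul_le_mul_of_nonneg_left (Real.rpow_le_rpow_of_nonpos hC0 hDC hk) ha0)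
    have hg2 : C * ‖greenC (n + 2) z D‖ ≤ b * C ^ (-((n : ℝ) - 1) / 2 - z.re) := by
      have h1 := norm_greenC_le_of_two_le (n := n + 2) (by omega) hz (hC2.trans hDC)
      have h2 : D ^ (-(((n + 2 : ℕ) : ℝ) - 1) / 2 - z.re) ≤
          C ^ (-(((n + 2 : ℕ) : ℝ) - 1) / 2 - z.re) :=
        Real.rpow_le_rpow_of_nonpos hC0 hDC (decay_exp_nonpos (by omega) hz)
      have h3 : C * C ^ (-(((n + 2 : ℕ) : ℝ) - 1) / 2 - z.re) =
          C ^ (-((n : ℝ) - 1) / 2 - z.re) := by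
        nth_rewrite 1 [← Real.rpow_one C]
        rw [← Real.rpow_add hC0]
        congr 1; push_cast; ring
      calc C * ‖greenC (n + 2) z D‖ ≤ C * (b * C ^ (-(((n + 2 : ℕ) : ℝ) - 1) / 2 - z.re)) := by
            gcongr
            exact h1.trans (mul_le_mul_of_nonneg_left h2 hb0)
        _ = b * (C * C ^ (-(((n + 2 : ℕ) : ℝ) - 1) / 2 - z.re)) := by ring
        _ = _ := by rw [h3]
    obtain ⟨hS1, hS2⟩ := hS (s * C)
    have hCsq : ‖(C : ℂ) ^ 2 - 1‖ ≤ C ^ 2 := by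
      rw [← Complex.ofReal_pow, ← Complex.ofReal_one, ← Complex.ofReal_sub, Complex.norm_real,
        Real.norm_of_nonneg (by nlinarith)]
      linarith
    have h2pi : ‖(-(2 * Real.pi : ℂ))‖ = 2 * Real.pi := by
      rw [norm_neg, ← Complex.ofReal_ofNat, ← Complex.ofReal_mul, Complex.norm_real,
        Real.norm_of_nonneg Real.two_pi_pos.le]
    have t1 : ‖((C : ℂ) ^ 2 - 1) * ((s ^ 2 * deriv (deriv cutoff) (s * C) : ℝ) * greenC n z D)‖ ≤
        4 * S * (a * C ^ (-((n : ℝ) - 1) / 2 - z.re)) := by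
      rw [norm_mul, norm_mul, Complex.norm_real, norm_mul, Real.norm_eq_abs, Real.norm_eq_abs,
        abs_of_pos (by positivity : 0 < s ^ 2)]
      calc _ ≤ C ^ 2 * (s ^ 2 * S * (a * C ^ (-((n : ℝ) - 1) / 2 - z.re))) := by gcongr
        _ = (s * C) ^ 2 * (S * (a * C ^ (-((n : ℝ) - 1) / 2 - z.re))) := by ring
        _ ≤ 2 ^ 2 * (S * (a * C ^ (-((n : ℝ) - 1) / 2 - z.re))) := by
          gcongr
          exact hsC.2
        _ = _ := by ring
    have t2 : ‖((C : ℂ) ^ 2 - 1) * (2 * (s * deriv cutoff (s * C) : ℝ) *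
        (-(2 * Real.pi) * greenC (n + 2) z D))‖ ≤
        8 * Real.pi * S * (b * C ^ (-((n : ℝ) - 1) / 2 - z.re)) := by
      rw [norm_mul, norm_mul, norm_mul, norm_mul, Complex.norm_real, h2pi, norm_mul,
        Real.norm_eq_abs, Real.norm_eq_abs, abs_of_pos hs, Complex.norm_two]
      calc _ ≤ C ^ 2 * (2 * (s * S) * (2 * Real.pi * ‖greenC (n + 2) z D‖)) := by gcongr
        _ = 4 * Real.pi * S * (s * C) * (C * ‖greenC (n + 2) z D‖) := by ring
        _ ≤ 4 * Real.pi * S * 2 * (b * C ^ (-((n : ℝ) - 1) / 2 - z.re)) := by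
          gcongr
          exact hsC.2
        _ = _ := by ring
    have t3 : ‖n * C * ((s * deriv cutoff (s * C) : ℝ) * greenC n z D)‖ ≤
        n * (2 * S * (a * C ^ (-((n : ℝ) - 1) / 2 - z.re))) := by
      rw [norm_mul, norm_mul, norm_mul, Complex.norm_real, Complex.norm_real, Complex.norm_natCast,
        norm_mul, Real.norm_eq_abs, Real.norm_eq_abs, Real.norm_eq_abs, abs_of_pos hs,
        abs_of_pos hC0]
      calc _ ≤ n * C * (s * S * (a * C ^ (-((n : ℝ) - 1) / 2 - z.re))) := by gcongr
        _ = n * ((s * C) * S * (a * C ^ (-((n : ℝ) - 1) / 2 - z.re))) := by ring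
        _ ≤ _ := by
          gcongr
          exact hsC.2
    rw [cutErr, sub_sub_cancel_left, norm_neg, mul_add]
    calc _ ≤ _ := (norm_add_le _ _).trans (add_le_add ((norm_add_le _ _).trans (add_le_add t1 t2)) t3)
      _ = _ := by ring

theorem norm_cutErr_le {n : ℕ} (hn : 2 ≤ n) {z : ℂ} (hz : 0 ≤ z.re) :
    ∃ K : ℝ, 0 ≤ K ∧ ∀ (x y : E n) (s : ℝ), x ∈ pBall n → y ∈ pBall n → 0 < s → s ≤ 1 / 2 →
      ‖cutErr n z s (coshDist x y)‖ ≤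
        K * (1 + s ^ 2 * (2 * ‖y - x‖ ^ 2 + s ^ 2) ^ (-((n : ℝ) / 2 + 1))) *
          coshDist x y ^ (-((n : ℝ) - 1) / 2 - z.re) := by
  obtain ⟨K, hK0, hK⟩ := norm_cutErr_sub_le hn hz
  obtain ⟨K', hK0', hK'⟩ := norm_regErr_le_global hn hz
  refine ⟨K + K', by positivity, fun x y s hx hy hs hs1 => ?_⟩
  have h1 := hK s (coshDist x y) hs hs1 (one_le_coshDist hx hy)
  have h2 := hK' x y s hx hy hs (by linarith)
  have hC := one_le_coshDist hx hy
  have h3 : ‖(cutoff (s * coshDist x y) : ℂ) * regErr n z (s ^ 2) (coshDist x y)‖ ≤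
      ‖regErr n z (s ^ 2) (coshDist x y)‖ := by
    rw [norm_mul, Complex.norm_real, Real.norm_of_nonneg cutoff.nonneg]
    exact mul_le_of_le_one_left (norm_nonneg _) cutoff.le_one
  have hP : 0 ≤ s ^ 2 * (2 * ‖y - x‖ ^ 2 + s ^ 2) ^ (-((n : ℝ) / 2 + 1)) := by positivity
  have hpow : 0 ≤ coshDist x y ^ (-((n : ℝ) - 1) / 2 - z.re) := Real.rpow_nonneg (by linarith) _
  have h4 := norm_add_le (cutErr n z s (coshDist x y) -
    (cutoff (s * coshDist x y) : ℂ) * regErr n z (s ^ 2) (coshDist x y))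
    ((cutoff (s * coshDist x y) : ℂ) * regErr n z (s ^ 2) (coshDist x y))
  rw [sub_add_cancel] at h4
  nlinarith [mul_nonneg (mul_nonneg hK0 hP) hpow]

theorem continuousAt_cutErr {n : ℕ} (hn : 2 ≤ n) {z : ℂ} (hz : 0 ≤ z.re) {s C : ℝ}
    (hC : 1 < C + s ^ 2) : ContinuousAt (cutErr n z s) C := by
  have hs : ContinuousAt (fun C : ℝ => C + s ^ 2) C := by fun_prop
  have h2 : ContinuousAt (fun C : ℝ => greenC (n + 2) z (C + s ^ 2)) C :=
    ContinuousAt.comp (f := fun C : ℝ => C + s ^ 2) (continuousAt_greenC (by omega) hz hC) hs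
  have h0 : ContinuousAt (fun C : ℝ => greenC n z (C + s ^ 2)) C :=
    ContinuousAt.comp (f := fun C : ℝ => C + s ^ 2) (continuousAt_greenC (by omega) hz hC) hs
  have h1 := continuousAt_regErr hn hz hC
  have c0 : Continuous (cutoff : ℝ → ℝ) := contDiff_cutoff.continuous
  have c1 := contDiff_deriv_cutoff.continuous
  have c2 := (contDiff_infty_iff_deriv.1 contDiff_deriv_cutoff).2.continuous
  unfold cutErr
  fun_prop

/-- The truncated regularised Green function with pole `y`, extended by zero outside of the ball.
It is a test function (`isTest_cutTest`), since large `C` means near the boundary. -/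
noncomputable def cutTest {n : ℕ} (z : ℂ) (s : ℝ) (y : E n) : E n → ℂ :=
  (pBall n).indicator fun x => cutGreen n z s (coshDist y x)

theorem contDiffAt_cutGreen {n : ℕ} (hn : 2 ≤ n) {z : ℂ} (hz : 0 ≤ z.re) {s C : ℝ}
    (hC : 1 < C + s ^ 2) : ContDiffAt ℝ ∞ (cutGreen n z s) C := by
  have h1 : ContDiff ℝ ∞ fun C : ℝ => (cutoff (s * C) : ℂ) :=
    Complex.ofRealCLM.contDiff.comp (contDiff_cutoff.comp (contDiff_const.mul contDiff_id))
  exact h1.contDiffAt.mul (contDiffAt_greenC_shift hn hz hC)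

theorem cutTest_eventuallyEq {n : ℕ} (z : ℂ) (s : ℝ) (y : E n) {x : E n} (hx : x ∈ pBall n) :
    cutTest z s y =ᶠ[𝓝 x] fun x => cutGreen n z s (coshDist y x) := by
  filter_upwards [(isOpen_pBall n).mem_nhds hx] with w hw
  exact Set.indicator_of_mem hw _

theorem isTest_cutTest {n : ℕ} (hn : 2 ≤ n) {z : ℂ} (hz : 0 ≤ z.re) {s : ℝ} (hs : 0 < s)
    {y : E n} (hy : y ∈ pBall n) : IsTest (cutTest z s y) := by
  have hy1 := mem_pBall.1 hy
  have hs2 : 0 < s ^ 2 := by positivity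
  -- `C ≥ (1 - |y|)² / (1 - |x|²)`, so `s C > 2` as soon as `1 - |x|² < m`.
  set m := (1 - ‖y‖) ^ 2 * s / 2 with hm
  have hm0 : 0 < m := by
    have : 0 < 1 - ‖y‖ := by linarith
    positivity
  set K : Set (E n) := {x | ‖x‖ ^ 2 ≤ 1 - m} with hK
  have hKb : K ⊆ pBall n := fun x hx => by
    rw [mem_pBall]
    have h : ‖x‖ ^ 2 ≤ 1 - m := hx
    nlinarith [norm_nonneg x]
  have hKcl : IsClosed K := isClosed_le (by fun_prop) continuous_const
  have hKc : IsCompact K := Metric.isCompact_of_isClosed_isBounded hKcl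
    (Metric.isBounded_ball.subset hKb)
  have hzero : ∀ x ∉ K, cutTest z s y x = 0 := by
    intro x hx
    by_cases hxb : x ∈ pBall n
    · have h : 1 - m < ‖x‖ ^ 2 := not_le.1 hx
      have h1 := one_sub_sq_pos hxb
      have h2 := mul_cosh_rho_le_coshDist hy1 le_rfl hxb
      rw [cosh_rho hxb, mul_div_assoc', div_le_iff₀ h1] at h2
      have h3 : 2 < s * coshDist y x := by
        have hC := one_le_coshDist hy hxb
        have h4 : (1 - ‖y‖) ^ 2 * s ≤ s * coshDist y x * (1 - ‖x‖ ^ 2) := by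
          have : (1 - ‖y‖) ^ 2 * 1 ≤ (1 - ‖y‖) ^ 2 * (1 + ‖x‖ ^ 2) := by
            gcongr; nlinarith [sq_nonneg ‖x‖]
          nlinarith
        have h5 : s * coshDist y x * (1 - ‖x‖ ^ 2) < s * coshDist y x * m := by
          gcongr; linarith
        have h6 : 2 * m < s * coshDist y x * m := by linarith
        exact lt_of_mul_lt_mul_right h6 hm0.le
      rw [cutTest, Set.indicator_of_mem hxb, cutGreen,
        (cutoff_eventually_zero (lt_of_lt_of_le h3 (le_abs_self _))).self_of_nhds]
      simp
    · exact Set.indicator_of_notMem hxb _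
  have hts : tsupport (cutTest z s y) ⊆ K := by
    refine closure_minimal (fun x hx => ?_) hKcl
    by_contra h
    exact hx (hzero x h)
  refine ⟨contDiff_iff_contDiffAt.2 fun x => ?_, HasCompactSupport.intro hKc hzero,
    hts.trans hKb⟩
  by_cases hx : x ∈ K
  · refine ContDiffAt.congr_of_eventuallyEq ?_ (cutTest_eventuallyEq z s y (hKb hx))
    exact ContDiffAt.comp x (contDiffAt_cutGreen hn hz (by
      linarith [one_le_coshDist hy (hKb hx)]))
      ((contDiffOn_coshDist hy).contDiffAt ((isOpen_pBall n).mem_nhds (hKb hx)))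
  · refine (contDiffAt_const (c := (0 : ℂ))).congr_of_eventuallyEq ?_
    filter_upwards [hKcl.isOpen_compl.mem_nhds hx] with w hw using hzero w hw

theorem shiftedOp_congr_nhds {n : ℕ} (κ : ℂ) {u v : E n → ℂ} {x : E n} (h : u =ᶠ[𝓝 x] v) :
    shiftedOp κ u x = shiftedOp κ v x := by
  rw [shiftedOp, shiftedOp, hypLaplacian, hypLaplacian,
    (InnerProductSpace.laplacian_congr_nhds h).self_of_nhds, h.fderiv_eq, h.self_of_nhds]

theorem shiftedOp_cutTest {n : ℕ} (hn : 2 ≤ n) {z : ℂ} (hz : 0 ≤ z.re) {s : ℝ} (hs : 0 < s)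
    {x y : E n} (hy : y ∈ pBall n) (hx : x ∈ pBall n) :
    shiftedOp (z ^ 2) (cutTest z s y) x = cutErr n z s (coshDist y x) := by
  have hs2 : 0 < s ^ 2 := by positivity
  have hC : 1 < coshDist y x + s ^ 2 := by linarith [one_le_coshDist hy hx]
  have hd0 : ∀ C : ℝ, HasDerivAt (fun C : ℝ => (cutoff (s * C) : ℂ))
      ((s * deriv cutoff (s * C) : ℝ) : ℂ) C := fun C => by
    have h1 : HasDerivAt (cutoff : ℝ → ℝ) (deriv cutoff (s * C)) (s * C) :=
      (contDiff_cutoff.differentiable (by simp)).differentiableAt.hasDerivAt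
    have h2 := (h1.comp C ((hasDerivAt_id C).const_mul s)).ofReal_comp
    refine h2.congr_deriv ?_
    push_cast; ring
  have hd1 : ∀ C : ℝ, HasDerivAt (fun C : ℝ => ((s * deriv cutoff (s * C) : ℝ) : ℂ))
      ((s ^ 2 * deriv (deriv cutoff) (s * C) : ℝ) : ℂ) C := fun C => by
    have h1 : HasDerivAt (deriv cutoff) (deriv (deriv cutoff) (s * C)) (s * C) :=
      (contDiff_deriv_cutoff.differentiable (by simp)).differentiableAt.hasDerivAt
    have h2 := ((h1.comp C ((hasDerivAt_id C).const_mul s)).const_mul s).ofReal_comp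
    refine h2.congr_deriv ?_
    push_cast; ring
  have h := hypLaplacian_comp_coshDist hy hx (q := cutGreen n z s)
    (q₁ := fun C => (s * deriv cutoff (s * C) : ℝ) * greenC n z (C + s ^ 2) +
      (cutoff (s * C) : ℂ) * (-(2 * Real.pi) * greenC (n + 2) z (C + s ^ 2)))
    (by
      have : ∀ᶠ C : ℝ in 𝓝 (coshDist y x), 1 < C + s ^ 2 :=
        (continuous_id.add continuous_const).tendsto _ |>.eventually (lt_mem_nhds hC)
      filter_upwards [this] with C h using (hd0 C).mul (hasDerivAt_greenC_shift hn hz h))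
    (((hd1 _).mul (hasDerivAt_greenC_shift hn hz hC)).add
      ((hd0 _).mul (hasDerivAt_greenC_shift_two hn hz hC)))
    ((contDiffAt_cutGreen hn hz hC).of_le two_le_infty)
  rw [shiftedOp_congr_nhds _ (cutTest_eventuallyEq z s y hx), shiftedOp, h, cutErr,
    ← regErr_eq hn hz hC, cutGreen]
  ring

/-! ### Uniqueness of square integrable solutions -/

theorem aestronglyMeasurable_prod_cutErr {n : ℕ} (hn : 2 ≤ n) {z : ℂ} (hz : 0 ≤ z.re) {s : ℝ}
    (hs : 0 < s) : AEStronglyMeasurable (fun p : E n × E n => cutErr n z s (coshDist p.1 p.2))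
      ((hypVolume n).prod (hypVolume n)) := by
  have hac : (hypVolume n).prod (hypVolume n) ≪
      (volume.prod volume).restrict (pBall n ×ˢ pBall n) := by
    rw [← Measure.prod_restrict]
    exact (hypVolume_absolutelyContinuous n).prod (hypVolume_absolutelyContinuous n)
  refine AEStronglyMeasurable.mono_ac hac ?_
  refine ContinuousOn.aestronglyMeasurable ?_ ((isOpen_pBall n).prod (isOpen_pBall n)).measurableSet
  intro p hp
  have hs2 : 0 < s ^ 2 := by positivity
  exact (ContinuousAt.comp (f := fun p : E n × E n => coshDist p.1 p.2)
    (continuousAt_cutErr hn hz (by linarith [one_le_coshDist hp.1 hp.2]))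
    (continuousAt_coshDist_prod hp.1 hp.2)).continuousWithinAt

theorem norm_cutErr_mul_le {n : ℕ} (hn : 2 ≤ n) {z : ℂ} (hz : 0 ≤ z.re) {f : E n → ℂ}
    (hf : IsContTest f) : ∃ K : ℝ, 0 ≤ K ∧ ∀ (x y : E n) (s : ℝ), x ∈ pBall n → 0 < s → s ≤ 1 / 2 →
      ‖cutErr n z s (coshDist x y) * f y‖ ≤
        K * decay z.re x * ((1 + s ^ 2 * (2 * ‖y - x‖ ^ 2 + s ^ 2) ^ (-((n : ℝ) / 2 + 1))) *
          ‖f y‖) := by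
  obtain ⟨K, hK0, hK⟩ := norm_cutErr_le hn hz
  obtain ⟨c, hc0, hc⟩ := exists_coshDist_rpow_le_decay hn hz hf.compact hf.support_subset
  refine ⟨K * c, by positivity, fun x y s hx hs hs1 => ?_⟩
  by_cases hy : y ∈ tsupport f
  · have h1 := hc x hx y hy
    rw [norm_mul]
    calc _ ≤ K * (1 + s ^ 2 * (2 * ‖y - x‖ ^ 2 + s ^ 2) ^ (-((n : ℝ) / 2 + 1))) *
          (c * decay z.re x) * ‖f y‖ := by
          gcongr
          exact (hK x y s hx (hf.support_subset hy) hs hs1).trans (by gcongr)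
      _ = _ := by ring
  · rw [image_eq_zero_of_notMem_tsupport hy]
    simp

theorem integrable_prod_cutErr {n : ℕ} (hn : 2 ≤ n) {z : ℂ} (hz : 0 < z.re) {f u : E n → ℂ}
    (hf : IsContTest f) (hu : MemLp u 2 (hypVolume n)) {s : ℝ} (hs : 0 < s) (hs1 : s ≤ 1 / 2) :
    Integrable (fun p : E n × E n => u p.1 * (cutErr n z s (coshDist p.1 p.2) * f p.2))
      ((hypVolume n).prod (hypVolume n)) := by
  obtain ⟨K, hK0, hK⟩ := norm_cutErr_mul_le hn hz.le hf
  set A := s ^ 2 * (s ^ 2) ^ (-((n : ℝ) / 2 + 1)) with hA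
  have hA0 : 0 ≤ A := by positivity
  have hdom : Integrable (fun p : E n × E n => (K * (1 + A)) * ((decay z.re p.1 * ‖u p.1‖) * ‖f p.2‖))
      ((hypVolume n).prod (hypVolume n)) :=
    (((memLp_decay hn hz).integrable_mul hu.norm).mul_prod (integrable_contTest hf).norm).const_mul _
  refine Integrable.mono' hdom (hu.1.comp_fst.mul ((aestronglyMeasurable_prod_cutErr hn hz.le hs).mul
    (hf.continuous.comp continuous_snd).aestronglyMeasurable)) ?_
  have hae : ∀ᵐ p : E n × E n ∂((hypVolume n).prod (hypVolume n)), p.1 ∈ pBall n :=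
    Measure.quasiMeasurePreserving_fst.ae (ae_mem_pBall n)
  filter_upwards [hae] with p hp
  rw [norm_mul]
  have hd := decay_nonneg z.re p.1
  have hP : s ^ 2 * (2 * ‖p.2 - p.1‖ ^ 2 + s ^ 2) ^ (-((n : ℝ) / 2 + 1)) ≤ A := by
    rw [hA]
    refine mul_le_mul_of_nonneg_left (Real.rpow_le_rpow_of_nonpos (by positivity) ?_ ?_)
      (by positivity)
    · nlinarith [sq_nonneg ‖p.2 - p.1‖]
    · have : (0 : ℝ) ≤ n := Nat.cast_nonneg n
      linarith
  calc _ ≤ ‖u p.1‖ * (K * decay z.re p.1 * ((1 + A) * ‖f p.2‖)) := by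
        gcongr
        exact (hK p.1 p.2 s hp hs hs1).trans (by gcongr)
    _ = _ := by ring

/-- The truncated kernels applied to a test function are dominated, uniformly in the truncation. -/
theorem norm_integral_cutErr_le {n : ℕ} (hn : 2 ≤ n) {z : ℂ} (hz : 0 ≤ z.re) {f : E n → ℂ}
    (hf : IsContTest f) : ∃ K : ℝ, ∀ (x : E n) (s : ℝ), x ∈ pBall n → 0 < s → s ≤ 1 / 2 →
      ‖∫ y, cutErr n z s (coshDist x y) * f y ∂(hypVolume n)‖ ≤ K * decay z.re x := by
  obtain ⟨K, hK0, hK⟩ := norm_cutErr_mul_le hn hz hf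
  obtain ⟨B, hB0, hB⟩ := exists_bound_densTest hf
  refine ⟨K * B * (volume.real (pBall n) + ∫ ζ : E n, profile ζ), fun x s hx hs hs1 => ?_⟩
  have hd := decay_nonneg z.re x
  obtain ⟨hpi, hpe⟩ := integral_scaled_profile hn x hs
  have hball : Integrable ((pBall n).indicator fun _ : E n => (1 : ℝ)) :=
    (integrable_indicator_iff (isOpen_pBall n).measurableSet).2
      (integrableOn_const measure_ball_lt_top.ne)
  rw [integral_mul_test hf]
  have key : ∀ y, ‖cutErr n z s (coshDist x y) * densTest f y‖ ≤ K * B * decay z.re x *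
      ((pBall n).indicator (fun _ => (1 : ℝ)) y +
        s ^ 2 * (2 * ‖y - x‖ ^ 2 + s ^ 2) ^ (-((n : ℝ) / 2 + 1))) := by
    intro y
    have hP : 0 ≤ s ^ 2 * (2 * ‖y - x‖ ^ 2 + s ^ 2) ^ (-((n : ℝ) / 2 + 1)) := by positivity
    by_cases hy : y ∈ pBall n
    · rw [Set.indicator_of_mem hy]
      have h1 := hK x y s hx hs hs1
      have h2 := hB y
      have h3 := (hypDens_pos hy).le
      rw [densTest, norm_smul, Real.norm_of_nonneg h3] at h2
      rw [densTest, norm_mul, norm_smul, Real.norm_of_nonneg h3]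
      rw [norm_mul] at h1
      calc _ = hypDens y * (‖cutErr n z s (coshDist x y)‖ * ‖f y‖) := by ring
        _ ≤ hypDens y * (K * decay z.re x *
          ((1 + s ^ 2 * (2 * ‖y - x‖ ^ 2 + s ^ 2) ^ (-((n : ℝ) / 2 + 1))) * ‖f y‖)) := by gcongr
        _ = K * decay z.re x *
          (1 + s ^ 2 * (2 * ‖y - x‖ ^ 2 + s ^ 2) ^ (-((n : ℝ) / 2 + 1))) *
            (hypDens y * ‖f y‖) := by ring
        _ ≤ K * decay z.re x *
          (1 + s ^ 2 * (2 * ‖y - x‖ ^ 2 + s ^ 2) ^ (-((n : ℝ) / 2 + 1))) * B := by gcongr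
        _ = _ := by ring
    · rw [densTest_eq_zero fun h => hy (hf.support_subset h), mul_zero, norm_zero,
        Set.indicator_of_notMem hy]
      positivity
  refine (norm_integral_le_of_norm_le ((hball.add hpi).const_mul _)
    (Eventually.of_forall key)).trans_eq ?_
  rw [integral_const_mul]
  simp only [Pi.add_apply]
  rw [integral_add hball hpi, hpe,
    integral_indicator_const _ (isOpen_pBall n).measurableSet, smul_eq_mul, mul_one]
  ring

theorem tendsto_integral_cutErr {n : ℕ} (hn : 2 ≤ n) {z : ℂ} (hz : 0 ≤ z.re) {x : E n}
    (hx : x ∈ pBall n) {f : E n → ℂ} (hf : IsContTest f) :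
    Tendsto (fun s : ℝ => ∫ y, cutErr n z s (coshDist x y) * f y ∂(hypVolume n)) (𝓝[>] 0)
      (𝓝 (f x)) := by
  obtain ⟨M, hM1, hM⟩ := exists_bound_coshDist hx hf.compact hf.support_subset
  -- For small `s` the cutoff is one on the support of `f`.
  refine (tendsto_integral_regErr hn hz hx hf).congr' ?_
  have hM0 : 0 < M⁻¹ := by positivity
  filter_upwards [Ioo_mem_nhdsGT hM0] with s hs
  refine integral_congr_ae (Eventually.of_forall fun y => ?_)
  by_cases hy : y ∈ tsupport f
  · have hC := one_le_coshDist hx (hf.support_subset hy)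
    have h : |s * coshDist x y| < 1 := by
      rw [abs_of_pos (mul_pos hs.1 (by linarith))]
      calc s * coshDist x y ≤ s * M := mul_le_mul_of_nonneg_left (hM y hy) hs.1.le
        _ < M⁻¹ * M := mul_lt_mul_of_pos_right hs.2 (by linarith)
        _ = 1 := inv_mul_cancel₀ (by linarith)
    simp only [cutErr_eq_regErr n z h]
  · simp only [image_eq_zero_of_notMem_tsupport hy, mul_zero]

/-- A square integrable solution of the homogeneous equation is orthogonal to all test functions. -/
theorem integral_mul_eq_zero_of_homogeneous {n : ℕ} (hn : 2 ≤ n) {z : ℂ} (hz : 0 < z.re)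
    {u : E n → ℂ} (hu : MemLp u 2 (hypVolume n))
    (h0 : ∀ φ : E n → ℂ, IsTest φ → ∫ x, u x * shiftedOp (z ^ 2) φ x ∂(hypVolume n) = 0)
    {f : E n → ℂ} (hf : IsContTest f) : ∫ x, u x * f x ∂(hypVolume n) = 0 := by
  have hsmall : ∀ᶠ s : ℝ in 𝓝[>] 0, 0 < s ∧ s < 1 / 2 := Ioo_mem_nhdsGT (by norm_num)
  obtain ⟨K, hK⟩ := norm_integral_cutErr_le hn hz.le hf
  have hlim : Tendsto (fun s : ℝ => ∫ x, ∫ y, u x * (cutErr n z s (coshDist x y) * f y)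
      ∂(hypVolume n) ∂(hypVolume n)) (𝓝[>] 0) (𝓝 (∫ x, u x * f x ∂(hypVolume n))) := by
    refine tendsto_integral_filter_of_dominated_convergence
      (fun x => K * (decay z.re x * ‖u x‖)) ?_ ?_
      (((memLp_decay hn hz).integrable_mul hu.norm).const_mul K) ?_
    · filter_upwards [hsmall] with s hs
      exact (integrable_prod_cutErr hn hz hf hu hs.1 hs.2.le).1.integral_prod_right'
    · filter_upwards [hsmall] with s hs
      filter_upwards [ae_mem_pBall n] with x hx
      rw [integral_const_mul, norm_mul, mul_comm, ← mul_assoc]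
      exact mul_le_mul_of_nonneg_right (hK x s hx hs.1 hs.2.le) (norm_nonneg _)
    · filter_upwards [ae_mem_pBall n] with x hx
      simp only [integral_const_mul]
      exact (tendsto_integral_cutErr hn hz.le hx hf).const_mul (u x)
  refine tendsto_nhds_unique hlim (tendsto_const_nhds.congr' ?_)
  filter_upwards [hsmall] with s hs
  -- For fixed `y`, the integral in `x` is the weak equation tested against `cutTest z s y`.
  rw [integral_integral_swap (integrable_prod_cutErr hn hz hf hu hs.1 hs.2.le)]
  refine (integral_eq_zero_of_ae ?_).symm
  filter_upwards [ae_mem_pBall n] with y hy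
  have h := h0 _ (isTest_cutTest hn hz.le hs.1 hy)
  have h1 : ∫ x, u x * shiftedOp (z ^ 2) (cutTest z s y) x ∂(hypVolume n) =
      ∫ x, u x * cutErr n z s (coshDist x y) ∂(hypVolume n) := by
    refine integral_congr_ae ?_
    filter_upwards [ae_mem_pBall n] with x hx
    rw [shiftedOp_cutTest hn hz.le hs.1 hy hx, coshDist_comm]
  simp only [← mul_assoc, integral_mul_const]
  rw [← h1, h, zero_mul, Pi.zero_apply]

theorem ae_eq_of_isL2Solution {n : ℕ} (hn : 2 ≤ n) {z : ℂ} (hz : 0 < z.re) {f u v : E n → ℂ}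
    (hu : IsL2Solution (z ^ 2) f u) (hv : IsL2Solution (z ^ 2) f v) : u =ᵐ[hypVolume n] v := by
  have huv : MemLp (u - v) 2 (hypVolume n) := hu.1.sub hv.1
  have h0 : ∀ φ : E n → ℂ, IsTest φ →
      ∫ x, (u - v) x * shiftedOp (z ^ 2) φ x ∂(hypVolume n) = 0 := fun φ hφ => by
    have hL := memLp_contTest (hφ.isContTest_shiftedOp (z ^ 2))
    simp only [Pi.sub_apply, sub_mul]
    refine (integral_sub (hu.1.integrable_mul hL) (hv.1.integrable_mul hL)).trans ?_
    exact sub_eq_zero.2 ((hu.2 φ hφ).trans (hv.2 φ hφ).symm)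
  have hz0 := (isOpen_pBall n).ae_eq_zero_of_integral_contDiff_smul_eq_zero
    (locallyIntegrableOn_of_memLp_two huv) fun g hg hgc hgs => by
      have hgt : IsContTest fun x => (g x : ℂ) := by
        have hsupp : tsupport (fun x => (g x : ℂ)) ⊆ tsupport g :=
          tsupport_comp_subset Complex.ofReal_zero g
        exact ⟨Complex.continuous_ofReal.comp hg.continuous,
          hgc.comp_left Complex.ofReal_zero, hsupp.trans hgs⟩
      refine Eq.trans (integral_congr_ae (Eventually.of_forall fun x => ?_))
        (integral_mul_eq_zero_of_homogeneous hn hz huv h0 hgt)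
      simp only [Complex.real_smul, mul_comm]
  filter_upwards [hz0, ae_mem_pBall n] with x h1 h2
  exact sub_eq_zero.1 (h1 h2)

/-! ### Limiting absorption -/

theorem isResolventKernel_green {n : ℕ} (hn : 2 ≤ n) {z : ℂ} (hz : 0 < z.re) :
    IsResolventKernel (n := n) (z ^ 2) fun x y => green n z (hypDist x y) := by
  intro f hf
  have hfc := hf.isContTest
  have hae : (fun x => ∫ y, greenC n z (coshDist x y) * f y ∂(hypVolume n)) =ᵐ[hypVolume n]
      fun x => ∫ y, green n z (hypDist x y) * f y ∂(hypVolume n) := by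
    filter_upwards [ae_mem_pBall n] with x hx using (integral_green_mul hn z hx f).symm
  have hsol := isL2Solution_greenC hn hz hf
  have hsol' : IsL2Solution (z ^ 2) f
      (fun x => ∫ y, green n z (hypDist x y) * f y ∂(hypVolume n)) := by
    refine ⟨hsol.1.ae_eq hae, fun φ hφ => (integral_congr_ae ?_).trans (hsol.2 φ hφ)⟩
    filter_upwards [hae] with x hx
    rw [hx]
  refine ⟨fun x hx => (integrable_greenC_mul_test hn hz.le hx hfc).congr ?_, hsol', fun v hv =>
    ae_eq_of_isL2Solution hn hz hv hsol'⟩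
  filter_upwards [green_hypDist_ae hn z hx] with y hy
  rw [hy]

theorem isLimitingAbsorption_of_re_eq_zero {n : ℕ} (hn : 2 ≤ n) {w : ℂ} (hw : w.re = 0) :
    IsLimitingAbsorption n w :=
  ⟨fun _ hε => isResolventKernel_green hn (by simpa [hw] using hε),
    fun _ hρ => tendsto_green_absorption hn hw hρ,
    fun _ hf _ hx => tendsto_integral_green_absorption hn hw hf.isContTest hx⟩

end HypScattering

theorem theorem2p2 (n : ℕ) (hn : 2 ≤ n) (μ : ℝ) (hμ : 0 < μ) :
    -- limiting absorption, for both choices of sign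
    (HypScattering.IsLimitingAbsorption n (-((μ : ℂ) * Complex.I)) ∧
      HypScattering.IsLimitingAbsorption n ((μ : ℂ) * Complex.I)) ∧
    -- singularity at the origin
    (HypScattering.IsFundamentalSolution (-(μ : ℂ) ^ 2) (0 : HypScattering.E n)
        (fun y => HypScattering.green n (-((μ : ℂ) * Complex.I)) (HypScattering.rho y)) ∧
      (fun y : HypScattering.E n =>
          HypScattering.green n (-((μ : ℂ) * Complex.I)) (HypScattering.rho y))
        =O[HypScattering.atInfinity n]
          (fun y => Real.sinh (HypScattering.rho y) ^ (-((n : ℝ) - 1) / 2)) ∧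
      HypScattering.IsFundamentalSolution (-(μ : ℂ) ^ 2) (0 : HypScattering.E n)
        (fun y => HypScattering.green n ((μ : ℂ) * Complex.I) (HypScattering.rho y)) ∧
      (fun y : HypScattering.E n =>
          HypScattering.green n ((μ : ℂ) * Complex.I) (HypScattering.rho y))
        =O[HypScattering.atInfinity n]
          (fun y => Real.sinh (HypScattering.rho y) ^ (-((n : ℝ) - 1) / 2))) ∧
    -- singularity at an arbitrary point, and the outgoing / ingoing behaviour
    (∀ x ∈ HypScattering.pBall n,
      (HypScattering.IsFundamentalSolution (-(μ : ℂ) ^ 2) x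
          (fun y => HypScattering.green n (-((μ : ℂ) * Complex.I)) (HypScattering.hypDist x y)) ∧
        (fun y => HypScattering.green n (-((μ : ℂ) * Complex.I)) (HypScattering.hypDist x y))
          =O[HypScattering.atInfinity n]
            (fun y => Real.sinh (HypScattering.rho y) ^ (-((n : ℝ) - 1) / 2)) ∧
        HypScattering.IsOutgoing μ
          (fun y => HypScattering.green n (-((μ : ℂ) * Complex.I)) (HypScattering.hypDist x y))) ∧
      (HypScattering.IsFundamentalSolution (-(μ : ℂ) ^ 2) x
          (fun y => HypScattering.green n ((μ : ℂ) * Complex.I) (HypScattering.hypDist x y)) ∧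
        (fun y => HypScattering.green n ((μ : ℂ) * Complex.I) (HypScattering.hypDist x y))
          =O[HypScattering.atInfinity n]
            (fun y => Real.sinh (HypScattering.rho y) ^ (-((n : ℝ) - 1) / 2)) ∧
        HypScattering.IsIngoing μ
          (fun y => HypScattering.green n ((μ : ℂ) * Complex.I) (HypScattering.hypDist x y)))) := by
  have hκ₁ : (-((μ : ℂ) * Complex.I)) ^ 2 = -(μ : ℂ) ^ 2 := by
    rw [neg_sq, mul_pow, Complex.I_sq, mul_neg_one]
  have hκ₂ : ((μ : ℂ) * Complex.I) ^ 2 = -(μ : ℂ) ^ 2 := by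
    rw [mul_pow, Complex.I_sq, mul_neg_one]
  have hre₁ : (-((μ : ℂ) * Complex.I)).re = 0 := by simp
  have hre₂ : ((μ : ℂ) * Complex.I).re = 0 := by simp
  have h0 : (0 : HypScattering.E n) ∈ HypScattering.pBall n := by
    simp [HypScattering.mem_pBall]
  have fund := fun (x : HypScattering.E n) (hx : x ∈ HypScattering.pBall n) =>
    And.intro (hκ₁ ▸ HypScattering.isFundamentalSolution_green hn hre₁.ge hx)
      (hκ₂ ▸ HypScattering.isFundamentalSolution_green hn hre₂.ge hx)
  have hO := fun (x : HypScattering.E n) (hx : x ∈ HypScattering.pBall n) =>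
    And.intro (HypScattering.isBigO_green hn hre₁.ge hx) (HypScattering.isBigO_green hn hre₂.ge hx)
  refine ⟨⟨HypScattering.isLimitingAbsorption_of_re_eq_zero hn hre₁,
    HypScattering.isLimitingAbsorption_of_re_eq_zero hn hre₂⟩, ?_, fun x hx => ⟨⟨(fund x hx).1,
      (hO x hx).1, HypScattering.isOutgoing_green hn μ hx⟩, (fund x hx).2, (hO x hx).2,
      HypScattering.isIngoing_green hn μ hx⟩⟩
  have hf := fund 0 h0
  have hb := hO 0 h0
  simp only [HypScattering.hypDist_zero] at hf hb
  exact ⟨hf.1, hb.1, hf.2, hb.2⟩
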